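/- Let $M$ be a smooth Riemannian manifold, let $\Gamma$ be a compact Lie group acting smoothly and isometrically on $M$, and let $E \to M$ be a smooth complex vector bundle of finite rank with a smooth Hermitian metric and a smooth action of $\Gamma$ on $E$, covering the action on $M$, by linear isometries of the fibres. Let $S^*M$ be the unit cosphere bundle of $M$, on which $\Gamma$ acts by $\gamma\cdot(x,\xi) = (\gamma x, \xi\circ(d_x\gamma)^{-1})$, and let $\Gamma_\xi$ be the stabilizer of $\xi\in S^*M$. Let $A_M^\Gamma := \mathcal C_0(S^*M;\operatorname{End}(E))^\Gamma$ be the algebra of $\Gamma$-invariant continuous sections, vanishing at infinity, of the lift of $\operatorname{End}(E)$ to $S^*M$, and let $Z_M := \mathcal C_0(S^*M)^\Gamma$, which maps to the centre of $A_M^\Gamma$ by $z\mapsto z\cdot\mathrm{id}_E$. For a C*-algebra $A$, let $\operatorname{Prim}(A)$ be the set of kernels of nonzero irreducible $*$-representations of $A$, with the hull-kernel topology. Consider the pairs $(\xi,\rho)$ with $\xi\in S^*_xM$, $x \in M$, and $\rho\in\widehat\Gamma_\xi$ (an equivalence class of irreducible unitary representations of $\Gamma_\xi$) occurring in the fibre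 $E_x$, i.e. $\operatorname{Hom}_{\Gamma_\xi}(\rho,E_x)\neq 0$. The group $\Gamma$ acts on these pairs by $\gamma(\xi,\rho) = (\gamma\xi,\ \rho(\gamma^{-1}\,\cdot\,\gamma))$. Then: 1. There is a bijection from the set of $\Gamma$-orbits of such pairs onto $\operatorname{Prim}(A_M^\Gamma)$ that sends $\Gamma(\xi,\rho)$ to $\{f\in A_M^\Gamma : f(\xi)|_{E_{x\rho}} = 0\}$, where $E_{x\rho}$ is the $\rho$-isotypical component of $E_x$. 2. The map $\Gamma\xi\mapsto\{z\in Z_M : z(\xi)=0\}$ is a homeomorphism $S^*M/\Gamma\to\operatorname{Prim}(Z_M)$. In every irreducible $*$-representation $\pi$ of $A_M^\Gamma$, the algebra $Z_M$ acts by scalars through a character $\omega_\pi : Z_M \to \mathbb C$, and $\ker\pi\mapsto\ker\omega_\pi$ is a well-defined map $\operatorname{Prim}(A_M^\Gamma)\to\operatorname{Prim}(Z_M) = S^*M/\Gamma$ (the central character map). This map is continuous and finite-to-one, and it sends the primitive ideal corresponding to the orbit $\Gamma(\xi,\rho)$ to the orbit $\Gamma\xi$. -/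

import Mathlib

open Bundle Manifold Topology Filter
open scoped ContDiff ZeroAtInfty

noncomputable section

namespace EquivSymbol

universe u

/-! ### Primitive ideals of complex `*`-algebras -/

section Prim

/-- A `*`-representation on a Hilbert space is irreducible if it is nonzero and has no closed
invariant subspaces besides `0` and the whole space. (A `*`-representation of a C*-algebra is
automatically bounded, so no norm on `A` is needed.) -/
structure IsIrreducibleRep {A : Type*} [NonUnitalRing A] [StarRing A] [Module ℂ A]
    {H : Type*} [NormedAddCommGroup H] [InnerProductSpace ℂ H] [CompleteSpace H]
    (r : A →⋆ₙₐ[ℂ] (H →L[ℂ] H)) : Prop where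
  ne_zero : ∃ a, r a ≠ 0
  eq_bot_or_eq_top : ∀ K : Submodule ℂ H, IsClosed (K : Set H) →
    (∀ a, ∀ v ∈ K, r a v ∈ K) → K = ⊥ ∨ K = ⊤

/-- A two-sided ideal is primitive if it is the kernel of an irreducible `*`-representation. -/
def IsPrimitiveIdeal {A : Type u} [NonUnitalRing A] [StarRing A] [Module ℂ A]
    (P : TwoSidedIdeal A) : Prop :=
  ∃ (H : Type u) (_ : NormedAddCommGroup H) (_ : InnerProductSpace ℂ H) (_ : CompleteSpace H)
    (r : A →⋆ₙₐ[ℂ] (H →L[ℂ] H)), IsIrreducibleRep r ∧ P = TwoSidedIdeal.ker r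

/-- The primitive ideal spectrum. -/
def Prim (A : Type u) [NonUnitalRing A] [StarRing A] [Module ℂ A] : Type u :=
  {P : TwoSidedIdeal A // IsPrimitiveIdeal P}

variable {A : Type u} [NonUnitalRing A] [StarRing A] [Module ℂ A]

theorem IsPrimitiveIdeal.le_or_le {P : TwoSidedIdeal A} (hP : IsPrimitiveIdeal P)
    {J₁ J₂ : TwoSidedIdeal A} (h : J₁ ⊓ J₂ ≤ P) : J₁ ≤ P ∨ J₂ ≤ P := by
  obtain ⟨H, _, _, _, r, hr, rfl⟩ := hP
  by_contra! hc
  obtain ⟨h1, h2⟩ := hc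
  obtain ⟨a, ha, ha'⟩ := SetLike.not_le_iff_exists.1 h1
  obtain ⟨b, hb, hb'⟩ := SetLike.not_le_iff_exists.1 h2
  rw [TwoSidedIdeal.mem_ker] at ha' hb'
  have hab : ∀ x, r a * r x * r b = 0 := by
    intro x
    have : a * x * b ∈ J₁ ⊓ J₂ :=
      (TwoSidedIdeal.mem_inf _).2 ⟨J₁.mul_mem_right _ _ (J₁.mul_mem_right _ _ ha),
        J₂.mul_mem_left _ _ hb⟩
    simpa [TwoSidedIdeal.mem_ker] using h this
  let K : Submodule ℂ H := ⨅ x : A, LinearMap.ker ((r a * r x : H →L[ℂ] H) : H →ₗ[ℂ] H)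
  have hK : IsClosed (K : Set H) := by
    simp only [K, Submodule.coe_iInf]
    exact isClosed_iInter fun x => ContinuousLinearMap.isClosed_ker (r a * r x)
  have memK : ∀ v, v ∈ K ↔ ∀ x, r a (r x v) = 0 := by
    intro v; simp [K]
  have hinv : ∀ c, ∀ v ∈ K, r c v ∈ K := by
    intro c v hv
    rw [memK] at hv ⊢
    intro x
    simpa using hv (x * c)
  obtain ⟨v, hv⟩ : ∃ v, r b v ≠ 0 := by
    by_contra! hz
    exact hb' (ContinuousLinearMap.ext hz)
  have hbv : r b v ∈ K := by
    rw [memK]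
    intro x
    simpa using congrArg (fun T : H →L[ℂ] H => T v) (hab x)
  rcases hr.eq_bot_or_eq_top K hK hinv with hbot | htop
  · rw [hbot] at hbv
    exact hv (by simpa using hbv)
  · apply ha'
    have hz : r a * star (r a) = 0 := by
      ext w
      have : w ∈ K := by rw [htop]; trivial
      rw [memK] at this
      simpa [map_star] using this (star a)
    exact (CStarRing.mul_star_self_eq_zero_iff _).1 hz

/-- The Jacobson (hull-kernel) topology: the open sets are the sets `{P | ¬ J ≤ P}` for two-sided
ideals `J`. (Primitive ideals of a C*-algebra are closed, so `J` and its closure define the same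
set.) -/
instance : TopologicalSpace (Prim A) where
  IsOpen U := ∃ J : TwoSidedIdeal A, U = {P | ¬ J ≤ P.1}
  isOpen_univ := by
    refine ⟨⊤, ?_⟩
    ext P
    simp only [Set.mem_univ, Set.mem_ofPred_eq, true_iff]
    intro h
    obtain ⟨H, _, _, _, r, hr, hP⟩ := P.2
    obtain ⟨a, ha⟩ := hr.ne_zero
    apply ha
    rw [← TwoSidedIdeal.mem_ker, ← hP]
    exact h (show a ∈ (⊤ : TwoSidedIdeal A) from trivial)
  isOpen_inter := by
    rintro _ _ ⟨J₁, rfl⟩ ⟨J₂, rfl⟩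
    refine ⟨J₁ ⊓ J₂, ?_⟩
    ext P
    simp only [Set.mem_inter_iff, Set.mem_ofPred_eq]
    constructor
    · rintro ⟨h1, h2⟩ h
      exact (P.2.le_or_le h).elim h1 h2
    · intro h
      exact ⟨fun h1 => h (inf_le_left.trans h1), fun h2 => h (inf_le_right.trans h2)⟩
  isOpen_sUnion := by
    intro S hS
    refine ⟨sSup {J | {P : Prim A | ¬ J ≤ P.1} ∈ S}, ?_⟩
    ext P
    simp only [Set.mem_sUnion, Set.mem_ofPred_eq, sSup_le_iff]
    push Not
    constructor
    · rintro ⟨U, hU, hPU⟩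
      obtain ⟨J, rfl⟩ := hS U hU
      exact ⟨J, hU, hPU⟩
    · rintro ⟨J, hJ, hP⟩
      exact ⟨_, hJ, hP⟩

/-- The central character map of a central `*`-morphism `φ : Z → A`, given by Schur's lemma: in
every irreducible representation `r` of `A` the algebra `Z` acts through a character `c`, and the
primitive ideal `ker r` is sent to `ker c`. -/
def IsCentralCharacterMap {Z : Type*} [NonUnitalRing Z] [StarRing Z] [Module ℂ Z]
    (φ : Z →⋆ₙₐ[ℂ] A) (χ : Prim A → Prim Z) : Prop :=
  ∀ (H : Type u) [NormedAddCommGroup H] [InnerProductSpace ℂ H] [CompleteSpace H]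
    (r : A →⋆ₙₐ[ℂ] (H →L[ℂ] H)) (hr : IsIrreducibleRep r),
    ∃ c : Z →⋆ₙₐ[ℂ] ℂ, (∀ z, r (φ z) = c z • ContinuousLinearMap.id ℂ H) ∧
      (χ ⟨TwoSidedIdeal.ker r, H, _, _, _, r, hr, rfl⟩).1 = TwoSidedIdeal.ker c

end Prim

/-! ### Irreducible unitary representations -/

/-- A (strongly continuous) irreducible unitary representation of a topological group on a space
`ℂⁿ`. For a compact group every irreducible unitary representation is finite dimensional, so
up to equivalence these are all of them. -/
structure Irrep (G : Type*) [Group G] [TopologicalSpace G] where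
  dim : ℕ
  rep : Representation ℂ G (EuclideanSpace ℂ (Fin dim))
  norm_rep : ∀ g v, ‖rep g v‖ = ‖v‖
  continuous_rep : ∀ v, Continuous fun g => rep g v
  irreducible : rep.IsIrreducible

/-! ### The cotangent bundle and the unit cosphere bundle of a Riemannian `Γ`-manifold -/

section Cosphere

variable (V M : Type*) [NormedAddCommGroup V] [NormedSpace ℝ V]
  [TopologicalSpace M] [ChartedSpace V M]

/-- The total space of the cotangent bundle of `M`. -/
abbrev Cotangent : Type _ :=
  TotalSpace (V →L[ℝ] ℝ) (fun x : M => TangentSpace 𝓘(ℝ, V) x →L[ℝ] ℝ)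

variable {V M}

/-- The map `(x, ξ) ↦ (f x, ξ ∘ (d_x f)⁻¹)` on the cotangent bundle induced by `f : M → M`. -/
def cotangentMap (f : M → M) (p : Cotangent V M) : Cotangent V M :=
  ⟨f p.1, p.2.comp (mfderiv 𝓘(ℝ, V) 𝓘(ℝ, V) f p.1).inverse⟩

theorem cotangentMap_id (p : Cotangent V M) : cotangentMap id p = p := by
  obtain ⟨x, ξ⟩ := p
  simp only [cotangentMap, mfderiv_id]
  rw [ContinuousLinearMap.inverse_id]
  rfl

theorem cotangentMap_comp {f g : M → M} {p : Cotangent V M}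
    (hf : MDifferentiableAt 𝓘(ℝ, V) 𝓘(ℝ, V) f (g p.1))
    (hg : MDifferentiableAt 𝓘(ℝ, V) 𝓘(ℝ, V) g p.1)
    (hf' : (mfderiv 𝓘(ℝ, V) 𝓘(ℝ, V) f (g p.1)).IsInvertible) :
    cotangentMap (f ∘ g) p = cotangentMap f (cotangentMap g p) := by
  obtain ⟨x, ξ⟩ := p
  simp only [cotangentMap]
  rw [mfderiv_comp x hf hg, hf'.inverse_comp_of_left]
  rfl

variable {Γ : Type*} [Group Γ] [MulAction Γ M]
  [RiemannianBundle (fun x : M => TangentSpace 𝓘(ℝ, V) x)]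

variable (V M Γ) in
/-- The group `Γ` acts on the Riemannian manifold `M` by smooth isometries. -/
class IsIsometricAction : Prop where
  contMDiff_smul : ∀ γ : Γ, ContMDiff 𝓘(ℝ, V) 𝓘(ℝ, V) ∞ (fun x : M => γ • x)
  norm_mfderiv : ∀ (γ : Γ) (x : M) (v : TangentSpace 𝓘(ℝ, V) x),
    ‖mfderiv 𝓘(ℝ, V) 𝓘(ℝ, V) (fun y : M => γ • y) x v‖ = ‖v‖

theorem mdifferentiable_smul [IsIsometricAction V M Γ] (γ : Γ) :
    MDifferentiable 𝓘(ℝ, V) 𝓘(ℝ, V) (fun x : M => γ • x) :=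
  (IsIsometricAction.contMDiff_smul γ).mdifferentiable (by simp)

theorem isInvertible_mfderiv_smul [IsIsometricAction V M Γ] (γ : Γ) (x : M) :
    (mfderiv 𝓘(ℝ, V) 𝓘(ℝ, V) (fun x : M => γ • x) x).IsInvertible := by
  have h1 := mdifferentiable_smul (V := V) (M := M) γ
  have h2 := mdifferentiable_smul (V := V) (M := M) γ⁻¹
  have e1 : (fun x : M => γ⁻¹ • x) ∘ (fun x : M => γ • x) = id := by ext; simp
  have e2 : (fun x : M => γ • x) ∘ (fun x : M => γ⁻¹ • x) = id := by ext; simp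
  have k1 := mfderiv_comp x (h2 (γ • x)) (h1 x)
  have k2 := mfderiv_comp (γ • x) (h1 (γ⁻¹ • γ • x)) (h2 (γ • x))
  rw [e1, mfderiv_id] at k1
  rw [e2, mfderiv_id] at k2
  have key : ∀ y, y = x → (mfderiv 𝓘(ℝ, V) 𝓘(ℝ, V) (fun x : M => γ • x) y : V →L[ℝ] V) =
      (mfderiv 𝓘(ℝ, V) 𝓘(ℝ, V) (fun x : M => γ • x) x : V →L[ℝ] V) := by
    rintro y rfl; rfl
  have k3 := key (γ⁻¹ • γ • x) (by simp)
  refine ContinuousLinearMap.IsInvertible.of_inverse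
    (g := mfderiv 𝓘(ℝ, V) 𝓘(ℝ, V) (fun x : M => γ⁻¹ • x) (γ • x)) ?_ ?_
  · ext v
    have := congrArg (fun T : V →L[ℝ] V => T v) k2
    have h3 := congrArg (fun T : V →L[ℝ] V =>
      T (mfderiv 𝓘(ℝ, V) 𝓘(ℝ, V) (fun x : M => γ⁻¹ • x) (γ • x) v)) k3
    exact h3.symm.trans this.symm
  · exact k1.symm

/-- The action of `Γ` on the cotangent bundle, `γ • (x, ξ) = (γ x, ξ ∘ (d_x γ)⁻¹)`. -/
instance [IsIsometricAction V M Γ] : MulAction Γ (Cotangent V M) where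
  smul γ p := cotangentMap (fun x : M => γ • x) p
  one_smul p := by
    have : (fun x : M => (1 : Γ) • x) = id := by ext; simp
    change cotangentMap (fun x : M => (1 : Γ) • x) p = p
    rw [this, cotangentMap_id]
  mul_smul γ δ p := by
    have : (fun x : M => (γ * δ) • x) = (fun x : M => γ • x) ∘ (fun x : M => δ • x) := by
      ext; simp [mul_smul]
    change cotangentMap (fun x : M => (γ * δ) • x) p = cotangentMap _ (cotangentMap _ p)
    rw [this, cotangentMap_comp (mdifferentiable_smul γ _) (mdifferentiable_smul δ _)
      (isInvertible_mfderiv_smul γ _)]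

theorem norm_smul_cotangent [IsIsometricAction V M Γ] (γ : Γ) (p : Cotangent V M) :
    ‖(γ • p).2‖ = ‖p.2‖ := by
  obtain ⟨e, he⟩ := isInvertible_mfderiv_smul (V := V) γ p.1
  have hn : ∀ v, ‖e v‖ = ‖v‖ := by
    intro v
    have := IsIsometricAction.norm_mfderiv (V := V) γ p.1 v
    rwa [← he] at this
  let e' : TangentSpace 𝓘(ℝ, V) p.1 ≃ₗᵢ[ℝ] TangentSpace 𝓘(ℝ, V) (γ • p.1) :=
    { e.toLinearEquiv with norm_map' := hn }
  change ‖(cotangentMap (fun x : M => γ • x) p).2‖ = ‖p.2‖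
  simp only [cotangentMap]
  rw [← he, ContinuousLinearMap.inverse_equiv]
  exact ContinuousLinearMap.opNorm_comp_linearIsometryEquiv p.2 e'.symm

variable (V M) in
/-- The unit cosphere bundle `S*M`: covectors of norm one for the dual of the Riemannian metric. -/
def Cosphere : Type _ := {p : Cotangent V M // ‖p.2‖ = 1}

/-- The base point of a covector. -/
def Cosphere.base (ξ : Cosphere V M) : M := ξ.1.1

instance [IsIsometricAction V M Γ] : MulAction Γ (Cosphere V M) where
  smul γ ξ := ⟨γ • ξ.1, by rw [norm_smul_cotangent, ξ.2]⟩
  one_smul ξ := Subtype.ext (one_smul Γ ξ.1)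
  mul_smul γ δ ξ := Subtype.ext (mul_smul γ δ ξ.1)

theorem base_smul [IsIsometricAction V M Γ] (γ : Γ) (ξ : Cosphere V M) :
    (γ • ξ).base = γ • ξ.base := rfl

variable [IsManifold 𝓘(ℝ, V) ∞ M]

instance : TopologicalSpace (Cosphere V M) :=
  inferInstanceAs (TopologicalSpace {p : Cotangent V M // ‖p.2‖ = 1})

theorem continuous_base : Continuous (Cosphere.base : Cosphere V M → M) :=
  (FiberBundle.continuous_proj (V →L[ℝ] ℝ)
    (fun x : M => TangentSpace 𝓘(ℝ, V) x →L[ℝ] ℝ)).comp continuous_subtype_val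

end Cosphere

/-! ### Continuous sections of `End E` along a map -/

section EndSections

variable {M : Type*} [TopologicalSpace M]
  {F : Type*} [NormedAddCommGroup F] [InnerProductSpace ℂ F]
  {E : M → Type*} [TopologicalSpace (TotalSpace F E)] [∀ x, NormedAddCommGroup (E x)]
  [∀ x, InnerProductSpace ℂ (E x)] [FiberBundle F E] [VectorBundle ℂ F E]
  {X : Type*} [TopologicalSpace X] {b : X → M}

variable (F) in
/-- A section `f` of the pull-back of `End E` along `b : X → M` is continuous. -/
def ContinuousEnd (f : ∀ ξ, E (b ξ) →L[ℂ] E (b ξ)) : Prop :=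
  Continuous fun ξ => (⟨b ξ, f ξ⟩ : TotalSpace (F →L[ℂ] F) (fun x => E x →L[ℂ] E x))

theorem continuousEnd_iff (hb : Continuous b) (f : ∀ ξ, E (b ξ) →L[ℂ] E (b ξ)) :
    ContinuousEnd F f ↔ ∀ ξ₀, ContinuousAt (fun ξ =>
      ContinuousLinearMap.inCoordinates F E F E (b ξ₀) (b ξ) (b ξ₀) (b ξ) (f ξ)) ξ₀ := by
  unfold ContinuousEnd
  rw [continuous_iff_continuousAt]
  refine forall_congr' fun ξ₀ => ?_
  rw [continuousAt_hom_bundle]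
  exact ⟨fun h => h.2, fun h => ⟨hb.continuousAt, h⟩⟩

theorem ContinuousEnd.add (hb : Continuous b) {f g : ∀ ξ, E (b ξ) →L[ℂ] E (b ξ)}
    (hf : ContinuousEnd F f) (hg : ContinuousEnd F g) : ContinuousEnd F (f + g) := by
  rw [continuousEnd_iff hb] at *
  intro ξ₀
  refine ((hf ξ₀).add (hg ξ₀)).congr (Eventually.of_forall fun ξ => ?_)
  ext v
  simp [ContinuousLinearMap.inCoordinates]

theorem continuousEnd_scalar (hb : Continuous b) {z : X → ℂ} (hz : Continuous z) :
    ContinuousEnd F (fun ξ => z ξ • ContinuousLinearMap.id ℂ (E (b ξ))) := by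
  rw [continuousEnd_iff hb]
  intro ξ₀
  have h : ContinuousAt (fun ξ => z ξ • ContinuousLinearMap.id ℂ F) ξ₀ :=
    (hz.smul continuous_const).continuousAt
  refine h.congr ?_
  filter_upwards [hb.continuousAt.preimage_mem_nhds
    ((trivializationAt F E (b ξ₀)).open_baseSet.mem_nhds (mem_baseSet_trivializationAt F E (b ξ₀)))]
    with ξ hξ
  rw [ContinuousLinearMap.inCoordinates_eq hξ hξ]
  ext v
  simp

theorem ContinuousEnd.mul (hb : Continuous b) {f g : ∀ ξ, E (b ξ) →L[ℂ] E (b ξ)}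
    (hf : ContinuousEnd F f) (hg : ContinuousEnd F g) : ContinuousEnd F (f * g) := by
  rw [continuousEnd_iff hb] at *
  intro ξ₀
  refine ((hf ξ₀).clm_comp (hg ξ₀)).congr ?_
  filter_upwards [hb.continuousAt.preimage_mem_nhds
    ((trivializationAt F E (b ξ₀)).open_baseSet.mem_nhds (mem_baseSet_trivializationAt F E (b ξ₀)))]
    with ξ hξ
  simp only [ContinuousLinearMap.inCoordinates_eq hξ hξ]
  ext v
  exact congrArg (fun w => (trivializationAt F E (b ξ₀)).continuousLinearEquivAt ℂ (b ξ) hξ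
    (f ξ w)) (ContinuousLinearEquiv.symm_apply_apply _ _)

variable [FiniteDimensional ℂ F] [∀ x, CompleteSpace (E x)]

theorem ContinuousEnd.star_section (hb : Continuous b)
    (hE : Continuous fun p : TotalSpace F E => ‖p.2‖ ^ 2) {f : ∀ ξ, E (b ξ) →L[ℂ] E (b ξ)}
    (hf : ContinuousEnd F f) : ContinuousEnd F (star f) := by
  rw [continuousEnd_iff hb] at *
  intro ξ₀
  have := FiniteDimensional.complete ℂ F
  set e := trivializationAt F E (b ξ₀) with he
  have hmem : ∀ᶠ ξ in 𝓝 ξ₀, b ξ ∈ e.baseSet := hb.continuousAt.preimage_mem_nhds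
    (e.open_baseSet.mem_nhds (mem_baseSet_trivializationAt F E (b ξ₀)))
  let S : ∀ ξ, F →L[ℂ] E (b ξ) := fun ξ => e.symmL ℂ (b ξ)
  let P : X → F →L[ℂ] F := fun ξ => (S ξ).adjoint.comp (S ξ)
  have hnorm : ∀ a, ContinuousAt (fun ξ => ‖S ξ a‖ ^ 2) ξ₀ := by
    intro a
    have h1 : ContinuousAt (fun ξ => (⟨b ξ, S ξ a⟩ : TotalSpace F E)) ξ₀ := by
      rw [FiberBundle.continuousAt_totalSpace]
      refine ⟨hb.continuousAt, ?_⟩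
      refine (continuousAt_const (y := a)).congr ?_
      filter_upwards [hmem] with ξ hξ
      simp only [S, e.symmL_apply hξ, ← he]
      rw [e.apply_mk_symm hξ]
    exact hE.continuousAt.comp h1
  have hinner : ∀ a c, ContinuousAt (fun ξ => inner ℂ a (P ξ c)) ξ₀ := by
    intro a c
    have h : ∀ ξ, inner ℂ a (P ξ c) = (((‖S ξ (a + c)‖ ^ 2 : ℝ) : ℂ) - ((‖S ξ (a - c)‖ ^ 2 : ℝ) : ℂ)
        + (((‖S ξ (a - Complex.I • c)‖ ^ 2 : ℝ) : ℂ) - ((‖S ξ (a + Complex.I • c)‖ ^ 2 : ℝ) : ℂ))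
          * Complex.I) / 4 := by
      intro ξ
      simp only [P, ContinuousLinearMap.comp_apply, ContinuousLinearMap.adjoint_inner_right]
      rw [inner_eq_sum_norm_sq_div_four (𝕜 := ℂ)]
      simp
    simp_rw [h]
    have hc : ∀ a, ContinuousAt (fun ξ => ((‖S ξ a‖ ^ 2 : ℝ) : ℂ)) ξ₀ := fun a =>
      Complex.continuous_ofReal.continuousAt.comp (hnorm a)
    exact ((((hc _).sub (hc _)).add (((hc _).sub (hc _)).mul continuousAt_const))).div_const _
  have hP : ContinuousAt P ξ₀ := by
    rw [continuousAt_clm_apply]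
    intro c
    have h : ∀ ξ, P ξ c = ∑ i, inner ℂ (stdOrthonormalBasis ℂ F i) (P ξ c) •
        stdOrthonormalBasis ℂ F i := fun ξ =>
      ((stdOrthonormalBasis ℂ F).sum_repr' (P ξ c)).symm
    refine ContinuousAt.congr ?_ (Eventually.of_forall fun ξ => (h ξ).symm)
    exact tendsto_finsetSum _ fun i _ => (hinner _ c).smul continuousAt_const
  have hunit : ∀ ξ, b ξ ∈ e.baseSet → IsUnit (P ξ) := by
    intro ξ hξ
    let L : F ≃L[ℂ] E (b ξ) := (e.continuousLinearEquivAt ℂ (b ξ) hξ).symm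
    have hS : S ξ = L := by
      exact ContinuousLinearMap.ext fun v => by simp [S, L, hξ]
    have hinj : Function.Injective (P ξ) := by
      refine (injective_iff_map_eq_zero _).2 fun a ha => ?_
      have h0 : inner ℂ a (P ξ a) = 0 := by rw [ha, inner_zero_right]
      simp only [P, ContinuousLinearMap.comp_apply, ContinuousLinearMap.adjoint_inner_right] at h0
      rw [inner_self_eq_zero, hS] at h0
      exact L.map_eq_zero_iff.1 h0
    have hbij : Function.Bijective (P ξ) :=
      ⟨hinj, LinearMap.injective_iff_surjective.1 hinj⟩
    exact ContinuousLinearMap.isUnit_iff_bijective.2 hbij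
  have hPinv : ContinuousAt (fun ξ => Ring.inverse (P ξ)) ξ₀ := by
    obtain ⟨U, hU⟩ := hunit ξ₀ (mem_baseSet_trivializationAt F E (b ξ₀))
    have := NormedRing.inverse_continuousAt U
    rw [hU] at this
    exact this.comp hP
  have hadj : ContinuousAt (fun ξ => ContinuousLinearMap.adjoint
      (ContinuousLinearMap.inCoordinates F E F E (b ξ₀) (b ξ) (b ξ₀) (b ξ) (f ξ))) ξ₀ :=
    (ContinuousLinearMap.adjoint (𝕜 := ℂ) (E := F) (F := F)).continuous.continuousAt.comp (hf ξ₀)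
  refine (hPinv.clm_comp (hadj.clm_comp hP)).congr ?_
  filter_upwards [hmem] with ξ hξ
  let L : F ≃L[ℂ] E (b ξ) := (e.continuousLinearEquivAt ℂ (b ξ) hξ).symm
  have hS : S ξ = L := by
    exact ContinuousLinearMap.ext fun v => by simp [S, L, hξ]
  have hcoord : ∀ T : E (b ξ) →L[ℂ] E (b ξ),
      ContinuousLinearMap.inCoordinates F E F E (b ξ₀) (b ξ) (b ξ₀) (b ξ) T =
        (L.symm : E (b ξ) →L[ℂ] F).comp (T.comp (L : F →L[ℂ] E (b ξ))) :=
    fun T => ContinuousLinearMap.inCoordinates_eq hξ hξ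
  have key : (ContinuousLinearMap.adjoint ((L.symm : E (b ξ) →L[ℂ] F).comp
        ((f ξ).comp (L : F →L[ℂ] E (b ξ))))).comp (P ξ) =
      P ξ * ((L.symm : E (b ξ) →L[ℂ] F).comp
        ((star f ξ).comp (L : F →L[ℂ] E (b ξ)))) := by
    refine ContinuousLinearMap.ext fun v => ext_inner_left ℂ fun w => ?_
    simp [P, hS, ContinuousLinearMap.adjoint_inner_right, ContinuousLinearMap.star_eq_adjoint]
  simp only [hcoord]
  rw [key]
  change Ring.inverse (P ξ) * (P ξ * _) = _
  rw [← mul_assoc, Ring.inverse_mul_cancel _ (hunit ξ hξ), one_mul]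

end EndSections
/-! ### Equivariant Hermitian vector bundles -/

section Bundles

/-- A Hermitian metric on a complex vector bundle is smooth. -/
class IsSmoothHermitian (V : Type*) {M : Type*} (F : Type*) (E : M → Type*)
    [NormedAddCommGroup V] [NormedSpace ℝ V] [TopologicalSpace M] [ChartedSpace V M]
    [NormedAddCommGroup F] [InnerProductSpace ℂ F]
    [TopologicalSpace (TotalSpace F E)] [∀ x, NormedAddCommGroup (E x)]
    [∀ x, InnerProductSpace ℂ (E x)] [FiberBundle F E] : Prop where
  contMDiff_norm_sq : ContMDiff (𝓘(ℝ, V).prod 𝓘(ℝ, F)) 𝓘(ℝ, ℝ) ∞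
    (fun p : TotalSpace F E => ‖p.2‖ ^ 2)

/-- A lift of the action of `Γ` on `M` to fibrewise linear isometries of a Hermitian vector bundle
`E → M`. The action laws are expressed in the total space of `E`. -/
structure EquivariantStructure (Γ : Type*) {M : Type*} [Group Γ] [MulAction Γ M]
    (F : Type*) (E : M → Type*) [∀ x, NormedAddCommGroup (E x)]
    [∀ x, InnerProductSpace ℂ (E x)] where
  act : ∀ (γ : Γ) (x : M), E x →ₗᵢ[ℂ] E (γ • x)
  one_act : ∀ (x : M) (v : E x), (⟨(1 : Γ) • x, act 1 x v⟩ : TotalSpace F E) = ⟨x, v⟩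
  mul_act : ∀ (γ δ : Γ) (x : M) (v : E x),
    (⟨(γ * δ) • x, act (γ * δ) x v⟩ : TotalSpace F E) = ⟨γ • δ • x, act γ (δ • x) (act δ x v)⟩

variable {V : Type*} [NormedAddCommGroup V] [NormedSpace ℝ V]
  {M : Type*} [TopologicalSpace M] [ChartedSpace V M]
  {Γ : Type*} [Group Γ] [MulAction Γ M]
  {F : Type*} [NormedAddCommGroup F] [InnerProductSpace ℂ F]
  {E : M → Type*} [TopologicalSpace (TotalSpace F E)] [∀ x, NormedAddCommGroup (E x)]
  [∀ x, InnerProductSpace ℂ (E x)] [FiberBundle F E]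

variable (V) in
/-- The action `Γ × E → E` on the total space is smooth. -/
def EquivariantStructure.IsSmooth (𝓔 : EquivariantStructure Γ F E) (W : Type*)
    [NormedAddCommGroup W] [NormedSpace ℝ W] [TopologicalSpace Γ] [ChartedSpace W Γ] : Prop :=
  ContMDiff (𝓘(ℝ, W).prod (𝓘(ℝ, V).prod 𝓘(ℝ, F))) (𝓘(ℝ, V).prod 𝓘(ℝ, F)) ∞
    (fun p : Γ × TotalSpace F E =>
      (⟨p.1 • p.2.1, 𝓔.act p.1 p.2.1 p.2.2⟩ : TotalSpace F E))

theorem EquivariantStructure.act_surjective {M Γ F : Type*} [Group Γ] [MulAction Γ M]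
    {E : M → Type*} [∀ x, NormedAddCommGroup (E x)] [∀ x, InnerProductSpace ℂ (E x)]
    (𝓔 : EquivariantStructure Γ F E) (γ : Γ) (x : M) :
    Function.Surjective (𝓔.act γ x) := by
  intro w
  have h1 := 𝓔.mul_act γ γ⁻¹ (γ • x) w
  rw [mul_inv_cancel, 𝓔.one_act] at h1
  have aux : ∀ (y : M) (v : E y), y = x → (∃ v' : E x, (⟨y, v⟩ : TotalSpace F E) = ⟨x, v'⟩) := by
    rintro y v rfl
    exact ⟨v, rfl⟩
  obtain ⟨v', hv'⟩ := aux (γ⁻¹ • γ • x) (𝓔.act γ⁻¹ (γ • x) w) (inv_smul_smul γ x)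
  refine ⟨v', ?_⟩
  have h2 := congrArg (fun p : TotalSpace F E =>
    (⟨γ • p.1, 𝓔.act γ p.1 p.2⟩ : TotalSpace F E)) hv'
  have h3 := h1.trans h2
  exact (eq_of_heq (TotalSpace.mk.inj h3).2).symm

end Bundles

/-! ### The algebra of invariant symbols -/

section Symbols

variable (V : Type*) [NormedAddCommGroup V] [NormedSpace ℝ V]
  {M : Type*} [TopologicalSpace M] [ChartedSpace V M] [IsManifold 𝓘(ℝ, V) ∞ M]
  [RiemannianBundle (fun x : M => TangentSpace 𝓘(ℝ, V) x)]
  (F : Type*) [NormedAddCommGroup F] [InnerProductSpace ℂ F] [FiniteDimensional ℂ F]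
  (E : M → Type*) [TopologicalSpace (TotalSpace F E)] [∀ x, NormedAddCommGroup (E x)]
  [∀ x, InnerProductSpace ℂ (E x)] [∀ x, CompleteSpace (E x)] [FiberBundle F E]
  [VectorBundle ℂ F E] [IsSmoothHermitian V F E]

/-- `A_M = C₀(S*M; End E)`: the `*`-algebra of continuous sections, vanishing at infinity, of the
lift of `End E` to the unit cosphere bundle, with pointwise operations. -/
def symbolAlgebra :
    NonUnitalStarSubalgebra ℂ (∀ ξ : Cosphere V M, E ξ.base →L[ℂ] E ξ.base) where
  carrier := {f | ContinuousEnd F f ∧ Tendsto (fun ξ => ‖f ξ‖) (cocompact (Cosphere V M)) (𝓝 0)}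
  add_mem' := by
    rintro f g ⟨hf, hf'⟩ ⟨hg, hg'⟩
    refine ⟨hf.add continuous_base hg, ?_⟩
    refine squeeze_zero (fun ξ => norm_nonneg _) (fun ξ => norm_add_le (f ξ) (g ξ)) ?_
    simpa using hf'.add hg'
  zero_mem' := by
    refine ⟨?_, by simpa using tendsto_const_nhds⟩
    have := continuousEnd_scalar (F := F) (E := E) (continuous_base (V := V) (M := M))
      (z := fun _ => 0) continuous_const
    simp only [zero_smul] at this
    exact this
  mul_mem' := by
    rintro f g ⟨hf, hf'⟩ ⟨hg, hg'⟩
    refine ⟨hf.mul continuous_base hg, ?_⟩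
    refine squeeze_zero (fun ξ => norm_nonneg _) (fun ξ => norm_mul_le (f ξ) (g ξ)) ?_
    simpa using hf'.mul hg'
  smul_mem' := by
    rintro c f ⟨hf, hf'⟩
    constructor
    · have h := (continuousEnd_scalar (F := F) (E := E) (continuous_base (V := V) (M := M))
        (z := fun _ => c) continuous_const).mul continuous_base hf
      have e : c • f = (fun ξ : Cosphere V M => c • ContinuousLinearMap.id ℂ (E ξ.base)) * f := by
        ext ξ v; simp
      rwa [e]
    · simpa [norm_smul] using hf'.const_mul ‖c‖
  star_mem' := by
    rintro f ⟨hf, hf'⟩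
    refine ⟨hf.star_section continuous_base
      (IsSmoothHermitian.contMDiff_norm_sq (V := V)).continuous, ?_⟩
    simpa using hf'

variable {F E}
variable {Γ : Type*} [Group Γ] [MulAction Γ M] [IsIsometricAction V M Γ]

variable {V} in
/-- The isometry `E_x → E_{γ x}` given by `γ`, for a covector `ξ` at `x`. -/
def EquivariantStructure.actAt (𝓔 : EquivariantStructure Γ F E) (γ : Γ) (ξ : Cosphere V M) :
    E ξ.base →ₗᵢ[ℂ] E (γ • ξ).base :=
  𝓔.act γ ξ.base

/-- The `Γ`-invariant (i.e. `Γ`-equivariant) sections `f` of `End E` over the cosphere bundle: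
`f (γ ξ) = γ ∘ f ξ ∘ γ⁻¹`. -/
def invariantSections (𝓔 : EquivariantStructure Γ F E) :
    NonUnitalStarSubalgebra ℂ (∀ ξ : Cosphere V M, E ξ.base →L[ℂ] E ξ.base) where
  carrier := {f | ∀ (γ : Γ) (ξ : Cosphere V M) (v : E ξ.base),
    f (γ • ξ) (𝓔.actAt γ ξ v) = 𝓔.actAt γ ξ (f ξ v)}
  add_mem' := by
    intro f g hf hg γ ξ v
    change f (γ • ξ) _ + g (γ • ξ) _ = 𝓔.actAt γ ξ (f ξ v + g ξ v)
    rw [hf γ ξ v, hg γ ξ v, map_add]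
  zero_mem' := by
    intro γ ξ v
    exact (map_zero (𝓔.actAt γ ξ)).symm
  mul_mem' := by
    intro f g hf hg γ ξ v
    change f (γ • ξ) (g (γ • ξ) _) = 𝓔.actAt γ ξ (f ξ (g ξ v))
    rw [hg γ ξ v, hf γ ξ]
  smul_mem' := by
    intro c f hf γ ξ v
    change c • f (γ • ξ) _ = 𝓔.actAt γ ξ (c • f ξ v)
    rw [hf γ ξ v, map_smul]
  star_mem' := by
    intro f hf γ ξ v
    refine ext_inner_right ℂ fun w => ?_
    obtain ⟨w, rfl⟩ : ∃ w', 𝓔.actAt γ ξ w' = w := 𝓔.act_surjective γ ξ.base w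
    have h1 : inner ℂ ((star f) (γ • ξ) (𝓔.actAt γ ξ v)) (𝓔.actAt γ ξ w) =
        inner ℂ (𝓔.actAt γ ξ v) (f (γ • ξ) (𝓔.actAt γ ξ w)) := by
      rw [Pi.star_apply, ContinuousLinearMap.star_eq_adjoint]
      exact ContinuousLinearMap.adjoint_inner_left _ _ _
    refine h1.trans ?_
    rw [hf γ ξ w, LinearIsometry.inner_map_map, LinearIsometry.inner_map_map, Pi.star_apply,
      ContinuousLinearMap.star_eq_adjoint, ContinuousLinearMap.adjoint_inner_left]

/-- `A_M^Γ = C₀(S*M; End E)^Γ`. -/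
def invariantSymbols (𝓔 : EquivariantStructure Γ F E) :
    NonUnitalStarSubalgebra ℂ (∀ ξ : Cosphere V M, E ξ.base →L[ℂ] E ξ.base) :=
  symbolAlgebra V F E ⊓ invariantSections V 𝓔

variable (M Γ) in
/-- `Z_M = C₀(S*M)^Γ`. -/
def invariantFunctions : NonUnitalStarSubalgebra ℂ C₀(Cosphere V M, ℂ) where
  carrier := {z | ∀ (γ : Γ) (ξ : Cosphere V M), z (γ • ξ) = z ξ}
  add_mem' := by
    intro z w hz hw γ ξ
    simp [hz γ ξ, hw γ ξ]
  zero_mem' := by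
    intro γ ξ
    simp
  mul_mem' := by
    intro z w hz hw γ ξ
    simp [hz γ ξ, hw γ ξ]
  smul_mem' := by
    intro c z hz γ ξ
    simp [hz γ ξ]
  star_mem' := by
    intro z hz γ ξ
    simp [hz γ ξ]

theorem scalar_mem_invariantSymbols (𝓔 : EquivariantStructure Γ F E)
    (z : invariantFunctions V M Γ) :
    (fun ξ => z.1 ξ • ContinuousLinearMap.id ℂ (E ξ.base)) ∈ invariantSymbols V 𝓔 := by
  rw [invariantSymbols, NonUnitalStarAlgebra.mem_inf]
  refine ⟨⟨continuousEnd_scalar continuous_base z.1.continuous, ?_⟩, ?_⟩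
  · have h := (zero_at_infty z.1).norm
    rw [norm_zero] at h
    refine squeeze_zero (fun ξ => norm_nonneg _) (fun ξ => ?_) h
    rw [norm_smul]
    exact mul_le_of_le_one_right (norm_nonneg _) ContinuousLinearMap.norm_id_le
  · intro γ ξ v
    have h := z.2 γ ξ
    change z.1 (γ • ξ) • 𝓔.actAt γ ξ v = 𝓔.actAt γ ξ (z.1 ξ • v)
    rw [h, map_smul]

/-- The central inclusion `Z_M → A_M^Γ`: invariant functions act as scalars on the fibres. -/
def centralInclusion (𝓔 : EquivariantStructure Γ F E) :
    invariantFunctions V M Γ →⋆ₙₐ[ℂ] invariantSymbols V 𝓔 where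
  toFun z := ⟨fun ξ => z.1 ξ • ContinuousLinearMap.id ℂ (E ξ.base),
    scalar_mem_invariantSymbols V 𝓔 z⟩
  map_smul' c z := by
    ext ξ v
    simp [mul_smul]
  map_zero' := by
    ext ξ v
    simp
  map_add' z w := by
    ext ξ v
    simp [add_smul]
  map_mul' z w := by
    ext ξ v
    simp [smul_smul, mul_comm]
  map_star' z := by
    apply Subtype.ext
    funext ξ
    change _ = star (z.1 ξ • ContinuousLinearMap.id ℂ (E ξ.base))
    rw [star_smul]
    change star (z.1 ξ) • _ = star (z.1 ξ) • star (1 : E ξ.base →L[ℂ] E ξ.base)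
    rw [star_one]
    rfl

end Symbols

/-! ### Pairs `(ξ, ρ)` and their `Γ`-orbits -/

section Pairs

variable {V : Type*} [NormedAddCommGroup V] [NormedSpace ℝ V]
  {M : Type*} [TopologicalSpace M] [ChartedSpace V M]
  [RiemannianBundle (fun x : M => TangentSpace 𝓘(ℝ, V) x)]
  {F : Type*} {E : M → Type*} [∀ x, NormedAddCommGroup (E x)] [∀ x, InnerProductSpace ℂ (E x)]
  {Γ : Type*} [Group Γ] [TopologicalSpace Γ] [MulAction Γ M] [IsIsometricAction V M Γ]

/-- `T : ℂⁿ → E_x` is `Γ_ξ`-equivariant, where `ξ ∈ S*_x M` and `Γ_ξ` acts on `ℂⁿ` by `ρ` and on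
`E_x` by restriction of the action on `E`. -/
def IsIntertwiner (𝓔 : EquivariantStructure Γ F E) (ξ : Cosphere V M)
    (ρ : Irrep (MulAction.stabilizer Γ ξ))
    (T : EuclideanSpace ℂ (Fin ρ.dim) →ₗ[ℂ] E ξ.base) : Prop :=
  ∀ (g : MulAction.stabilizer Γ ξ) (v : EuclideanSpace ℂ (Fin ρ.dim)),
    (⟨(g : Γ) • ξ.base, 𝓔.act g ξ.base (T v)⟩ : TotalSpace F E) = ⟨ξ.base, T (ρ.rep g v)⟩

/-- The `ρ`-isotypical component of `E_x`, for `ξ ∈ S*_x M` and `ρ` an irreducible representation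
of `Γ_ξ`: the sum of the images of all `Γ_ξ`-equivariant maps `ρ → E_x`. -/
def isotypic (𝓔 : EquivariantStructure Γ F E) (ξ : Cosphere V M)
    (ρ : Irrep (MulAction.stabilizer Γ ξ)) : Submodule ℂ (E ξ.base) :=
  ⨆ (T : EuclideanSpace ℂ (Fin ρ.dim) →ₗ[ℂ] E ξ.base) (_ : IsIntertwiner 𝓔 ξ ρ T),
    LinearMap.range T

variable (V) in
/-- Pairs `(ξ, ρ)` with `ξ ∈ S*_x M` and `ρ` an irreducible unitary representation of `Γ_ξ` that
occurs in `E_x`, i.e. `Hom_{Γ_ξ}(ρ, E_x) ≠ 0`. -/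
structure SymbolPair (𝓔 : EquivariantStructure Γ F E) where
  pt : Cosphere V M
  rho : Irrep (MulAction.stabilizer Γ pt)
  occurs : ∃ T, IsIntertwiner 𝓔 pt rho T ∧ T ≠ 0

/-- The pairs `(ξ, ρ)` and `(η, σ)` define the same `Γ`-orbit: there is `γ ∈ Γ` with `γ ξ = η` such
that `σ` is equivalent to the conjugate `γ ρ` of `ρ`, the representation
`h ↦ ρ (γ⁻¹ h γ)` of `Γ_η = γ Γ_ξ γ⁻¹`. For `γ = 1` this is equivalence of `ρ` and `σ`. -/
def SymbolPair.SameOrbit {𝓔 : EquivariantStructure Γ F E} (p q : SymbolPair V 𝓔) : Prop :=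
  ∃ γ : Γ, γ • p.pt = q.pt ∧
    ∃ T : EuclideanSpace ℂ (Fin p.rho.dim) ≃ₗ[ℂ] EuclideanSpace ℂ (Fin q.rho.dim),
      ∀ (g : MulAction.stabilizer Γ p.pt) (h : MulAction.stabilizer Γ q.pt),
        (h : Γ) = γ * g * γ⁻¹ → ∀ v, T (p.rho.rep g v) = q.rho.rep h (T v)

variable (V) in
/-- Equality of `Γ`-orbits of pairs. -/
def SymbolPair.orbitSetoid (𝓔 : EquivariantStructure Γ F E) : Setoid (SymbolPair V 𝓔) where
  r := SymbolPair.SameOrbit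
  iseqv := by
    refine ⟨?_, ?_, ?_⟩
    · intro p
      refine ⟨1, one_smul _ _, LinearEquiv.refl ℂ _, ?_⟩
      intro g h hgh v
      have : h = g := Subtype.ext (by simpa using hgh)
      simp [this]
    · rintro p q ⟨γ, hγ, T, hT⟩
      refine ⟨γ⁻¹, by rw [← hγ, inv_smul_smul], T.symm, ?_⟩
      intro h g hgh w
      have h1 := hT g h (by rw [hgh]; group) (T.symm w)
      rw [LinearEquiv.apply_symm_apply] at h1
      rw [← h1, LinearEquiv.symm_apply_apply]
    · rintro p q r ⟨γ, hγ, T, hT⟩ ⟨δ, hδ, S, hS⟩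
      refine ⟨δ * γ, by rw [mul_smul, hγ, hδ], T.trans S, ?_⟩
      intro g k hgk v
      have hmem : γ * g * γ⁻¹ ∈ MulAction.stabilizer Γ q.pt := by
        rw [MulAction.mem_stabilizer_iff, ← hγ, mul_smul, inv_smul_smul, mul_smul, g.2]
      have h1 := hT g ⟨_, hmem⟩ rfl v
      have h2 := hS ⟨_, hmem⟩ k (by rw [hgk]; group) (T v)
      simp only [LinearEquiv.trans_apply]
      rw [h1, h2]

variable (V) in
/-- The set of `Γ`-orbits of pairs `(ξ, ρ)`. -/
def OrbitPairs (𝓔 : EquivariantStructure Γ F E) : Type _ := Quotient (SymbolPair.orbitSetoid V 𝓔)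

/-- The orbit `Γ(ξ, ρ)`. -/
def SymbolPair.orbit {𝓔 : EquivariantStructure Γ F E} (p : SymbolPair V 𝓔) : OrbitPairs V 𝓔 :=
  Quotient.mk (SymbolPair.orbitSetoid V 𝓔) p

end Pairs

end EquivSymbol

end

open EquivSymbol

/-!
Everything is local over the orbit space `S*M / Γ`. Two facts tie the algebra `A = A_M^Γ` of
invariant symbols to finite-dimensional representation theory.

* Evaluation at `ξ ∈ S*M` maps `A` onto the commutant `End(E_x)^{Γ_ξ}` of the unitary representation
  of the stabilizer `Γ_ξ` on the fibre (`exists_invariantSymbols_eq`). An endomorphism in the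
  commutant is extended to a section that is cut off near `ξ` and averaged over `Γ`; this gives
  approximations of a multiple of it, and the space of values is closed, being finite-dimensional.
* Every `f ∈ A` is a product `z g` with `z ∈ Z_M` and `g ∈ A` such that `z` vanishes wherever `f`
  does (`exists_eq_smul`); one takes for `z` the square root of the Hilbert–Schmidt norm of `f`.

In an irreducible representation `r` of `A` the central algebra `Z_M` acts by a character, by the
operator form of Schur's lemma (`IsIrreducibleRep.exists_character`). By the factorization the
character is not zero, so it is the evaluation at a point `ξ` (`character_eq_eval`), and by the
factorization again `r f = 0` whenever `f ξ = 0` (`IsIrreducibleRep.exists_point`). Hence `r`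
factors through the commutant of the representation of `Γ_ξ` on `E_x`, and it remains to study the
commutant of a finite-dimensional unitary representation `τ`. The identity is a sum of projections
`T T*` with `T` an isometric intertwiner from an irreducible `ρ`; one of these acts nontrivially in
`r`, and then the kernel of `r` consists of the elements that annihilate all intertwiners from `ρ`
to `τ`, that is, the `ρ`-isotypical component (`IsIrreducibleRep.exists_irrep`). Conversely the
commutant acts irreducibly on `Hom(ρ, τ)` with this kernel (`exists_isPrimitiveIdeal_of_irrep`), and
inequivalent `ρ` have different kernels (`exists_linearEquiv_of_killsIntertwiners`).

Invariant functions, obtained by averaging bump functions, separate orbits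
(`mem_orbit_of_invariantFunctions`), which gives injectivity of the parametrization by orbits of
pairs, and also the homeomorphism `S*M / Γ ≃ Prim (Z_M)`. The central character map is
`P ↦ P ∩ Z_M` (`mem_centralCharacterMap`), which is visibly continuous for the hull-kernel
topologies; its fibres are finite because `E_x` has only finitely many irreducible summands.
-/

noncomputable section

set_option linter.unusedSectionVars false

namespace EquivSymbol

universe u

/-! ### Topology of the cosphere bundle -/

section Topology

theorem t2Space_totalSpace {B F : Type*} {E : B → Type*} [TopologicalSpace B] [T2Space B]
    [TopologicalSpace F] [T2Space F] [TopologicalSpace (TotalSpace F E)]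
    [∀ x, TopologicalSpace (E x)] [FiberBundle F E] : T2Space (TotalSpace F E) := by
  refine ⟨fun p q hpq => ?_⟩
  by_cases h : p.1 = q.1
  · let e := trivializationAt F E p.1
    have hp : p ∈ e.source := e.mem_source.2 (mem_baseSet_trivializationAt F E p.1)
    have hq : q ∈ e.source := e.mem_source.2 (h ▸ mem_baseSet_trivializationAt F E p.1)
    obtain ⟨u, v, hu, hv, hpu, hqv, huv⟩ :=
      t2_separation (fun h' : e p = e q => hpq (e.injOn hp hq h'))
    exact ⟨e.source ∩ e ⁻¹' u, e.source ∩ e ⁻¹' v,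
      e.continuousOn.isOpen_inter_preimage e.open_source hu,
      e.continuousOn.isOpen_inter_preimage e.open_source hv, ⟨hp, hpu⟩, ⟨hq, hqv⟩,
      (huv.preimage e).mono Set.inter_subset_right Set.inter_subset_right⟩
  · obtain ⟨u, v, hu, hv, hpu, hqv, huv⟩ := t2_separation h
    have hc : Continuous (TotalSpace.proj : TotalSpace F E → B) := FiberBundle.continuous_proj F E
    exact ⟨_, _, hu.preimage hc, hv.preimage hc, hpu, hqv, huv.preimage _⟩

theorem locallyCompactSpace_totalSpace {B F : Type*} {E : B → Type*} [TopologicalSpace B]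
    [LocallyCompactSpace B] [TopologicalSpace F] [LocallyCompactSpace F]
    [TopologicalSpace (TotalSpace F E)] [∀ x, TopologicalSpace (E x)] [FiberBundle F E] :
    LocallyCompactSpace (TotalSpace F E) :=
  ChartedSpace.locallyCompactSpace (B × F) (TotalSpace F E)

/-- The local frame vector of a vector bundle with constant coordinate `a` is a continuous
section. -/
theorem continuousAt_symm_trivializationAt {B F : Type*} {E : B → Type*} [TopologicalSpace B]
    [TopologicalSpace F] [TopologicalSpace (TotalSpace F E)] [∀ x, Zero (E x)]
    [∀ x, TopologicalSpace (E x)] [FiberBundle F E]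
    {Y : Type*} [TopologicalSpace Y] {b : Y → B} {x : B} {y : Y} {a : Y → F}
    (hb : ContinuousAt b y) (hy : b y ∈ (trivializationAt F E x).baseSet) (ha : ContinuousAt a y) :
    ContinuousAt (fun y => (⟨b y, (trivializationAt F E x).symm (b y) (a y)⟩ : TotalSpace F E))
      y := by
  set e := trivializationAt F E x
  have h := e.toOpenPartialHomeomorph.symm.continuousAt (x := (b y, a y))
    (by simpa [e.mem_target] using hy)
  refine (h.comp (x := y) (f := fun y => (b y, a y)) (hb.prodMk ha)).congr ?_
  filter_upwards [hb (e.open_baseSet.mem_nhds hy)] with z hz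
  exact (e.mk_symm hz _).symm

variable {V M : Type*} [NormedAddCommGroup V] [NormedSpace ℝ V]
  [TopologicalSpace M] [ChartedSpace V M] [IsManifold 𝓘(ℝ, V) ∞ M]
  [RiemannianBundle (fun x : M => TangentSpace 𝓘(ℝ, V) x)]

instance [T2Space M] : T2Space (Cosphere V M) :=
  have : T2Space (Cotangent V M) := t2Space_totalSpace
  inferInstanceAs (T2Space {p : Cotangent V M // ‖p.2‖ = 1})

variable [FiniteDimensional ℝ V]
  [IsContMDiffRiemannianBundle 𝓘(ℝ, V) ∞ V (fun x : M => TangentSpace 𝓘(ℝ, V) x)]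

variable (V M) in
/-- The norm dual to a continuous Riemannian metric is continuous. -/
theorem continuous_norm_cotangent : Continuous fun p : Cotangent V M => ‖p.2‖ := by
  have : IsContinuousRiemannianBundle V (fun x : M => TangentSpace 𝓘(ℝ, V) x) := by
    obtain ⟨g, hg, h⟩ := IsContMDiffRiemannianBundle.exists_contMDiff (IB := 𝓘(ℝ, V)) (n := ∞)
      (F := V) (E := fun x : M => TangentSpace 𝓘(ℝ, V) x)
    exact ⟨g, hg.continuous, h⟩
  rw [continuous_iff_continuousAt]
  intro p
  set e := trivializationAt V (fun x : M => TangentSpace 𝓘(ℝ, V) x) p.1 with he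
  have hpe : p.1 ∈ e.baseSet := mem_baseSet_trivializationAt _ _ _
  have hproj : Continuous (fun q : Cotangent V M => q.1) :=
    FiberBundle.continuous_proj (V →L[ℝ] ℝ) (fun x : M => TangentSpace 𝓘(ℝ, V) x →L[ℝ] ℝ)
  have hsec : ∀ a : V, ContinuousAt (fun z : Cotangent V M × V =>
      (⟨z.1.1, e.symm z.1.1 z.2⟩ : TotalSpace V (fun x : M => TangentSpace 𝓘(ℝ, V) x)))
      (p, a) := fun a =>
    continuousAt_symm_trivializationAt (hproj.comp continuous_fst).continuousAt hpe
      continuous_snd.continuousAt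
  have hnorm : ∀ a : V, ContinuousAt (fun z : Cotangent V M × V => ‖e.symm z.1.1 z.2‖) (p, a) := by
    intro a
    have h := ((hsec a).inner_bundle (hsec a)).sqrt
    refine h.congr (Eventually.of_forall fun z => ?_)
    simp only [real_inner_self_eq_norm_sq]
    exact Real.sqrt_sq (norm_nonneg _)
  have happ : ∀ a : V, ContinuousAt (fun z : Cotangent V M × V => z.1.2 (e.symm z.1.1 z.2))
      (p, a) := by
    intro a
    have h := ContinuousAt.clm_bundle_apply (𝕜 := ℝ) (F₁ := V) (F₂ := ℝ)
      (E₁ := fun x : M => TangentSpace 𝓘(ℝ, V) x) (E₂ := Bundle.Trivial M ℝ)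
      (b := fun z : Cotangent V M × V => z.1.1) (ϕ := fun z => z.1.2)
      (v := fun z => e.symm z.1.1 z.2) (x := (p, a)) ?_ (hsec a)
    · rw [FiberBundle.continuousAt_totalSpace] at h
      exact h.2
    · exact continuous_fst.continuousAt
  refine tendsto_order.2 ⟨fun r hr => ?_, fun r hr => ?_⟩
  -- lower semicontinuity: extend a vector on which the norm is almost attained by a local frame
  · obtain ⟨v, hv, hrv⟩ := p.2.exists_lt_apply_of_lt_opNorm hr
    have hve : e.symm p.1 (e ⟨p.1, v⟩).2 = v := e.symm_apply_apply_mk hpe v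
    set a := (e ⟨p.1, v⟩).2
    have hc : ContinuousAt (fun q : Cotangent V M => (q, a)) p := by fun_prop
    have h1 : ContinuousAt (fun q : Cotangent V M => ‖e.symm q.1 a‖) p :=
      ContinuousAt.comp (g := fun z : Cotangent V M × V => ‖e.symm z.1.1 z.2‖) (x := p)
        (f := fun q => (q, a)) (hnorm a) hc
    have h2 : ContinuousAt (fun q : Cotangent V M => q.2 (e.symm q.1 a)) p :=
      ContinuousAt.comp (g := fun z : Cotangent V M × V => z.1.2 (e.symm z.1.1 z.2)) (x := p)
        (f := fun q => (q, a)) (happ a) hc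
    filter_upwards [h1.eventually (gt_mem_nhds (by rwa [hve] : ‖e.symm p.1 a‖ < 1)),
      h2.norm.eventually (lt_mem_nhds (by rwa [hve] : r < ‖p.2 (e.symm p.1 a)‖))] with q hq1 hq2
    calc r < ‖q.2 (e.symm q.1 a)‖ := hq2
      _ ≤ ‖q.2‖ * ‖e.symm q.1 a‖ := q.2.le_opNorm _
      _ ≤ ‖q.2‖ := mul_le_of_le_one_right q.2.opNorm_nonneg hq1.le
  -- upper semicontinuity: by compactness of the unit sphere of `V`, the strict inequality
  -- `‖q v‖ < s ‖v‖` persists near `p` for all frame vectors at once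
  · obtain ⟨s, hps, hsr⟩ := exists_between hr
    have hs : 0 ≤ s := p.2.opNorm_nonneg.trans hps.le
    have key := (isCompact_sphere (0 : V) 1).eventually_forall_of_forall_eventually (x₀ := p)
      (P := fun q a => ‖q.2 (e.symm q.1 a)‖ < s * ‖e.symm q.1 a‖) (by
        intro a ha
        refine (happ a).norm.eventually_lt ((hnorm a).const_mul s) ?_
        have hne : e.symm p.1 a ≠ 0 := by
          intro h0
          have h1 := e.apply_mk_symm hpe a
          have h2 : e.symm p.1 (0 : V) = 0 := by
            rw [← e.symmₗ_apply (R := ℝ) hpe, map_zero]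
          rw [h0, ← h2, e.apply_mk_symm hpe] at h1
          have : a = 0 := (Prod.ext_iff.1 h1).2.symm
          simp [this] at ha
        calc ‖p.2 (e.symm p.1 a)‖ ≤ ‖p.2‖ * ‖e.symm p.1 a‖ := p.2.le_opNorm _
          _ < s * ‖e.symm p.1 a‖ := by
            gcongr)
    filter_upwards [key, hproj.continuousAt (e.open_baseSet.mem_nhds hpe)] with q hq hqe
    refine (ContinuousLinearMap.opNorm_le_bound _ hs fun v => ?_).trans_lt hsr
    have hve : e.symm q.1 (e ⟨q.1, v⟩).2 = v := e.symm_apply_apply_mk hqe v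
    set a := (e ⟨q.1, v⟩).2
    by_cases ha : a = 0
    · have : v = 0 := by
        rw [← hve, ha]
        rw [← e.symmₗ_apply (R := ℝ) hqe, map_zero]
      rw [this]
      simp
    · have h := hq (‖a‖⁻¹ • a) (by simp [norm_smul, ha])
      have hl : e.symm q.1 (‖a‖⁻¹ • a) = ‖a‖⁻¹ • v := by
        rw [← hve]
        rw [← e.symmₗ_apply (R := ℝ) hqe, ← e.symmₗ_apply (R := ℝ) hqe, map_smul]
      rw [hl, map_smul, norm_smul, norm_smul, mul_left_comm] at h
      exact (lt_of_mul_lt_mul_left h (norm_nonneg _)).le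

variable (V M) in
theorem isClosedEmbedding_cosphere_val :
    IsClosedEmbedding (Subtype.val : Cosphere V M → Cotangent V M) :=
  IsClosed.isClosedEmbedding_subtypeVal
    (isClosed_singleton.preimage (continuous_norm_cotangent V M) :
      IsClosed {p : Cotangent V M | ‖p.2‖ = 1})

instance : LocallyCompactSpace (Cosphere V M) := by
  have := ChartedSpace.locallyCompactSpace V M
  have : LocallyCompactSpace (Cotangent V M) := locallyCompactSpace_totalSpace
  exact (isClosedEmbedding_cosphere_val V M).locallyCompactSpace

end Topology

/-! ### Continuity of the action on the cosphere bundle -/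

section Action

/-- A family of linear maps between the fibres of two vector bundles of finite rank is continuous
as soon as it maps the vectors of the local frames continuously. -/
theorem continuousAt_hom_bundle_of_frame {𝕜 B F₁ F₂ Y : Type*} [NontriviallyNormedField 𝕜]
    [CompleteSpace 𝕜] {E₁ E₂ : B → Type*} [NormedAddCommGroup F₁] [NormedSpace 𝕜 F₁]
    [FiniteDimensional 𝕜 F₁] [NormedAddCommGroup F₂] [NormedSpace 𝕜 F₂]
    [∀ x, AddCommGroup (E₁ x)] [∀ x, Module 𝕜 (E₁ x)] [∀ x, TopologicalSpace (E₁ x)]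
    [∀ x, AddCommGroup (E₂ x)] [∀ x, Module 𝕜 (E₂ x)] [∀ x, TopologicalSpace (E₂ x)]
    [TopologicalSpace B] [TopologicalSpace (TotalSpace F₁ E₁)] [TopologicalSpace (TotalSpace F₂ E₂)]
    [FiberBundle F₁ E₁] [VectorBundle 𝕜 F₁ E₁] [FiberBundle F₂ E₂] [VectorBundle 𝕜 F₂ E₂]
    [∀ x, IsTopologicalAddGroup (E₂ x)] [∀ x, ContinuousSMul 𝕜 (E₂ x)]
    [TopologicalSpace Y] {b : Y → B} {φ : ∀ y, E₁ (b y) →L[𝕜] E₂ (b y)} {y₀ : Y}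
    (hb : ContinuousAt b y₀)
    (h : ∀ a : F₁, ContinuousAt (fun y =>
      (⟨b y, φ y ((trivializationAt F₁ E₁ (b y₀)).symm (b y) a)⟩ : TotalSpace F₂ E₂)) y₀) :
    ContinuousAt (fun y =>
      (⟨b y, φ y⟩ : TotalSpace (F₁ →L[𝕜] F₂) (fun x => E₁ x →L[𝕜] E₂ x))) y₀ := by
  rw [continuousAt_hom_bundle]
  refine ⟨hb, ?_⟩
  rw [continuousAt_clm_apply]
  intro a
  have ha := h a
  rw [FiberBundle.continuousAt_totalSpace] at ha
  refine ha.2.congr ?_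
  filter_upwards [hb ((trivializationAt F₁ E₁ (b y₀)).open_baseSet.mem_nhds
      (mem_baseSet_trivializationAt F₁ E₁ _)),
    hb ((trivializationAt F₂ E₂ (b y₀)).open_baseSet.mem_nhds
      (mem_baseSet_trivializationAt F₂ E₂ _))] with y h1 h2
  simp only [ContinuousLinearMap.inCoordinates, ContinuousLinearMap.comp_apply]
  rw [Trivialization.symmL_apply _ h1, Trivialization.continuousLinearMapAt_apply,
    Trivialization.linearMapAt_apply, if_pos (show b y ∈ _ from h2)]

variable {V W M Γ : Type*} [NormedAddCommGroup V] [NormedSpace ℝ V]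
  [NormedAddCommGroup W] [NormedSpace ℝ W]
  [TopologicalSpace M] [ChartedSpace V M]
  [Group Γ] [TopologicalSpace Γ] [ChartedSpace W Γ] [MulAction Γ M]

/-- The differential of `x ↦ γ x` is the differential of the action `Γ × M → M` restricted to the
zero section over `Γ`, so that it depends continuously on `γ`. -/
theorem tangentMap_smul_eq [IsManifold 𝓘(ℝ, V) ∞ M] [LieGroup 𝓘(ℝ, W) ∞ Γ]
    [ContMDiffSMul 𝓘(ℝ, W) 𝓘(ℝ, V) ∞ Γ M] (γ : Γ) (p : TangentBundle 𝓘(ℝ, V) M) :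
    tangentMap 𝓘(ℝ, V) 𝓘(ℝ, V) (fun x : M => γ • x) p =
      tangentMap (𝓘(ℝ, W).prod 𝓘(ℝ, V)) 𝓘(ℝ, V) (fun q : Γ × M => q.1 • q.2)
        ((equivTangentBundleProd 𝓘(ℝ, W) Γ 𝓘(ℝ, V) M).symm
          (zeroSection W (TangentSpace 𝓘(ℝ, W) : Γ → Type _) γ, p)) := by
  have hs : MDifferentiable (𝓘(ℝ, W).prod 𝓘(ℝ, V)) 𝓘(ℝ, V) (fun q : Γ × M => q.1 • q.2) :=
    (ContMDiffSMul.contMDiff_smul (I := 𝓘(ℝ, W)) (I' := 𝓘(ℝ, V)) (n := ∞)).mdifferentiable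
      (by simp)
  have hp : MDifferentiable 𝓘(ℝ, V) (𝓘(ℝ, W).prod 𝓘(ℝ, V)) (fun x : M => (γ, x)) :=
    mdifferentiable_const.prodMk mdifferentiable_id
  have h := congrFun (tangentMap_comp hs hp) p
  refine h.trans (congrArg (tangentMap (𝓘(ℝ, W).prod 𝓘(ℝ, V)) 𝓘(ℝ, V)
    (fun q : Γ × M => q.1 • q.2)) ?_)
  obtain ⟨x, v⟩ := p
  simp only [tangentMap, mfderiv_prod_right]
  rfl

theorem continuous_tangentMap_smul [IsManifold 𝓘(ℝ, V) ∞ M] [LieGroup 𝓘(ℝ, W) ∞ Γ]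
    [ContMDiffSMul 𝓘(ℝ, W) 𝓘(ℝ, V) ∞ Γ M] :
    Continuous (fun q : Γ × TangentBundle 𝓘(ℝ, V) M =>
      tangentMap 𝓘(ℝ, V) 𝓘(ℝ, V) (fun x : M => q.1 • x) q.2) := by
  simp_rw [tangentMap_smul_eq (W := W)]
  have h1 := (ContMDiffSMul.contMDiff_smul (I := 𝓘(ℝ, W)) (I' := 𝓘(ℝ, V)) (n := ∞)
    (G := Γ) (M := M)).continuous_tangentMap (by simp)
  have : IsManifold 𝓘(ℝ, V) 1 M := IsManifold.of_le (n := ∞) (by simp)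
  have : IsManifold 𝓘(ℝ, W) 1 Γ := IsManifold.of_le (n := ∞) (by simp)
  have h2 := (contMDiff_equivTangentBundleProd_symm (I := 𝓘(ℝ, W)) (M := Γ) (I' := 𝓘(ℝ, V))
    (M' := M) (n := 0)).continuous
  exact h1.comp (h2.comp
    (((Bundle.Trivialization.continuous_zeroSection ℝ).comp continuous_fst).prodMk continuous_snd))

variable [RiemannianBundle (fun x : M => TangentSpace 𝓘(ℝ, V) x)]

/-- The inverse of the differential of `γ` is the differential of `γ⁻¹`. -/
theorem tangentMap_inv_smul {Γ : Type*} [Group Γ] [MulAction Γ M] [IsIsometricAction V M Γ]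
    (γ : Γ) (x : M) (w : TangentSpace 𝓘(ℝ, V) (γ • x)) :
    tangentMap 𝓘(ℝ, V) 𝓘(ℝ, V) (fun x : M => γ⁻¹ • x) ⟨γ • x, w⟩ =
      ⟨x, (mfderiv 𝓘(ℝ, V) 𝓘(ℝ, V) (fun x : M => γ • x) x).inverse w⟩ := by
  obtain ⟨e, he⟩ := isInvertible_mfderiv_smul (V := V) γ x
  have h1 := mdifferentiable_smul (V := V) (M := M) γ
  have h2 := mdifferentiable_smul (V := V) (M := M) γ⁻¹
  have e1 : (fun x : M => γ⁻¹ • x) ∘ (fun x : M => γ • x) = id := by ext; simp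
  have h := congrFun (tangentMap_comp h2 h1) ⟨x, e.symm w⟩
  rw [e1, tangentMap_id] at h
  have h3 : tangentMap 𝓘(ℝ, V) 𝓘(ℝ, V) (fun x : M => γ • x) ⟨x, e.symm w⟩ = ⟨γ • x, w⟩ := by
    simp only [tangentMap, ← he]
    exact congrArg (TotalSpace.mk _) (e.apply_symm_apply w)
  rw [Function.comp_apply, h3] at h
  rw [← h, ← he, ContinuousLinearMap.inverse_equiv]
  rfl

/-- The action on covectors is continuous: the covector `γ ξ` takes the value `ξ (d γ⁻¹ w)` at a
frame vector `w`, and `d γ⁻¹ w` depends continuously on `γ`. -/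
theorem continuousSMul_cosphere [FiniteDimensional ℝ V] [IsManifold 𝓘(ℝ, V) ∞ M]
    [LieGroup 𝓘(ℝ, W) ∞ Γ] [ContMDiffSMul 𝓘(ℝ, W) 𝓘(ℝ, V) ∞ Γ M] [IsIsometricAction V M Γ] :
    ContinuousSMul Γ (Cosphere V M) := by
  refine ⟨?_⟩
  suffices h : Continuous fun q : Γ × Cotangent V M => q.1 • q.2 from
    Continuous.subtype_mk (h.comp (continuous_fst.prodMk
      (continuous_subtype_val.comp continuous_snd))) _
  rw [continuous_iff_continuousAt]
  intro q₀
  have hproj : Continuous (fun q : Cotangent V M => q.1) :=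
    FiberBundle.continuous_proj (V →L[ℝ] ℝ) (fun x : M => TangentSpace 𝓘(ℝ, V) x →L[ℝ] ℝ)
  have hsm : Continuous (fun q : Γ × M => q.1 • q.2) :=
    (ContMDiffSMul.contMDiff_smul (I := 𝓘(ℝ, W)) (I' := 𝓘(ℝ, V)) (n := ∞)).continuous
  have : IsTopologicalGroup Γ := topologicalGroup_of_lieGroup 𝓘(ℝ, W) ∞
  have hb : Continuous (fun q : Γ × Cotangent V M => q.1 • q.2.1) :=
    hsm.comp (continuous_fst.prodMk (hproj.comp continuous_snd))
  refine continuousAt_hom_bundle_of_frame (𝕜 := ℝ) (F₁ := V) (F₂ := ℝ)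
    (E₁ := fun x : M => TangentSpace 𝓘(ℝ, V) x) (E₂ := Bundle.Trivial M ℝ)
    (b := fun q : Γ × Cotangent V M => q.1 • q.2.1)
    (φ := fun q => q.2.2.comp (mfderiv 𝓘(ℝ, V) 𝓘(ℝ, V) (fun x : M => q.1 • x) q.2.1).inverse)
    hb.continuousAt fun a => ?_
  have hframe := continuousAt_symm_trivializationAt (F := V)
    (E := fun x : M => TangentSpace 𝓘(ℝ, V) x) (a := fun _ => a) hb.continuousAt
    (mem_baseSet_trivializationAt V (fun x : M => TangentSpace 𝓘(ℝ, V) x) (q₀.1 • q₀.2.1))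
    continuousAt_const
  have hT := ((continuous_tangentMap_smul (V := V) (W := W) (M := M) (Γ := Γ)).continuousAt.comp
    (x := q₀) (f := fun q : Γ × Cotangent V M => (q.1⁻¹,
      (⟨q.1 • q.2.1, (trivializationAt V (fun x : M => TangentSpace 𝓘(ℝ, V) x)
        (q₀.1 • q₀.2.1)).symm (q.1 • q.2.1) a⟩ : TangentBundle 𝓘(ℝ, V) M)))
    (continuous_fst.inv.continuousAt.prodMk hframe))
  have hT' := hT.congr (Eventually.of_forall fun q => tangentMap_inv_smul q.1 q.2.1 _)
  have happ := ContinuousAt.clm_bundle_apply (𝕜 := ℝ) (F₁ := V) (F₂ := ℝ)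
    (E₁ := fun x : M => TangentSpace 𝓘(ℝ, V) x) (E₂ := Bundle.Trivial M ℝ)
    (b := fun q : Γ × Cotangent V M => q.2.1) (ϕ := fun q => q.2.2) (x := q₀)
    continuous_snd.continuousAt hT'
  rw [FiberBundle.continuousAt_totalSpace] at happ ⊢
  exact ⟨hb.continuousAt, happ.2⟩

end Action

/-! ### Schur's lemma for irreducible `*`-representations -/

section Schur

variable {A : Type*} [NonUnitalRing A] [StarRing A] [Module ℂ A]
  {H : Type*} [NormedAddCommGroup H] [InnerProductSpace ℂ H] [CompleteSpace H]
  {r : A →⋆ₙₐ[ℂ] (H →L[ℂ] H)}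

theorem IsIrreducibleRep.nontrivial (hr : IsIrreducibleRep r) : Nontrivial H := by
  obtain ⟨a, ha⟩ := hr.ne_zero
  by_contra h
  rw [not_nontrivial_iff_subsingleton] at h
  exact ha (ContinuousLinearMap.ext fun v => Subsingleton.elim _ _)

theorem IsIrreducibleRep.eq_zero_or_eq_zero_of_mul_eq_zero (hr : IsIrreducibleRep r)
    {S T : H →L[ℂ] H} (hS : ∀ a, Commute S (r a)) (h : S * T = 0) : S = 0 ∨ T = 0 := by
  have hinv : ∀ a, ∀ v ∈ LinearMap.ker (S : H →ₗ[ℂ] H), r a v ∈ LinearMap.ker (S : H →ₗ[ℂ] H) := by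
    intro a v hv
    have h1 : S (r a v) = r a (S v) := congrArg (fun f : H →L[ℂ] H => f v) (hS a)
    have h2 : S v = 0 := hv
    change S (r a v) = 0
    rw [h1, h2, map_zero]
  rcases hr.eq_bot_or_eq_top _ (ContinuousLinearMap.isClosed_ker S) hinv with hb | ht
  · right
    ext v
    have : T v ∈ LinearMap.ker (S : H →ₗ[ℂ] H) := congrArg (fun f : H →L[ℂ] H => f v) h
    rw [hb] at this
    simpa using this
  · left
    ext v
    have : v ∈ LinearMap.ker (S : H →ₗ[ℂ] H) := by rw [ht]; trivial
    simpa using this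

/-- Schur's lemma: a normal operator that commutes with an irreducible representation has only one
point in its spectrum, because two disjoint bumps around different points of the spectrum would
give commuting operators with product zero. -/
theorem IsIrreducibleRep.exists_eq_smul_id (hr : IsIrreducibleRep r) {T : H →L[ℂ] H}
    (hT : IsStarNormal T) (h1 : ∀ a, Commute T (r a)) :
    ∃ c : ℂ, T = c • ContinuousLinearMap.id ℂ H := by
  have := hr.nontrivial
  have h2 : ∀ a, Commute (star T) (r a) := by
    intro a
    have := (h1 (star a)).star_star
    rwa [map_star, star_star] at this
  obtain ⟨c, hc⟩ := spectrum.nonempty T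
  refine ⟨c, ?_⟩
  have hs : ∀ d ∈ spectrum ℂ T, d = c := by
    intro d hd
    by_contra hne
    let bump : ℂ → ℂ → ℂ := fun w z => ((max 0 (dist d c / 2 - dist z w) : ℝ) : ℂ)
    have hcont : ∀ w, Continuous (bump w) := fun w => by fun_prop
    have hpos : 0 < dist d c := dist_pos.2 hne
    have hbump : ∀ w, bump w w ≠ 0 := by
      intro w
      simp only [bump, dist_self, sub_zero]
      rw [max_eq_right (by positivity)]
      exact_mod_cast (by positivity : dist d c / 2 ≠ 0)
    have hmul : cfc (bump c) T * cfc (bump d) T = 0 := by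
      rw [← cfc_mul (bump c) (bump d) T (hcont c).continuousOn (hcont d).continuousOn]
      rw [← cfc_zero ℂ T]
      congr 1
      ext z
      by_cases hz : dist d c / 2 ≤ dist z c
      · simp [bump, max_eq_left (sub_nonpos.2 hz)]
      · have : dist d c / 2 ≤ dist z d := by
          have := dist_triangle d z c
          rw [dist_comm d z] at this
          linarith
        simp [bump, max_eq_left (sub_nonpos.2 this)]
    have hne0 : ∀ w ∈ spectrum ℂ T, cfc (bump w) T ≠ 0 := by
      intro w hw h0
      have := cfc_map_spectrum (bump w) T hT (hcont w).continuousOn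
      rw [h0, spectrum.zero_eq] at this
      have h3 : bump w w ∈ bump w '' spectrum ℂ T := ⟨w, hw, rfl⟩
      rw [← this] at h3
      exact hbump w h3
    rcases hr.eq_zero_or_eq_zero_of_mul_eq_zero
      (fun a => Commute.cfc (h1 a) (h2 a) (bump c)) hmul with h | h
    · exact hne0 c hc h
    · exact hne0 d hd h
  calc T = cfc id T := (cfc_id ℂ T).symm
    _ = cfc (fun _ => c) T := cfc_congr fun z hz => hs z hz
    _ = c • ContinuousLinearMap.id ℂ H := by
      rw [cfc_const c T, Algebra.algebraMap_eq_smul_one]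
      rfl

theorem smul_id_injective {H : Type*} [NormedAddCommGroup H] [InnerProductSpace ℂ H]
    [Nontrivial H] :
    Function.Injective fun c : ℂ => c • ContinuousLinearMap.id ℂ H := by
  intro c d h
  obtain ⟨v, hv⟩ := exists_ne (0 : H)
  have := congrArg (fun f : H →L[ℂ] H => f v) h
  exact smul_left_injective ℂ hv this

/-- A central subalgebra acts by a character in every irreducible representation. -/
theorem IsIrreducibleRep.exists_character (hr : IsIrreducibleRep r)
    {Z : Type*} [NonUnitalRing Z] [StarRing Z] [Module ℂ Z] (φ : Z →⋆ₙₐ[ℂ] A)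
    (hφ : ∀ z a, Commute (φ z) a) :
    ∃ c : Z →⋆ₙₐ[ℂ] ℂ, ∀ z, r (φ z) = c z • ContinuousLinearMap.id ℂ H := by
  have := hr.nontrivial
  have h : ∀ z, ∃ c : ℂ, r (φ z) = c • ContinuousLinearMap.id ℂ H := by
    intro z
    refine hr.exists_eq_smul_id ⟨?_⟩ fun a => (hφ z a).map r
    rw [← map_star]
    exact ((hφ z (star (φ z))).symm).map r
  choose c hc using h
  have key : ∀ {x y : ℂ}, x • ContinuousLinearMap.id ℂ H = y • ContinuousLinearMap.id ℂ H → x = y :=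
    fun h => smul_id_injective h
  refine ⟨{ toFun := c, map_smul' := ?_, map_zero' := ?_, map_add' := ?_, map_mul' := ?_,
            map_star' := ?_ }, hc⟩
  · intro m z
    apply key
    rw [← hc, map_smul, map_smul, hc]
    simp [smul_smul]
  · apply key
    rw [← hc]
    simp
  · intro z w
    apply key
    rw [← hc, map_add, map_add, hc, hc, add_smul]
  · intro z w
    apply key
    rw [← hc, map_mul, map_mul, hc, hc]
    ext v
    simp [smul_smul, mul_comm]
  · intro z
    apply key
    rw [← hc, map_star, map_star, hc, star_smul]
    congr 1
    exact star_one (H →L[ℂ] H)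

/-- The kernel of a finite-dimensional irreducible representation is primitive, in whatever universe
the representation space lives. -/
theorem IsIrreducibleRep.isPrimitiveIdeal_ker {A : Type u} [NonUnitalRing A] [StarRing A]
    [Module ℂ A] {H : Type*} [NormedAddCommGroup H] [InnerProductSpace ℂ H] [CompleteSpace H]
    [FiniteDimensional ℂ H] {r : A →⋆ₙₐ[ℂ] (H →L[ℂ] H)} (hr : IsIrreducibleRep r) :
    IsPrimitiveIdeal (TwoSidedIdeal.ker r) := by
  let b := (stdOrthonormalBasis ℂ H).reindex (Equiv.ulift.{u}.symm)
  let e := b.repr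
  refine ⟨EuclideanSpace ℂ (ULift.{u} (Fin (Module.finrank ℂ H))), inferInstance, inferInstance,
    inferInstance, e.conjStarAlgEquiv.toNonUnitalStarAlgHom.comp r,
    ⟨?_, ?_⟩, ?_⟩
  · obtain ⟨a, ha⟩ := hr.ne_zero
    exact ⟨a, fun h => ha ((map_eq_zero_iff _ e.conjStarAlgEquiv.injective).1 h)⟩
  · intro K hK hinv
    let K' : Submodule ℂ H := K.comap (e.toLinearEquiv : H →ₗ[ℂ] _)
    have hmem : ∀ v, v ∈ K' ↔ e v ∈ K := fun v => Iff.rfl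
    have hinv' : ∀ a, ∀ v ∈ K', r a v ∈ K' := by
      intro a v hv
      have := hinv a _ hv
      change e (r a (e.symm (e v))) ∈ K at this
      rwa [e.symm_apply_apply] at this
    rcases hr.eq_bot_or_eq_top K' (hK.preimage e.continuous) hinv' with h | h
    · left
      rw [eq_bot_iff]
      intro v hv
      have : e.symm v ∈ K' := by rwa [hmem, e.apply_symm_apply]
      rw [h] at this
      have h0 : e.symm v = 0 := this
      simpa using h0
    · right
      rw [eq_top_iff]
      intro v _
      have : e.symm v ∈ K' := by rw [h]; trivial
      rwa [hmem, e.apply_symm_apply] at this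
  · ext a
    rw [TwoSidedIdeal.mem_ker, TwoSidedIdeal.mem_ker]
    exact (map_eq_zero_iff _ e.conjStarAlgEquiv.injective).symm

end Schur

/-! ### Endomorphisms of Hermitian vector bundles -/

section HermitianBundle

variable {M : Type*} [TopologicalSpace M]
  {F : Type*} [NormedAddCommGroup F] [InnerProductSpace ℂ F]
  {E : M → Type*} [TopologicalSpace (TotalSpace F E)] [∀ x, NormedAddCommGroup (E x)]
  [∀ x, InnerProductSpace ℂ (E x)] [FiberBundle F E] [VectorBundle ℂ F E]
  {Y : Type*} [TopologicalSpace Y] {b : Y → M}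

theorem ContinuousEnd.continuousAt_apply {f : ∀ y, E (b y) →L[ℂ] E (b y)} (hf : ContinuousEnd F f)
    {w : ∀ y, E (b y)} {y : Y}
    (hw : ContinuousAt (fun y => (⟨b y, w y⟩ : TotalSpace F E)) y) :
    ContinuousAt (fun y => (⟨b y, f y (w y)⟩ : TotalSpace F E)) y :=
  ContinuousAt.clm_bundle_apply (𝕜 := ℂ) (F₁ := F) (F₂ := F) (E₁ := E) (E₂ := E)
    (Continuous.continuousAt hf) hw

variable (F) in
/-- The trivialization at `x` identifies the nearby fibres of `E` with `F`. -/
def fiberEquiv (E : M → Type*) [TopologicalSpace (TotalSpace F E)] [∀ x, NormedAddCommGroup (E x)]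
    [∀ x, InnerProductSpace ℂ (E x)] [FiberBundle F E] [VectorBundle ℂ F E]
    {x y : M} (hy : y ∈ (trivializationAt F E x).baseSet) : E y ≃L[ℂ] F :=
  (trivializationAt F E x).continuousLinearEquivAt ℂ y hy

theorem fiberEquiv_symm_apply {x y : M} (hy : y ∈ (trivializationAt F E x).baseSet) (a : F) :
    (fiberEquiv F E hy).symm a = (trivializationAt F E x).symm y a := by
  simp [fiberEquiv]

theorem inCoordinates_eq_fiberEquiv {x y : M} (hy : y ∈ (trivializationAt F E x).baseSet)
    (T : E y →L[ℂ] E y) : ContinuousLinearMap.inCoordinates F E F E x y x y T =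
      (fiberEquiv F E hy : E y →L[ℂ] F).comp
        (T.comp ((fiberEquiv F E hy).symm : F →L[ℂ] E y)) :=
  ContinuousLinearMap.inCoordinates_eq hy hy

variable (F) in
theorem finiteDimensional_fiber [FiniteDimensional ℂ F] (x : M) : FiniteDimensional ℂ (E x) :=
  (fiberEquiv F E
    (mem_baseSet_trivializationAt F E x)).symm.toLinearEquiv.finiteDimensional

variable (F) in
theorem finrank_fiber (x : M) : Module.finrank ℂ (E x) = Module.finrank ℂ F :=
  (fiberEquiv F E (mem_baseSet_trivializationAt F E x)).toLinearEquiv.finrank_eq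

variable [FiniteDimensional ℂ F]

/-- Near a point, the coordinates of a vector are bounded by its length. -/
theorem exists_norm_fiberEquiv_le (hE : Continuous fun p : TotalSpace F E => ‖p.2‖ ^ 2) (x : M) :
    ∃ C : ℝ, ∀ᶠ y in 𝓝 x, ∀ hy : y ∈ (trivializationAt F E x).baseSet, ∀ v : E y,
      ‖fiberEquiv F E hy v‖ ≤ C * ‖v‖ := by
  have : ProperSpace F := FiniteDimensional.proper ℂ F
  set e := trivializationAt F E x
  have hx : x ∈ e.baseSet := mem_baseSet_trivializationAt F E x
  have hcont : ∀ a : F, ContinuousAt (fun z : M × F => ‖e.symm z.1 z.2‖ ^ 2) (x, a) := fun a =>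
    hE.continuousAt.comp (continuousAt_symm_trivializationAt (F := F) (E := E) (x := x)
      (y := (x, a)) (b := Prod.fst) (a := Prod.snd) continuousAt_fst hx continuousAt_snd)
  have hpos : ∀ a : F, a ≠ 0 → 0 < ‖e.symm x a‖ ^ 2 := by
    intro a ha
    rw [← fiberEquiv_symm_apply hx]
    exact pow_pos (norm_pos_iff.2 (by simpa using ha)) 2
  obtain ⟨δ, hδ, hδ'⟩ : ∃ δ > 0, ∀ a ∈ Metric.sphere (0 : F) 1, δ < ‖e.symm x a‖ ^ 2 := by
    by_cases hne : (Metric.sphere (0 : F) 1).Nonempty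
    · obtain ⟨a, ha, hmin⟩ := (isCompact_sphere (0 : F) 1).exists_isMinOn hne
        (f := fun a => ‖e.symm x a‖ ^ 2) fun a _ => by
          exact (ContinuousAt.comp (x := a) (f := fun a => (x, a))
            (g := fun z : M × F => ‖e.symm z.1 z.2‖ ^ 2) (hcont a)
            (by fun_prop)).continuousWithinAt
      have ha0 : a ≠ 0 := by
        rintro rfl
        simp at ha
      refine ⟨‖e.symm x a‖ ^ 2 / 2, half_pos (hpos a ha0), fun c hc => ?_⟩
      exact (half_lt_self (hpos a ha0)).trans_le (hmin hc)
    · exact ⟨1, one_pos, fun a ha => (hne ⟨a, ha⟩).elim⟩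
  refine ⟨(Real.sqrt δ)⁻¹, ?_⟩
  have key := (isCompact_sphere (0 : F) 1).eventually_forall_of_forall_eventually (x₀ := x)
    (P := fun y a => δ < ‖e.symm y a‖ ^ 2)
    fun a ha => (hcont a).eventually (lt_mem_nhds (hδ' a ha))
  filter_upwards [key] with y hy hyb v
  rw [inv_mul_eq_div, le_div_iff₀ (Real.sqrt_pos.2 hδ)]
  set a := fiberEquiv F E hyb v with ha
  have hv : v = (fiberEquiv F E hyb).symm a := by simp [ha]
  by_cases h0 : a = 0
  · simp [h0]
  have h1 := hy (‖a‖⁻¹ • a) (by simp [norm_smul, h0])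
  rw [← fiberEquiv_symm_apply hyb, ← Complex.coe_smul, map_smul, ← hv, norm_smul] at h1
  have h2 : Real.sqrt δ ≤ ‖a‖⁻¹ * ‖v‖ := by
    rw [Real.sqrt_le_left (by positivity)]
    simpa using h1.le
  have h3 : 0 < ‖a‖ := norm_pos_iff.2 h0
  calc ‖a‖ * Real.sqrt δ ≤ ‖a‖ * (‖a‖⁻¹ * ‖v‖) := by gcongr
    _ = ‖v‖ := by field_simp

/-- A section that vanishes at a point is continuous there if its length tends to zero. -/
theorem continuousAt_of_tendsto_norm_zero (hE : Continuous fun p : TotalSpace F E => ‖p.2‖ ^ 2)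
    {w : ∀ y, E (b y)} {y₀ : Y} (hb : ContinuousAt b y₀)
    (h0 : w y₀ = 0) (hw : Tendsto (fun y => ‖w y‖) (𝓝 y₀) (𝓝 0)) :
    ContinuousAt (fun y => (⟨b y, w y⟩ : TotalSpace F E)) y₀ := by
  rw [FiberBundle.continuousAt_totalSpace]
  refine ⟨hb, ?_⟩
  obtain ⟨C, hC⟩ := exists_norm_fiberEquiv_le hE (b y₀)
  have hval : ∀ y (hy : b y ∈ (trivializationAt F E (b y₀)).baseSet),
      (trivializationAt F E (b y₀) ⟨b y, w y⟩).2 = fiberEquiv F E hy (w y) := fun y hy => rfl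
  have hmem := mem_baseSet_trivializationAt F E (b y₀)
  unfold ContinuousAt
  simp only
  rw [hval y₀ hmem, h0, map_zero]
  rw [tendsto_zero_iff_norm_tendsto_zero]
  refine squeeze_zero' (Eventually.of_forall fun y => norm_nonneg _) ?_
    (by simpa using hw.const_mul C)
  filter_upwards [hb.eventually hC,
    hb ((trivializationAt F E (b y₀)).open_baseSet.mem_nhds hmem)] with y h1 h2
  rw [hval y h2]
  exact h1 h2 _

theorem continuousEnd_of_frame {f : ∀ y, E (b y) →L[ℂ] E (b y)} (hb : Continuous b)
    (h : ∀ y₀ (a : F), ContinuousAt (fun y =>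
      (⟨b y, f y ((trivializationAt F E (b y₀)).symm (b y) a)⟩ : TotalSpace F E)) y₀) :
    ContinuousEnd F f :=
  continuous_iff_continuousAt.2 fun y₀ =>
    continuousAt_hom_bundle_of_frame (𝕜 := ℂ) hb.continuousAt (h y₀)

variable [∀ x, CompleteSpace (E x)]

/-- The square of the Hilbert–Schmidt norm of an endomorphism of a finite-dimensional Hilbert
space, as a trace. -/
def hsNormSq {H : Type*} [NormedAddCommGroup H] [InnerProductSpace ℂ H] [CompleteSpace H]
    (T : H →L[ℂ] H) : ℝ :=
  (LinearMap.trace ℂ H ((star T * T : H →L[ℂ] H) : H →ₗ[ℂ] H)).re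

section HilbertSchmidt

variable {H : Type*} [NormedAddCommGroup H] [InnerProductSpace ℂ H] [CompleteSpace H]

theorem hsNormSq_eq_sum {ι : Type*} [Fintype ι] (e : OrthonormalBasis ι ℂ H) (T : H →L[ℂ] H) :
    hsNormSq T = ∑ i, ‖T (e i)‖ ^ 2 := by
  rw [hsNormSq, LinearMap.trace_eq_sum_inner _ e, Complex.re_sum]
  refine Finset.sum_congr rfl fun i _ => ?_
  change (inner ℂ (e i) ((star T) (T (e i)))).re = _
  rw [ContinuousLinearMap.star_eq_adjoint, ContinuousLinearMap.adjoint_inner_right]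
  exact inner_self_eq_norm_sq (𝕜 := ℂ) _

variable [FiniteDimensional ℂ H]

theorem hsNormSq_nonneg (T : H →L[ℂ] H) : 0 ≤ hsNormSq T := by
  rw [hsNormSq_eq_sum (stdOrthonormalBasis ℂ H)]
  positivity

theorem norm_le_sqrt_hsNormSq (T : H →L[ℂ] H) : ‖T‖ ≤ Real.sqrt (hsNormSq T) := by
  refine T.opNorm_le_bound (Real.sqrt_nonneg _) fun v => ?_
  let e := stdOrthonormalBasis ℂ H
  rw [hsNormSq_eq_sum e]
  calc ‖T v‖ = ‖∑ i, inner ℂ (e i) v • T (e i)‖ := by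
        conv_lhs => rw [← e.sum_repr' v, map_sum]
        simp only [map_smul]
    _ ≤ ∑ i, ‖T (e i)‖ * ‖inner ℂ (e i) v‖ := by
        refine (norm_sum_le _ _).trans_eq (Finset.sum_congr rfl fun i _ => ?_)
        rw [norm_smul, mul_comm]
    _ ≤ Real.sqrt (∑ i, ‖T (e i)‖ ^ 2) * Real.sqrt (∑ i, ‖inner ℂ (e i) v‖ ^ 2) :=
        Real.sum_mul_le_sqrt_mul_sqrt _ _ _
    _ = Real.sqrt (∑ i, ‖T (e i)‖ ^ 2) * ‖v‖ := by
        rw [e.sum_sq_norm_inner_right, Real.sqrt_sq (norm_nonneg _)]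

theorem hsNormSq_le (T : H →L[ℂ] H) : hsNormSq T ≤ Module.finrank ℂ H * ‖T‖ ^ 2 := by
  let e := stdOrthonormalBasis ℂ H
  rw [hsNormSq_eq_sum e]
  calc ∑ i, ‖T (e i)‖ ^ 2 ≤ ∑ _i : Fin (Module.finrank ℂ H), ‖T‖ ^ 2 := by
        refine Finset.sum_le_sum fun i _ => ?_
        gcongr
        simpa using T.le_opNorm (e i)
    _ = _ := by simp

end HilbertSchmidt

theorem ContinuousEnd.continuous_hsNormSq (hb : Continuous b)
    (hE : Continuous fun p : TotalSpace F E => ‖p.2‖ ^ 2) {f : ∀ y, E (b y) →L[ℂ] E (b y)}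
    (hf : ContinuousEnd F f) : Continuous fun y => hsNormSq (f y) := by
  have h := (hf.star_section hb hE).mul hb hf
  rw [continuousEnd_iff hb] at h
  rw [continuous_iff_continuousAt]
  intro y₀
  have htr : Continuous fun T : F →L[ℂ] F => LinearMap.trace ℂ F (T : F →ₗ[ℂ] F) :=
    ((LinearMap.trace ℂ F).comp (ContinuousLinearMap.coeLM ℂ)).continuous_of_finiteDimensional
  refine (Complex.continuous_re.continuousAt.comp (htr.continuousAt.comp (h y₀))).congr ?_
  filter_upwards [hb.continuousAt ((trivializationAt F E (b y₀)).open_baseSet.mem_nhds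
    (mem_baseSet_trivializationAt F E (b y₀)))] with y hy
  simp only [Function.comp_apply]
  rw [inCoordinates_eq_fiberEquiv hy]
  exact congrArg Complex.re (LinearMap.trace_conj'
    ((star (f y) * f y : E (b y) →L[ℂ] E (b y)) : E (b y) →ₗ[ℂ] E (b y))
    (fiberEquiv F E hy).toLinearEquiv)

end HermitianBundle

/-! ### The representation of the stabilizer on the fibre -/

section FiberAction

variable {V : Type*} [NormedAddCommGroup V] [NormedSpace ℝ V]
  {M : Type*} [TopologicalSpace M] [ChartedSpace V M]
  [RiemannianBundle (fun x : M => TangentSpace 𝓘(ℝ, V) x)]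
  {F : Type*} {E : M → Type*} [∀ x, NormedAddCommGroup (E x)] [∀ x, InnerProductSpace ℂ (E x)]
  {Γ : Type*} [Group Γ] [MulAction Γ M] [IsIsometricAction V M Γ]
  {𝓔 : EquivariantStructure Γ F E}

/-- The action of `γ` on the fibres of `E`, as an isometric isomorphism. -/
def EquivariantStructure.actEquiv (𝓔 : EquivariantStructure Γ F E) (γ : Γ) (ξ : Cosphere V M) :
    E ξ.base ≃ₗᵢ[ℂ] E (γ • ξ).base :=
  LinearIsometryEquiv.ofSurjective (𝓔.actAt γ ξ) (𝓔.act_surjective γ ξ.base)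

theorem EquivariantStructure.actEquiv_apply (γ : Γ) (ξ : Cosphere V M) (v : E ξ.base) :
    𝓔.actEquiv γ ξ v = 𝓔.actAt γ ξ v := rfl

theorem act_inv_actEquiv (γ : Γ) (ξ : Cosphere V M) (w : E (γ • ξ).base) :
    (⟨γ⁻¹ • γ • ξ.base, 𝓔.act γ⁻¹ (γ • ξ.base) w⟩ : TotalSpace F E) =
      ⟨ξ.base, (𝓔.actEquiv γ ξ).symm w⟩ := by
  obtain ⟨v, rfl⟩ := (𝓔.actEquiv γ ξ).surjective w
  rw [LinearIsometryEquiv.symm_apply_apply]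
  have h := 𝓔.mul_act γ⁻¹ γ ξ.base v
  rw [inv_mul_cancel, 𝓔.one_act] at h
  exact h.symm

/-- The pull-back `γ⁻¹ ∘ f (γ ξ) ∘ γ` of a section of `End E` by `γ`. -/
def pullbackEnd (𝓔 : EquivariantStructure Γ F E)
    (f : ∀ ξ : Cosphere V M, E ξ.base →L[ℂ] E ξ.base) (γ : Γ) (ξ : Cosphere V M) :
    E ξ.base →L[ℂ] E ξ.base :=
  ((𝓔.actEquiv γ ξ).symm.toContinuousLinearEquiv : E (γ • ξ).base →L[ℂ] E ξ.base).comp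
    ((f (γ • ξ)).comp ((𝓔.actEquiv γ ξ).toContinuousLinearEquiv : E ξ.base →L[ℂ] E (γ • ξ).base))

theorem pullbackEnd_apply (f : ∀ ξ : Cosphere V M, E ξ.base →L[ℂ] E ξ.base) (γ : Γ)
    (ξ : Cosphere V M) (v : E ξ.base) :
    pullbackEnd 𝓔 f γ ξ v = (𝓔.actEquiv γ ξ).symm (f (γ • ξ) (𝓔.actEquiv γ ξ v)) := rfl

theorem pullbackEnd_smul (f : ∀ ξ : Cosphere V M, E ξ.base →L[ℂ] E ξ.base) (γ δ : Γ)
    (ξ : Cosphere V M) (v : E ξ.base) :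
    pullbackEnd 𝓔 f γ (δ • ξ) (𝓔.actEquiv δ ξ v) =
      𝓔.actEquiv δ ξ (pullbackEnd 𝓔 f (γ * δ) ξ v) := by
  -- a section maps equal vectors of the total space to equal vectors
  have aux : ∀ (η η' : Cosphere V M) (w : E η.base) (w' : E η'.base), η = η' →
      (⟨η.base, w⟩ : TotalSpace F E) = ⟨η'.base, w'⟩ →
      (⟨η.base, f η w⟩ : TotalSpace F E) = ⟨η'.base, f η' w'⟩ := by
    rintro η _ w w' rfl h
    rw [eq_of_heq (TotalSpace.mk.inj h).2]
  have hmul : ∀ w : E ξ.base, (⟨((γ * δ) • ξ).base, 𝓔.actEquiv (γ * δ) ξ w⟩ : TotalSpace F E) =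
      ⟨(γ • δ • ξ).base, 𝓔.actEquiv γ (δ • ξ) (𝓔.actEquiv δ ξ w)⟩ :=
    fun w => 𝓔.mul_act γ δ ξ.base w
  rw [pullbackEnd_apply, LinearIsometryEquiv.symm_apply_eq]
  have h1 := aux _ _ _ _ (mul_smul γ δ ξ) (hmul v)
  have h2 := hmul (pullbackEnd 𝓔 f (γ * δ) ξ v)
  rw [pullbackEnd_apply, LinearIsometryEquiv.apply_symm_apply, h1] at h2
  exact eq_of_heq (TotalSpace.mk.inj h2).2

/-- The identification of two fibres over equal points. -/
def fiberCast {M : Type*} {E : M → Type*} [∀ x, NormedAddCommGroup (E x)]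
    [∀ x, InnerProductSpace ℂ (E x)] {x y : M} (h : x = y) : E x ≃ₗᵢ[ℂ] E y :=
  h ▸ LinearIsometryEquiv.refl ℂ (E x)

theorem mk_fiberCast {M F : Type*} {E : M → Type*} [∀ x, NormedAddCommGroup (E x)]
    [∀ x, InnerProductSpace ℂ (E x)] {x y : M} (h : x = y) (v : E x) :
    (⟨y, fiberCast h v⟩ : TotalSpace F E) = ⟨x, v⟩ := by
  subst h
  rfl

theorem base_stabilizer_smul {ξ : Cosphere V M} (g : MulAction.stabilizer Γ ξ) :
    ((g : Γ) • ξ).base = ξ.base :=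
  congrArg Cosphere.base g.2

/-- The unitary representation of the stabilizer `Γ_ξ` on the fibre of `E` at the base point of
`ξ`. -/
def fiberRep (𝓔 : EquivariantStructure Γ F E) (ξ : Cosphere V M) :
    Representation ℂ (MulAction.stabilizer Γ ξ) (E ξ.base) where
  toFun g := (fiberCast (E := E) (base_stabilizer_smul g)).toLinearEquiv.toLinearMap ∘ₗ
    (𝓔.actAt g ξ).toLinearMap
  map_one' := by
    ext v
    have h := (mk_fiberCast (F := F) (base_stabilizer_smul (1 : MulAction.stabilizer Γ ξ))
      (𝓔.actAt 1 ξ v)).trans (𝓔.one_act ξ.base v)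
    exact eq_of_heq (TotalSpace.mk.inj h).2
  map_mul' g h := by
    ext v
    have h1 := (mk_fiberCast (F := F) (base_stabilizer_smul (g * h))
      (𝓔.actAt (g * h : Γ) ξ v)).trans (𝓔.mul_act g h ξ.base v)
    have h2 := mk_fiberCast (F := F) (base_stabilizer_smul h) (𝓔.actAt (h : Γ) ξ v)
    have h3 := congrArg (fun p : TotalSpace F E =>
      (⟨(g : Γ) • p.1, 𝓔.act g p.1 p.2⟩ : TotalSpace F E)) h2
    have h4 := mk_fiberCast (F := F) (base_stabilizer_smul g) (𝓔.actAt (g : Γ) ξ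
      (fiberCast (base_stabilizer_smul h) (𝓔.actAt (h : Γ) ξ v)))
    exact eq_of_heq (TotalSpace.mk.inj (h1.trans (h4.trans h3).symm)).2

theorem mk_fiberRep (ξ : Cosphere V M) (g : MulAction.stabilizer Γ ξ) (v : E ξ.base) :
    (⟨ξ.base, fiberRep 𝓔 ξ g v⟩ : TotalSpace F E) = ⟨((g : Γ) • ξ).base, 𝓔.actAt (g : Γ) ξ v⟩ :=
  mk_fiberCast _ _

theorem norm_fiberRep (ξ : Cosphere V M) (g : MulAction.stabilizer Γ ξ) (v : E ξ.base) :
    ‖fiberRep 𝓔 ξ g v‖ = ‖v‖ :=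
  ((fiberCast (E := E) (base_stabilizer_smul g)).norm_map _).trans ((𝓔.actAt (g : Γ) ξ).norm_map v)

/-- The vectors `f (g ξ) (g v)` and `f ξ (g v)` of the total space are equal for `g ∈ Γ_ξ`. -/
theorem mk_apply_actAt (f : ∀ ξ : Cosphere V M, E ξ.base →L[ℂ] E ξ.base) (ξ : Cosphere V M)
    (g : MulAction.stabilizer Γ ξ) (v : E ξ.base) :
    (⟨((g : Γ) • ξ).base, f ((g : Γ) • ξ) (𝓔.actAt (g : Γ) ξ v)⟩ : TotalSpace F E) =
      ⟨ξ.base, f ξ (fiberRep 𝓔 ξ g v)⟩ := by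
  have aux : ∀ (η η' : Cosphere V M) (w : E η.base) (w' : E η'.base), η = η' →
      (⟨η.base, w⟩ : TotalSpace F E) = ⟨η'.base, w'⟩ →
      (⟨η.base, f η w⟩ : TotalSpace F E) = ⟨η'.base, f η' w'⟩ := by
    rintro η _ w w' rfl h
    rw [eq_of_heq (TotalSpace.mk.inj h).2]
  exact aux _ _ _ _ g.2 (mk_fiberRep ξ g v).symm

theorem pullbackEnd_stabilizer {f : ∀ ξ : Cosphere V M, E ξ.base →L[ℂ] E ξ.base}
    {ξ : Cosphere V M} (hf : ∀ g v, f ξ (fiberRep 𝓔 ξ g v) = fiberRep 𝓔 ξ g (f ξ v))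
    (g : MulAction.stabilizer Γ ξ) : pullbackEnd 𝓔 f g ξ = f ξ := by
  ext v
  rw [pullbackEnd_apply, LinearIsometryEquiv.symm_apply_eq]
  have h := mk_apply_actAt (𝓔 := 𝓔) f ξ g v
  rw [hf, mk_fiberRep] at h
  exact eq_of_heq (TotalSpace.mk.inj h).2

end FiberAction

/-! ### Factorization of invariant symbols -/

section Factorization

variable {V : Type*} [NormedAddCommGroup V] [NormedSpace ℝ V]
  {M : Type*} [TopologicalSpace M] [ChartedSpace V M] [IsManifold 𝓘(ℝ, V) ∞ M]
  [RiemannianBundle (fun x : M => TangentSpace 𝓘(ℝ, V) x)]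
  {F : Type*} [NormedAddCommGroup F] [InnerProductSpace ℂ F] [FiniteDimensional ℂ F]
  {E : M → Type*} [TopologicalSpace (TotalSpace F E)] [∀ x, NormedAddCommGroup (E x)]
  [∀ x, InnerProductSpace ℂ (E x)] [∀ x, CompleteSpace (E x)] [FiberBundle F E]
  [VectorBundle ℂ F E] [IsSmoothHermitian V F E]
  {Γ : Type*} [Group Γ] [MulAction Γ M] [IsIsometricAction V M Γ]
  {𝓔 : EquivariantStructure Γ F E}

theorem hsNormSq_smul (f : invariantSymbols V 𝓔) (γ : Γ) (ξ : Cosphere V M) :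
    hsNormSq (f.1 (γ • ξ)) = hsNormSq (f.1 ξ) := by
  have := finiteDimensional_fiber F (E := E) ξ.base
  let e := stdOrthonormalBasis ℂ (E ξ.base)
  rw [hsNormSq_eq_sum e, hsNormSq_eq_sum (e.map (𝓔.actEquiv γ ξ))]
  refine Finset.sum_congr rfl fun i _ => ?_
  rw [OrthonormalBasis.map_apply, EquivariantStructure.actEquiv_apply, f.2.2 γ ξ,
    LinearIsometry.norm_map]

theorem tendsto_hsNormSq (f : invariantSymbols V 𝓔) :
    Tendsto (fun ξ => hsNormSq (f.1 ξ)) (cocompact (Cosphere V M)) (𝓝 0) := by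
  have h : Tendsto (fun ξ => (Module.finrank ℂ F : ℝ) * ‖f.1 ξ‖ ^ 2) (cocompact (Cosphere V M))
      (𝓝 0) := by
    simpa using (f.2.1.2.pow 2).const_mul (Module.finrank ℂ F : ℝ)
  refine squeeze_zero (fun ξ => ?_) (fun ξ => ?_) h
  · have := finiteDimensional_fiber F (E := E) ξ.base
    exact hsNormSq_nonneg _
  · have := finiteDimensional_fiber F (E := E) ξ.base
    rw [← finrank_fiber F (E := E) ξ.base]
    exact hsNormSq_le _

/-- Every invariant symbol `f` is a product of an invariant function with another invariant symbol:
if `n` is the Hilbert–Schmidt norm of `f`, then `f = √n • (f / √n)`. -/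
theorem exists_eq_smul (f : invariantSymbols V 𝓔) :
    ∃ (z : invariantFunctions V M Γ) (g : invariantSymbols V 𝓔),
      f = centralInclusion V 𝓔 z * g ∧ ∀ ξ, f.1 ξ = 0 → z.1 ξ = 0 := by
  have hE : Continuous fun p : TotalSpace F E => ‖p.2‖ ^ 2 :=
    (IsSmoothHermitian.contMDiff_norm_sq (V := V)).continuous
  have hb := continuous_base (V := V) (M := M)
  have hf := f.2.1.1
  let k : Cosphere V M → ℝ := fun ξ => √√(hsNormSq (f.1 ξ))
  have hk : Continuous k := (hf.continuous_hsNormSq hb hE).sqrt.sqrt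
  have hk0 : Tendsto k (cocompact (Cosphere V M)) (𝓝 0) := by
    simpa [k] using (tendsto_hsNormSq f).sqrt.sqrt
  have hkf : ∀ ξ, ‖f.1 ξ‖ ≤ k ξ ^ 2 := by
    intro ξ
    have := finiteDimensional_fiber F (E := E) ξ.base
    simpa only [k, Real.sq_sqrt (Real.sqrt_nonneg _)] using norm_le_sqrt_hsNormSq (f.1 ξ)
  have hkn : ∀ ξ, 0 ≤ k ξ := fun ξ => Real.sqrt_nonneg _
  have hkinv : ∀ (γ : Γ) ξ, k (γ • ξ) = k ξ := by
    intro γ ξ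
    simp only [k, hsNormSq_smul]
  have hfk : ∀ ξ, k ξ = 0 → f.1 ξ = 0 := by
    intro ξ h
    have := hkf ξ
    rw [h] at this
    simpa using this
  let g : ∀ ξ : Cosphere V M, E ξ.base →L[ℂ] E ξ.base := fun ξ => ((k ξ : ℂ)⁻¹) • f.1 ξ
  have hgk : ∀ ξ, ‖g ξ‖ ≤ k ξ := by
    intro ξ
    rcases (hkn ξ).eq_or_lt with h | h
    · simp [g, ← h]
    · simp only [g, norm_smul, norm_inv, Complex.norm_real, Real.norm_of_nonneg (hkn ξ)]
      rw [inv_mul_le_iff₀ h, ← sq]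
      exact hkf ξ
  have hg : ContinuousEnd F g := by
    refine continuousEnd_of_frame hb fun ξ₀ a => ?_
    have hs := continuousAt_symm_trivializationAt (F := F) (E := E) (a := fun _ => a)
      hb.continuousAt (mem_baseSet_trivializationAt F E (Cosphere.base ξ₀)) continuousAt_const
    by_cases h0 : k ξ₀ = 0
    -- where `f` vanishes, `g` is continuous because of the bound `‖g‖ ≤ k`
    · refine continuousAt_of_tendsto_norm_zero hE hb.continuousAt ?_ ?_
      · simp [g, h0]
      · have hn : ContinuousAt (fun ξ : Cosphere V M =>
            √(‖(trivializationAt F E ξ₀.base).symm ξ.base a‖ ^ 2)) ξ₀ :=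
          (hE.continuousAt.comp hs).sqrt
        have hz := (hk.continuousAt (x := ξ₀)).mul hn
        rw [ContinuousAt, Pi.mul_apply, h0, zero_mul] at hz
        refine squeeze_zero (fun ξ => norm_nonneg _) (fun ξ => ?_) hz
        rw [Pi.mul_apply, Real.sqrt_sq (norm_nonneg _)]
        exact (ContinuousLinearMap.le_opNorm _ _).trans
          (mul_le_mul_of_nonneg_right (hgk ξ) (norm_nonneg _))
    · have h1 : ContinuousAt (fun ξ : Cosphere V M => ((k ξ : ℂ)⁻¹)) ξ₀ :=
        (Complex.continuous_ofReal.comp hk).continuousAt.inv₀ (by simpa using h0)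
      have h2 := hf.continuousAt_apply hs
      rw [FiberBundle.continuousAt_totalSpace] at h2 ⊢
      refine ⟨h2.1, (h1.smul h2.2).congr ?_⟩
      filter_upwards [hb.continuousAt
        ((trivializationAt F E (Cosphere.base ξ₀)).open_baseSet.mem_nhds
          (mem_baseSet_trivializationAt F E (Cosphere.base ξ₀)))] with ξ hξ
      exact ((fiberEquiv F E hξ).map_smul ((k ξ : ℂ)⁻¹) _).symm
  refine ⟨⟨⟨⟨fun ξ => (k ξ : ℂ), Complex.continuous_ofReal.comp hk⟩, ?_⟩, ?_⟩,
    ⟨g, ⟨hg, ?_⟩, ?_⟩, ?_, ?_⟩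
  · exact (Complex.continuous_ofReal.tendsto' 0 0 Complex.ofReal_zero).comp hk0
  · intro γ ξ
    exact congrArg Complex.ofReal (hkinv γ ξ)
  · exact squeeze_zero (fun ξ => norm_nonneg _) hgk hk0
  · intro γ ξ v
    change ((k (γ • ξ) : ℂ)⁻¹) • f.1 (γ • ξ) _ = 𝓔.actAt γ ξ (((k ξ : ℂ)⁻¹) • f.1 ξ v)
    rw [hkinv, f.2.2 γ ξ v, map_smul]
  · apply Subtype.ext
    funext ξ
    ext v
    change f.1 ξ v = (k ξ : ℂ) • ((k ξ : ℂ)⁻¹) • f.1 ξ v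
    by_cases h : k ξ = 0
    · simp [hfk ξ h]
    · rw [smul_inv_smul₀ (by simpa using h)]
  · intro ξ h
    change (k ξ : ℂ) = 0
    simp [k, h, hsNormSq]

end Factorization

/-! ### Averages of sections over the group -/

section Averaging

open MeasureTheory

variable {V : Type*} [NormedAddCommGroup V] [NormedSpace ℝ V]
  {M : Type*} [TopologicalSpace M] [ChartedSpace V M] [IsManifold 𝓘(ℝ, V) ∞ M]
  [RiemannianBundle (fun x : M => TangentSpace 𝓘(ℝ, V) x)]
  {F : Type*} [NormedAddCommGroup F] [InnerProductSpace ℂ F] [FiniteDimensional ℂ F]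
  {E : M → Type*} [TopologicalSpace (TotalSpace F E)] [∀ x, NormedAddCommGroup (E x)]
  [∀ x, InnerProductSpace ℂ (E x)] [∀ x, CompleteSpace (E x)] [FiberBundle F E]
  [VectorBundle ℂ F E] [IsSmoothHermitian V F E]
  {Γ : Type*} [Group Γ] [TopologicalSpace Γ] [IsTopologicalGroup Γ] [CompactSpace Γ]
  [MulAction Γ M] [IsIsometricAction V M Γ] [ContinuousSMul Γ (Cosphere V M)]
  {𝓔 : EquivariantStructure Γ F E}

/-- The action `Γ × E → E` on the total space is continuous. -/
def EquivariantStructure.ContinuousAct (𝓔 : EquivariantStructure Γ F E) : Prop :=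
  Continuous fun p : Γ × TotalSpace F E =>
    (⟨p.1 • p.2.1, 𝓔.act p.1 p.2.1 p.2.2⟩ : TotalSpace F E)

theorem continuousEnd_pullbackEnd (h𝓔 : 𝓔.ContinuousAct)
    {f : ∀ ξ : Cosphere V M, E ξ.base →L[ℂ] E ξ.base} (hf : ContinuousEnd F f) :
    ContinuousEnd F (fun q : Γ × Cosphere V M => pullbackEnd 𝓔 f q.1 q.2) := by
  have hb := continuous_base (V := V) (M := M)
  refine continuousEnd_of_frame (b := fun q : Γ × Cosphere V M => q.2.base)
    (hb.comp continuous_snd) fun q₀ a => ?_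
  have hs := continuousAt_symm_trivializationAt (F := F) (E := E) (a := fun _ => a)
    (hb.comp continuous_snd).continuousAt
    (mem_baseSet_trivializationAt F E (Cosphere.base q₀.2)) continuousAt_const
  have h1 := (Continuous.continuousAt h𝓔).comp (x := q₀)
    (f := fun q : Γ × Cosphere V M => (q.1, (⟨q.2.base,
      (trivializationAt F E q₀.2.base).symm q.2.base a⟩ : TotalSpace F E)))
    (continuous_fst.continuousAt.prodMk hs)
  have hf' : ContinuousEnd F (b := fun q : Γ × Cosphere V M => (q.1 • q.2).base)
      fun q => f (q.1 • q.2) := Continuous.comp hf continuous_smul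
  have h2 := hf'.continuousAt_apply (y := q₀)
    (w := fun q => 𝓔.actEquiv q.1 q.2 ((trivializationAt F E q₀.2.base).symm q.2.base a)) h1
  have h3 := (Continuous.continuousAt h𝓔).comp (x := q₀)
    (f := fun q : Γ × Cosphere V M => (q.1⁻¹, (⟨(q.1 • q.2).base, f (q.1 • q.2)
      (𝓔.actEquiv q.1 q.2 ((trivializationAt F E q₀.2.base).symm q.2.base a))⟩ : TotalSpace F E)))
    (continuous_fst.inv.continuousAt.prodMk h2)
  exact h3.congr (Eventually.of_forall fun q => act_inv_actEquiv q.1 q.2 _)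

theorem continuous_pullbackEnd (h𝓔 : 𝓔.ContinuousAct)
    {f : ∀ ξ : Cosphere V M, E ξ.base →L[ℂ] E ξ.base} (hf : ContinuousEnd F f)
    (ξ : Cosphere V M) : Continuous fun γ => pullbackEnd 𝓔 f γ ξ := by
  rw [(FiberBundle.totalSpaceMk_isInducing (F →L[ℂ] F) (fun x => E x →L[ℂ] E x)
    ξ.base).continuous_iff]
  have h := continuousEnd_pullbackEnd h𝓔 hf
  unfold ContinuousEnd at h
  exact h.comp (continuous_id.prodMk continuous_const : Continuous fun γ : Γ => (γ, ξ))

variable [MeasurableSpace Γ] [BorelSpace Γ] (μ : Measure Γ)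

/-- The integral over `Γ` of the pull-backs of a section of `End E`; the measure need not be
normalized. -/
def averageEnd (𝓔 : EquivariantStructure Γ F E)
    (f : ∀ ξ : Cosphere V M, E ξ.base →L[ℂ] E ξ.base) (ξ : Cosphere V M) :
    E ξ.base →L[ℂ] E ξ.base :=
  ∫ γ, pullbackEnd 𝓔 f γ ξ ∂μ

variable [IsFiniteMeasure μ]

theorem integrable_pullbackEnd (h𝓔 : 𝓔.ContinuousAct)
    {f : ∀ ξ : Cosphere V M, E ξ.base →L[ℂ] E ξ.base} (hf : ContinuousEnd F f)
    (ξ : Cosphere V M) : Integrable (fun γ => pullbackEnd 𝓔 f γ ξ) μ := by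
  have := finiteDimensional_fiber F (E := E) ξ.base
  exact (continuous_pullbackEnd h𝓔 hf ξ).integrable_of_hasCompactSupport
    (HasCompactSupport.of_compactSpace _)

theorem averageEnd_equivariant [μ.IsMulRightInvariant] (h𝓔 : 𝓔.ContinuousAct)
    {f : ∀ ξ : Cosphere V M, E ξ.base →L[ℂ] E ξ.base} (hf : ContinuousEnd F f) (δ : Γ)
    (ξ : Cosphere V M) (v : E ξ.base) :
    averageEnd μ 𝓔 f (δ • ξ) (𝓔.actAt δ ξ v) = 𝓔.actAt δ ξ (averageEnd μ 𝓔 f ξ v) := by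
  change averageEnd μ 𝓔 f (δ • ξ) (𝓔.actEquiv δ ξ v) = 𝓔.actEquiv δ ξ (averageEnd μ 𝓔 f ξ v)
  rw [averageEnd, averageEnd, ContinuousLinearMap.integral_apply
    (integrable_pullbackEnd μ h𝓔 hf _), ContinuousLinearMap.integral_apply
    (integrable_pullbackEnd μ h𝓔 hf _)]
  simp_rw [pullbackEnd_smul]
  rw [integral_mul_right_eq_self (fun γ => 𝓔.actEquiv δ ξ (pullbackEnd 𝓔 f γ ξ v)) δ]
  exact (𝓔.actEquiv δ ξ).toContinuousLinearEquiv.integral_comp_comm _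

/-- Integrals over a compact space depend continuously on a parameter. -/
theorem continuousAt_integral_of_compactSpace {X G : Type*} [TopologicalSpace X]
    [NormedAddCommGroup G] [NormedSpace ℝ G] {c : Γ × X → G} {x₀ : X}
    (hc : ∀ γ, ContinuousAt c (γ, x₀)) (hi : ∀ᶠ x in 𝓝 x₀, Integrable (fun γ => c (γ, x)) μ) :
    ContinuousAt (fun x => ∫ γ, c (γ, x) ∂μ) x₀ := by
  rw [Metric.continuousAt_iff']
  intro ε hε
  set m : ℝ := μ.real Set.univ
  have hm : 0 ≤ m := measureReal_nonneg
  set δ := ε / (m + 1)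
  have hδ : 0 < δ := by positivity
  have key := (isCompact_univ (X := Γ)).eventually_forall_of_forall_eventually (x₀ := x₀)
    (P := fun x γ => ‖c (γ, x) - c (γ, x₀)‖ < δ) (by
      intro γ _
      have h1 : ContinuousAt (fun z : X × Γ => c (z.2, z.1)) (x₀, γ) :=
        (hc γ).comp (x := (x₀, γ)) (f := Prod.swap) continuous_swap.continuousAt
      have h2 : ContinuousAt (fun z : X × Γ => c (z.2, x₀)) (x₀, γ) :=
        (hc γ).comp (x := (x₀, γ)) (f := fun z : X × Γ => (z.2, x₀))
          (by fun_prop)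
      have h3 := (h1.sub h2).norm
      refine h3.eventually (gt_mem_nhds ?_)
      simpa using hδ)
  filter_upwards [key, hi] with x hx hix
  rw [dist_eq_norm, ← integral_sub hix hi.self_of_nhds]
  calc ‖∫ γ, (c (γ, x) - c (γ, x₀)) ∂μ‖ ≤ δ * m :=
        norm_integral_le_of_norm_le_const (Eventually.of_forall fun γ => (hx γ trivial).le)
    _ < ε := by
        rw [div_mul_eq_mul_div, div_lt_iff₀ (by positivity)]
        nlinarith

theorem continuousEnd_averageEnd (h𝓔 : 𝓔.ContinuousAct)
    {f : ∀ ξ : Cosphere V M, E ξ.base →L[ℂ] E ξ.base} (hf : ContinuousEnd F f) :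
    ContinuousEnd F (averageEnd μ 𝓔 f) := by
  have hb := continuous_base (V := V) (M := M)
  rw [continuousEnd_iff hb]
  intro ξ₀
  have hp := continuousEnd_pullbackEnd h𝓔 hf
  rw [continuousEnd_iff (hb.comp continuous_snd)] at hp
  -- taking coordinates is a continuous linear map, so it commutes with the integral
  have hL : ∀ ξ : Cosphere V M, ∃ L : (E ξ.base →L[ℂ] E ξ.base) →L[ℂ] (F →L[ℂ] F), ∀ T,
      L T = ContinuousLinearMap.inCoordinates F E F E ξ₀.base ξ.base ξ₀.base ξ.base T := by
    intro ξ
    exact ⟨(ContinuousLinearMap.compL ℂ F (E ξ.base) F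
      ((trivializationAt F E ξ₀.base).continuousLinearMapAt ℂ ξ.base)).comp
      ((ContinuousLinearMap.compL ℂ F (E ξ.base) (E ξ.base)).flip
        ((trivializationAt F E ξ₀.base).symmL ℂ ξ.base)), fun T => rfl⟩
  choose L hL using hL
  refine (continuousAt_integral_of_compactSpace μ (c := fun q : Γ × Cosphere V M =>
    L q.2 (pullbackEnd 𝓔 f q.1 q.2)) (x₀ := ξ₀) (fun γ => ?_)
    (Eventually.of_forall fun ξ => ?_)).congr (Eventually.of_forall fun ξ => ?_)
  · refine (hp (γ, ξ₀)).congr (Eventually.of_forall fun q => (hL _ _).symm)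
  · exact (L ξ).integrable_comp (integrable_pullbackEnd μ h𝓔 hf ξ)
  · beta_reduce
    rw [← hL]
    exact (L ξ).integral_comp_comm (integrable_pullbackEnd μ h𝓔 hf ξ)

/-- The integral over `Γ` of a compactly supported continuous section is an invariant symbol. -/
theorem averageEnd_mem [μ.IsMulRightInvariant] (h𝓔 : 𝓔.ContinuousAct)
    {f : ∀ ξ : Cosphere V M, E ξ.base →L[ℂ] E ξ.base} (hf : ContinuousEnd F f)
    {K : Set (Cosphere V M)} (hK : IsCompact K) (hfK : ∀ ξ ∉ K, f ξ = 0) :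
    averageEnd μ 𝓔 f ∈ invariantSymbols V 𝓔 := by
  refine ⟨⟨continuousEnd_averageEnd μ h𝓔 hf, ?_⟩, averageEnd_equivariant μ h𝓔 hf⟩
  have hK' : IsCompact ((fun q : Γ × Cosphere V M => q.1⁻¹ • q.2) '' (Set.univ ×ˢ K)) :=
    (isCompact_univ.prod hK).image (by fun_prop)
  refine tendsto_const_nhds.congr' ?_
  filter_upwards [hK'.compl_mem_cocompact] with ξ hξ
  have : ∀ γ, pullbackEnd 𝓔 f γ ξ = 0 := by
    intro γ
    have : f (γ • ξ) = 0 := hfK _ fun h => hξ ⟨(γ, γ • ξ), ⟨trivial, h⟩, by simp⟩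
    ext v
    simp [pullbackEnd_apply, this]
  simp [averageEnd, this]

end Averaging

/-! ### Existence of invariant functions and invariant symbols -/

section Existence

open MeasureTheory

variable {V : Type*} [NormedAddCommGroup V] [NormedSpace ℝ V]
  {M : Type*} [TopologicalSpace M] [ChartedSpace V M] [IsManifold 𝓘(ℝ, V) ∞ M]
  [RiemannianBundle (fun x : M => TangentSpace 𝓘(ℝ, V) x)]
  {F : Type*} [NormedAddCommGroup F] [InnerProductSpace ℂ F] [FiniteDimensional ℂ F]
  {E : M → Type*} [TopologicalSpace (TotalSpace F E)] [∀ x, NormedAddCommGroup (E x)]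
  [∀ x, InnerProductSpace ℂ (E x)] [∀ x, CompleteSpace (E x)] [FiberBundle F E]
  [VectorBundle ℂ F E] [IsSmoothHermitian V F E]
  {Γ : Type*} [Group Γ] [TopologicalSpace Γ] [IsTopologicalGroup Γ] [CompactSpace Γ]
  [MulAction Γ M] [IsIsometricAction V M Γ] [ContinuousSMul Γ (Cosphere V M)]
  [LocallyCompactSpace (Cosphere V M)] [T2Space (Cosphere V M)]
  {𝓔 : EquivariantStructure Γ F E}

/-- Invariant functions vanishing at infinity separate a point from the complement of an invariant
neighbourhood. -/
theorem exists_invariantFunctions_ne_zero {U : Set (Cosphere V M)} (hU : IsOpen U)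
    (hinv : ∀ (γ : Γ) (ξ), γ • ξ ∈ U → ξ ∈ U) {ξ : Cosphere V M} (hξ : ξ ∈ U) :
    ∃ z : invariantFunctions V M Γ, z.1 ξ ≠ 0 ∧ ∀ η ∉ U, z.1 η = 0 := by
  let _ : MeasurableSpace Γ := borel Γ
  have : BorelSpace Γ := ⟨rfl⟩
  -- the inverse of the left Haar measure is right invariant
  let μ : Measure Γ := (Measure.haar : Measure Γ).inv
  have : IsFiniteMeasure μ := inferInstanceAs (IsFiniteMeasure (Measure.map _ _))
  obtain ⟨ψ, hψξ, hψc, hψU, hψ⟩ := exists_continuousMap_one_of_isCompact_subset_isOpen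
    (isCompact_singleton (x := ξ)) hU (Set.singleton_subset_iff.2 hξ)
  have hz : Continuous fun η : Cosphere V M => ∫ γ : Γ, ψ (γ • η) ∂μ := by
    rw [continuous_iff_continuousAt]
    intro η
    refine continuousAt_integral_of_compactSpace μ
      (c := fun q : Γ × Cosphere V M => ψ (q.1 • q.2))
      (fun γ => (ψ.continuous.comp continuous_smul).continuousAt)
      (Eventually.of_forall fun η => ?_)
    exact (ψ.continuous.comp (continuous_id.smul continuous_const)).integrable_of_hasCompactSupport
      (HasCompactSupport.of_compactSpace _)
  have hK : IsCompact ((fun q : Γ × Cosphere V M => q.1⁻¹ • q.2) ''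
      (Set.univ ×ˢ tsupport ψ)) :=
    (isCompact_univ.prod hψc).image (by fun_prop)
  have hψ0 : ∀ η ∉ tsupport ψ, ψ η = 0 := fun η hη => image_eq_zero_of_notMem_tsupport hη
  refine ⟨⟨⟨⟨fun η => ((∫ γ : Γ, ψ (γ • η) ∂μ : ℝ) : ℂ), Complex.continuous_ofReal.comp hz⟩, ?_⟩,
    ?_⟩, ?_, ?_⟩
  · refine tendsto_const_nhds.congr' ?_
    filter_upwards [hK.compl_mem_cocompact] with η hη
    have : ∀ γ : Γ, ψ (γ • η) = 0 := fun γ =>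
      hψ0 _ fun h => hη ⟨(γ, γ • η), ⟨trivial, h⟩, by simp⟩
    simp [this]
  · intro γ η
    change ((∫ δ : Γ, ψ (δ • γ • η) ∂μ : ℝ) : ℂ) = ((∫ δ : Γ, ψ (δ • η) ∂μ : ℝ) : ℂ)
    simp_rw [← mul_smul]
    rw [integral_mul_right_eq_self (fun δ => ψ (δ • η)) γ]
  · have h : 0 < ∫ γ : Γ, ψ (γ • ξ) ∂μ := by
      refine Continuous.integral_pos_of_hasCompactSupport_nonneg_nonzero (x := (1 : Γ))
        (ψ.continuous.comp (continuous_id.smul continuous_const))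
        (HasCompactSupport.of_compactSpace _) (fun γ => (hψ _).1) ?_
      have : ψ ξ = 1 := hψξ rfl
      simp [this]
    exact Complex.ofReal_ne_zero.2 h.ne'
  · intro η hη
    have : ∀ γ : Γ, ψ (γ • η) = 0 := fun γ => hψ0 _ fun h => hη (hinv γ η (hψU h))
    change ((∫ γ : Γ, ψ (γ • η) ∂μ : ℝ) : ℂ) = 0
    simp [this]

theorem isCompact_orbit (ξ : Cosphere V M) : IsCompact (MulAction.orbit Γ ξ) :=
  isCompact_range (continuous_id.smul continuous_const)

theorem mem_orbit_of_invariantFunctions {ξ η : Cosphere V M}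
    (h : ∀ z : invariantFunctions V M Γ, z.1 η = 0 → z.1 ξ = 0) : ξ ∈ MulAction.orbit Γ η := by
  by_contra hξ
  obtain ⟨z, hz, hz'⟩ := exists_invariantFunctions_ne_zero (Γ := Γ)
    (isCompact_orbit (Γ := Γ) η).isClosed.isOpen_compl
    (fun γ ζ hζ hmem => hζ ((MulAction.mem_orbit_iff.2 (by
      obtain ⟨δ, rfl⟩ := hmem
      exact ⟨γ * δ, mul_smul _ _ _⟩)))) hξ
  exact hz (h z (hz' η (fun h => h (MulAction.mem_orbit_self η))))

/-- Every endomorphism of a fibre extends to a continuous section. -/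
theorem exists_continuousEnd_eq (ξ₀ : Cosphere V M) (T : E ξ₀.base →L[ℂ] E ξ₀.base) :
    ∃ f : ∀ ξ : Cosphere V M, E ξ.base →L[ℂ] E ξ.base, ContinuousEnd F f ∧ f ξ₀ = T := by
  have hb := continuous_base (V := V) (M := M)
  set e := trivializationAt F E ξ₀.base with he
  have hξ₀ : ξ₀.base ∈ e.baseSet := mem_baseSet_trivializationAt F E ξ₀.base
  obtain ⟨ψ, hψξ, -, hψU, -⟩ := exists_continuousMap_one_of_isCompact_subset_isOpen
    (isCompact_singleton (x := ξ₀)) (e.open_baseSet.preimage hb)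
    (Set.singleton_subset_iff.2 hξ₀)
  let T' : F →L[ℂ] F := (fiberEquiv F E hξ₀ : E ξ₀.base →L[ℂ] F).comp
    (T.comp ((fiberEquiv F E hξ₀).symm : F →L[ℂ] E ξ₀.base))
  let f : ∀ ξ : Cosphere V M, E ξ.base →L[ℂ] E ξ.base := fun ξ =>
    (ψ ξ : ℂ) • ((e.symmL ℂ ξ.base).comp (T'.comp (e.continuousLinearMapAt ℂ ξ.base)))
  have hf : ∀ ξ (hξ : ξ.base ∈ e.baseSet) v, f ξ v =
      e.symm ξ.base ((ψ ξ : ℂ) • T' (e ⟨ξ.base, v⟩).2) := by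
    intro ξ hξ v
    rw [← fiberEquiv_symm_apply hξ, map_smul, fiberEquiv_symm_apply hξ]
    simp only [f, smul_apply, ContinuousLinearMap.comp_apply]
    rw [e.symmL_apply hξ, e.continuousLinearMapAt_apply (R := ℂ), e.linearMapAt_apply (R := ℂ),
      if_pos hξ]
  refine ⟨f, continuousEnd_of_frame hb fun ξ₁ a => ?_, ?_⟩
  · by_cases h : ξ₁.base ∈ e.baseSet
    · have hs := continuousAt_symm_trivializationAt (F := F) (E := E) (a := fun _ => a)
        hb.continuousAt (mem_baseSet_trivializationAt F E (Cosphere.base ξ₁)) continuousAt_const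
      have h1 := (e.continuousOn.continuousAt (e.open_source.mem_nhds (e.mem_source.2 h))).comp
        (x := ξ₁) (f := fun ξ : Cosphere V M => (⟨ξ.base,
          (trivializationAt F E ξ₁.base).symm ξ.base a⟩ : TotalSpace F E)) hs
      have h2 := (Complex.continuous_ofReal.comp ψ.continuous).continuousAt.smul
        (T'.continuous.continuousAt.comp (continuous_snd.continuousAt.comp h1))
      refine (continuousAt_symm_trivializationAt (F := F) (E := E) hb.continuousAt h h2).congr ?_
      filter_upwards [hb.continuousAt (e.open_baseSet.mem_nhds h)] with ξ hξ
      rw [hf ξ hξ]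
      rfl
    · have hzero : ∀ᶠ ξ in 𝓝 ξ₁, f ξ = 0 := by
        filter_upwards [(isClosed_tsupport ψ).isOpen_compl.mem_nhds (fun h' => h (hψU h'))]
          with ξ hξ
        simp [f, image_eq_zero_of_notMem_tsupport hξ]
      refine ((Bundle.Trivialization.continuous_zeroSection ℂ (F := F)
        (E := E)).comp hb).continuousAt.congr ?_
      filter_upwards [hzero] with ξ hξ
      rw [hξ]
      rfl
  · have : ψ ξ₀ = 1 := hψξ rfl
    ext v
    rw [hf ξ₀ hξ₀, this, Complex.ofReal_one, one_smul, ← fiberEquiv_symm_apply hξ₀,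
      ContinuousLinearEquiv.symm_apply_eq]
    have : (e ⟨ξ₀.base, v⟩).2 = fiberEquiv F E hξ₀ v := rfl
    rw [this]
    simp [T']

/-- The values at `ξ` of the invariant symbols are all the endomorphisms of the fibre that commute
with the stabilizer of `ξ`. Averaging an extension of `T` cut off near `ξ` gives an
approximation of a multiple of `T`, and the space of values is closed, being
finite-dimensional. -/
theorem exists_invariantSymbols_eq (h𝓔 : 𝓔.ContinuousAct) {ξ : Cosphere V M}
    {T : E ξ.base →L[ℂ] E ξ.base}
    (hT : ∀ g v, T (fiberRep 𝓔 ξ g v) = fiberRep 𝓔 ξ g (T v)) :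
    ∃ f : invariantSymbols V 𝓔, f.1 ξ = T := by
  let _ : MeasurableSpace Γ := borel Γ
  have : BorelSpace Γ := ⟨rfl⟩
  -- the inverse of the left Haar measure is right invariant
  let μ : Measure Γ := (Measure.haar : Measure Γ).inv
  have : IsFiniteMeasure μ := inferInstanceAs (IsFiniteMeasure (Measure.map _ _))
  have := finiteDimensional_fiber F (E := E) ξ.base
  let S : Submodule ℂ (E ξ.base →L[ℂ] E ξ.base) :=
    { carrier := {T | ∃ f : invariantSymbols V 𝓔, f.1 ξ = T}
      zero_mem' := ⟨0, rfl⟩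
      add_mem' := by
        rintro _ _ ⟨f, rfl⟩ ⟨g, rfl⟩
        exact ⟨f + g, rfl⟩
      smul_mem' := by
        rintro c _ ⟨f, rfl⟩
        exact ⟨c • f, rfl⟩ }
  suffices h : T ∈ S from h
  have hS : IsClosed (S : Set (E ξ.base →L[ℂ] E ξ.base)) := S.closed_of_finiteDimensional
  rw [← SetLike.mem_coe, ← hS.closure_eq, Metric.mem_closure_iff]
  intro ε hε
  obtain ⟨f, hf, rfl⟩ := exists_continuousEnd_eq (F := F) ξ T
  have hP := continuous_pullbackEnd h𝓔 hf ξ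
  let D : Set Γ := {γ | ε / 2 ≤ ‖pullbackEnd 𝓔 f γ ξ - f ξ‖}
  have hD : IsCompact ((fun γ : Γ => γ • ξ) '' D) :=
    (isClosed_le continuous_const (hP.sub continuous_const).norm).isCompact.image
      (continuous_id.smul continuous_const)
  have hξD : ξ ∉ (fun γ : Γ => γ • ξ) '' D := by
    rintro ⟨γ, hγ, hγξ⟩
    have := pullbackEnd_stabilizer hT ⟨γ, hγξ⟩
    simp only [D, Set.mem_ofPred_eq, this, sub_self, norm_zero] at hγ
    linarith
  obtain ⟨ψ, hψξ, hψc, hψU, hψ⟩ := exists_continuousMap_one_of_isCompact_subset_isOpen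
    (isCompact_singleton (x := ξ)) hD.isClosed.isOpen_compl (Set.singleton_subset_iff.2 hξD)
  have hψγ : Continuous fun γ : Γ => ψ (γ • ξ) :=
    ψ.continuous.comp (continuous_id.smul continuous_const)
  have hint : Integrable (fun γ : Γ => ψ (γ • ξ)) μ :=
    hψγ.integrable_of_hasCompactSupport (HasCompactSupport.of_compactSpace _)
  set m := ∫ γ : Γ, ψ (γ • ξ) ∂μ with hm_def
  have hm : 0 < m := by
    refine Continuous.integral_pos_of_hasCompactSupport_nonneg_nonzero (x := (1 : Γ)) hψγ
      (HasCompactSupport.of_compactSpace _) (fun γ => (hψ _).1) ?_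
    have : ψ ξ = 1 := hψξ rfl
    simp [this]
  have hψ0 : ∀ η ∉ tsupport ψ, ψ η = 0 := fun η hη => image_eq_zero_of_notMem_tsupport hη
  -- the extension cut off to the set where its pull-backs are close to the given endomorphism
  let f' : ∀ ξ : Cosphere V M, E ξ.base →L[ℂ] E ξ.base := fun η => (ψ η : ℂ) • f η
  have hf' : ContinuousEnd F f' :=
    (continuousEnd_scalar (F := F) (E := E) (continuous_base (V := V) (M := M))
      (Complex.continuous_ofReal.comp ψ.continuous)).mul continuous_base hf
  have hpb : ∀ γ, pullbackEnd 𝓔 f' γ ξ = ψ (γ • ξ) • pullbackEnd 𝓔 f γ ξ := by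
    intro γ
    ext v
    rw [← Complex.coe_smul, smul_apply, pullbackEnd_apply, pullbackEnd_apply, ← map_smul]
    rfl
  refine ⟨((m : ℂ)⁻¹) • averageEnd μ 𝓔 f' ξ, ⟨((m : ℂ)⁻¹) •
    ⟨_, averageEnd_mem μ h𝓔 hf' hψc fun η hη => by simp [f', hψ0 η hη]⟩, rfl⟩, ?_⟩
  have hclose : ‖averageEnd μ 𝓔 f' ξ - m • f ξ‖ ≤ ε / 2 * m := by
    have h1 : averageEnd μ 𝓔 f' ξ - m • f ξ =
        ∫ γ, ψ (γ • ξ) • (pullbackEnd 𝓔 f γ ξ - f ξ) ∂μ := by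
      rw [averageEnd, hm_def, ← integral_smul_const, ← integral_sub
        (integrable_pullbackEnd μ h𝓔 hf' ξ) (hint.smul_const _)]
      refine integral_congr_ae (Eventually.of_forall fun γ => ?_)
      simp only [hpb, smul_sub]
    rw [h1, hm_def, ← integral_const_mul]
    refine norm_integral_le_of_norm_le (hint.const_mul _) (Eventually.of_forall fun γ => ?_)
    rw [norm_smul, Real.norm_of_nonneg (hψ _).1, mul_comm]
    by_cases hγ : γ ∈ D
    · rw [hψ0 _ fun h => hψU h ⟨γ, hγ, rfl⟩]
      simp
    · exact mul_le_mul_of_nonneg_right (not_le.1 hγ).le (hψ _).1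
  have h2 : f ξ - ((m : ℂ)⁻¹) • averageEnd μ 𝓔 f' ξ =
      -((m⁻¹ : ℝ) • (averageEnd μ 𝓔 f' ξ - m • f ξ)) := by
    rw [smul_sub, inv_smul_smul₀ hm.ne', ← Complex.ofReal_inv, Complex.coe_smul]
    abel
  rw [dist_eq_norm, h2, norm_neg, norm_smul, Real.norm_of_nonneg (by positivity)]
  calc m⁻¹ * ‖averageEnd μ 𝓔 f' ξ - m • f ξ‖ ≤ m⁻¹ * (ε / 2 * m) := by gcongr
    _ = ε / 2 := by field_simp
    _ < ε := half_lt_self hε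

end Existence

/-! ### Characters of the algebra of invariant functions -/

section Characters

variable {V : Type*} [NormedAddCommGroup V] [NormedSpace ℝ V]
  {M : Type*} [TopologicalSpace M] [ChartedSpace V M] [IsManifold 𝓘(ℝ, V) ∞ M]
  [RiemannianBundle (fun x : M => TangentSpace 𝓘(ℝ, V) x)]
  {Γ : Type*} [Group Γ] [MulAction Γ M] [IsIsometricAction V M Γ]

/-- The kernel of a nonzero character `c` of `Z_M` vanishes at some point: otherwise, if `c w = 1`,
a finite sum `q` of squares `|z|²` with `c z = 0` would make `1 - |w|² + t q` strictly positive and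
hence invertible in the unitization of `Z_M`, although `c` maps it to `0`. -/
theorem exists_eval_eq_zero_of_character {c : invariantFunctions V M Γ →⋆ₙₐ[ℂ] ℂ}
    {w : invariantFunctions V M Γ} (hw : c w = 1) :
    ∃ ξ : Cosphere V M, ∀ z, c z = 0 → z.1 ξ = 0 := by
  by_contra! hcon
  choose z hz hzξ using hcon
  obtain ⟨K, hK, hKw⟩ := mem_cocompact.1
    ((zero_at_infty w.1).norm.eventually (gt_mem_nhds (by simp : ‖(0 : ℂ)‖ < 1 / 2)))
  obtain ⟨s, hs⟩ := hK.elim_finite_subcover (fun ξ => {η | (z ξ).1 η ≠ 0})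
    (fun ξ => isOpen_ne_fun (z ξ).1.continuous continuous_const)
    (fun ξ _ => Set.mem_iUnion.2 ⟨ξ, hzξ ξ⟩)
  let q : invariantFunctions V M Γ := ∑ ξ ∈ s, star (z ξ) * z ξ
  have hqc : c q = 0 := by
    simp only [q, map_sum, map_mul, hz, mul_zero, Finset.sum_const_zero]
  let qr : Cosphere V M → ℝ := fun η => ∑ ξ ∈ s, ‖(z ξ).1 η‖ ^ 2
  have hnormsq : ∀ x : ℂ, star x * x = ((‖x‖ ^ 2 : ℝ) : ℂ) := fun x => by
    rw [Complex.star_def, Complex.conj_mul', Complex.ofReal_pow]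
  have hq : ∀ η, q.1 η = (qr η : ℂ) := by
    intro η
    let ev : invariantFunctions V M Γ →+ ℂ :=
      { toFun := fun z => z.1 η, map_zero' := rfl, map_add' := fun _ _ => rfl }
    change ev q = _
    rw [map_sum]
    simp only [qr, Complex.ofReal_sum]
    exact Finset.sum_congr rfl fun ξ _ => hnormsq _
  have hqr : Continuous qr := by
    refine continuous_finsetSum _ fun ξ _ => ?_
    exact ((z ξ).1.continuous.norm).pow 2
  have hqr0 : ∀ η, 0 ≤ qr η := fun η => Finset.sum_nonneg fun _ _ => by positivity
  have hqrK : ∀ η ∈ K, 0 < qr η := by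
    intro η hη
    obtain ⟨ξ, hξs, hξ⟩ := Set.mem_iUnion₂.1 (hs hη)
    refine Finset.sum_pos' (fun _ _ => by positivity) ⟨ξ, hξs, ?_⟩
    exact pow_pos (norm_pos_iff.2 hξ) 2
  -- `t` is so large that `t q ≥ |w|²` on `K`
  obtain ⟨t, ht0, ht⟩ : ∃ t : ℝ, 0 ≤ t ∧ ∀ η ∈ K, ‖w.1 η‖ ^ 2 ≤ t * qr η := by
    rcases K.eq_empty_or_nonempty with rfl | hne
    · exact ⟨0, le_rfl, by simp⟩
    obtain ⟨η, hη, hmax⟩ := hK.exists_isMaxOn hne (f := fun η => ‖w.1 η‖ ^ 2 / qr η)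
      (ContinuousOn.div (w.1.continuous.norm.pow 2).continuousOn hqr.continuousOn
        fun η hη => (hqrK η hη).ne')
    exact ⟨‖w.1 η‖ ^ 2 / qr η, by have := hqr0 η; positivity, fun ζ hζ =>
      (div_le_iff₀ (hqrK ζ hζ)).1 (hmax hζ)⟩
  let g : invariantFunctions V M Γ := star w * w - (t : ℂ) • q
  let gr : Cosphere V M → ℝ := fun η => ‖w.1 η‖ ^ 2 - t * qr η
  have hg : ∀ η, g.1 η = (gr η : ℂ) := by
    intro η
    change star (w.1 η) * w.1 η - (t : ℂ) * q.1 η = _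
    rw [hq, hnormsq]
    simp [gr]
  have hgr : ∀ η, 3 / 4 ≤ 1 - gr η := by
    intro η
    by_cases hη : η ∈ K
    · have := ht η hη
      simp only [gr]
      linarith
    · have h1 : ‖w.1 η‖ < 1 / 2 := hKw hη
      have h2 : ‖w.1 η‖ ^ 2 ≤ (1 / 2) ^ 2 := by gcongr
      have h3 := mul_nonneg ht0 (hqr0 η)
      simp only [gr]
      linarith
  have hgc : c g = 1 := by
    have h1 : c g = c (star w * w) - c ((t : ℂ) • q) := map_sub c _ _
    have h2 : c ((t : ℂ) • q) = (t : ℂ) • c q := map_smul c _ _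
    rw [h1, h2, hqc, map_mul, map_star, hw]
    simp
  have hne : ∀ η, (1 : ℂ) - g.1 η ≠ 0 := by
    intro η h
    rw [hg] at h
    have h1 : 1 - gr η = 0 := by exact_mod_cast h
    linarith [hgr η]
  -- the inverse of `1 - g` in the unitization of `Z_M` is `1 + u`
  let u : invariantFunctions V M Γ := ⟨⟨⟨fun η => g.1 η / (1 - g.1 η),
      g.1.continuous.div (continuous_const.sub g.1.continuous) hne⟩, by
        have h := (zero_at_infty g.1).div (tendsto_const_nhds.sub (zero_at_infty g.1))
          (by simp : (1 : ℂ) - 0 ≠ 0)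
        rw [zero_div] at h
        exact h⟩, by
      intro γ η
      change g.1 (γ • η) / (1 - g.1 (γ • η)) = g.1 η / (1 - g.1 η)
      rw [g.2 γ η]⟩
  have hu : g = u - u * g := by
    apply Subtype.ext
    ext η
    change g.1 η = g.1 η / (1 - g.1 η) - g.1 η / (1 - g.1 η) * g.1 η
    have := hne η
    field_simp
  have h1 : c g = c u - c (u * g) := (congrArg c hu).trans (map_sub c _ _)
  rw [map_mul, hgc] at h1
  simp at h1

/-- The nonzero characters of `Z_M` are the evaluations at points. -/
theorem character_eq_eval {c : invariantFunctions V M Γ →⋆ₙₐ[ℂ] ℂ} (hc : ∃ w, c w ≠ 0)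
    (hZ : ∀ ξ : Cosphere V M, ∃ z : invariantFunctions V M Γ, z.1 ξ ≠ 0) :
    ∃ ξ : Cosphere V M, ∀ z, c z = z.1 ξ := by
  obtain ⟨w₀, hw₀⟩ := hc
  let w := (c w₀)⁻¹ • w₀
  have hw : c w = 1 := (map_smul c _ _).trans (inv_mul_cancel₀ hw₀)
  obtain ⟨ξ, hξ⟩ := exists_eval_eq_zero_of_character hw
  have hlin : ∀ z : invariantFunctions V M Γ, z.1 ξ = c z * w.1 ξ := by
    intro z
    have h1 : c (c z • w) = c z • c w := map_smul c _ _
    have h := hξ (z - c z • w) ((map_sub c _ _).trans (by rw [h1, hw]; simp))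
    exact sub_eq_zero.1 h
  obtain ⟨z, hz⟩ := hZ ξ
  have hw0 : w.1 ξ ≠ 0 := fun h => hz (by rw [hlin, h, mul_zero])
  have hww := hlin (w * w)
  rw [map_mul, hw, one_mul, one_mul] at hww
  have hw1 : w.1 ξ = 1 := mul_right_cancel₀ hw0 (hww.trans (one_mul _).symm)
  exact ⟨ξ, fun z => by rw [hlin, hw1, mul_one]⟩

end Characters

/-! ### Irreducible representations live over points -/

section IrreducibleReps

variable {V : Type*} [NormedAddCommGroup V] [NormedSpace ℝ V]
  {M : Type*} [TopologicalSpace M] [ChartedSpace V M] [IsManifold 𝓘(ℝ, V) ∞ M]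
  [RiemannianBundle (fun x : M => TangentSpace 𝓘(ℝ, V) x)]
  {F : Type*} [NormedAddCommGroup F] [InnerProductSpace ℂ F] [FiniteDimensional ℂ F]
  {E : M → Type*} [TopologicalSpace (TotalSpace F E)] [∀ x, NormedAddCommGroup (E x)]
  [∀ x, InnerProductSpace ℂ (E x)] [∀ x, CompleteSpace (E x)] [FiberBundle F E]
  [VectorBundle ℂ F E] [IsSmoothHermitian V F E]
  {Γ : Type*} [Group Γ] [MulAction Γ M] [IsIsometricAction V M Γ]
  {𝓔 : EquivariantStructure Γ F E}
  {H : Type*} [NormedAddCommGroup H] [InnerProductSpace ℂ H] [CompleteSpace H]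

theorem commute_centralInclusion (z : invariantFunctions V M Γ) (f : invariantSymbols V 𝓔) :
    Commute (centralInclusion V 𝓔 z) f := by
  apply Subtype.ext
  funext ξ
  ext v
  exact (map_smul (f.1 ξ) (z.1 ξ) v).symm

/-- An irreducible representation of the invariant symbols lives at a point `ξ`: the central
functions act by their values at `ξ`, and symbols that vanish at `ξ` act by zero. -/
theorem IsIrreducibleRep.exists_point {r : invariantSymbols V 𝓔 →⋆ₙₐ[ℂ] (H →L[ℂ] H)}
    (hr : IsIrreducibleRep r)
    (hZ : ∀ ξ : Cosphere V M, ∃ z : invariantFunctions V M Γ, z.1 ξ ≠ 0) :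
    ∃ (c : invariantFunctions V M Γ →⋆ₙₐ[ℂ] ℂ) (ξ : Cosphere V M), (∀ z, c z = z.1 ξ) ∧
      (∀ z, r (centralInclusion V 𝓔 z) = c z • ContinuousLinearMap.id ℂ H) ∧
      ∀ f, f.1 ξ = 0 → r f = 0 := by
  obtain ⟨c, hc⟩ := hr.exists_character (centralInclusion V 𝓔)
    fun z f => commute_centralInclusion z f
  have hc0 : ∃ w, c w ≠ 0 := by
    obtain ⟨f, hf⟩ := hr.ne_zero
    obtain ⟨z, g, rfl, -⟩ := exists_eq_smul f
    refine ⟨z, fun h => hf ?_⟩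
    rw [map_mul, hc, h, zero_smul, zero_mul]
  obtain ⟨ξ, hξ⟩ := character_eq_eval hc0 hZ
  refine ⟨c, ξ, hξ, hc, fun f hf => ?_⟩
  obtain ⟨z, g, rfl, hz⟩ := exists_eq_smul f
  rw [map_mul, hc, hξ, hz ξ hf, zero_smul, zero_mul]

end IrreducibleReps

/-! ### Unitary representations on finite-dimensional spaces -/

section Unitary

open Representation

variable {G : Type*} [Group G]
  {U : Type*} [NormedAddCommGroup U] [InnerProductSpace ℂ U] [FiniteDimensional ℂ U]
  {W : Type*} [NormedAddCommGroup W] [InnerProductSpace ℂ W] [FiniteDimensional ℂ W]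
  {σ : Representation ℂ G U} {τ : Representation ℂ G W}

theorem isIrreducible_iff_forall_submodule : σ.IsIrreducible ↔ Nontrivial U ∧
    ∀ K : Submodule ℂ U, (∀ g, ∀ v ∈ K, σ g v ∈ K) → K = ⊥ ∨ K = ⊤ := by
  constructor
  · intro h
    refine ⟨?_, fun K hK => ?_⟩
    · by_contra hU
      rw [not_nontrivial_iff_subsingleton] at hU
      refine bot_ne_top (α := Subrepresentation σ) (SetLike.ext fun v => ?_)
      exact ⟨fun _ => trivial, fun _ => Subsingleton.elim v 0⟩
    · let K' : Subrepresentation σ := ⟨K, fun g v hv => hK g v hv⟩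
      refine (eq_bot_or_eq_top K').imp (fun h => ?_) (fun h => ?_)
      · exact congrArg Subrepresentation.toSubmodule h
      · exact congrArg Subrepresentation.toSubmodule h
  · rintro ⟨hU, h⟩
    refine { exists_pair_ne := ⟨⊥, ⊤, fun hbt => ?_⟩, eq_bot_or_eq_top := fun K => ?_ }
    · obtain ⟨v, hv⟩ := exists_ne (0 : U)
      have : v ∈ (⊤ : Subrepresentation σ) := trivial
      rw [← hbt] at this
      exact hv this
    · refine (h K.toSubmodule fun g v hv => K.apply_mem_toSubmodule g hv).imp
        (fun h => ?_) (fun h => ?_)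
      · exact Subrepresentation.toSubmodule_injective h
      · exact Subrepresentation.toSubmodule_injective h

theorem inner_rep_left (hσ : ∀ g v, ‖σ g v‖ = ‖v‖) (g : G) (v w : U) :
    inner ℂ (σ g v) w = inner ℂ v (σ g⁻¹ w) := by
  let e : U →ₗᵢ[ℂ] U := ⟨σ g, hσ g⟩
  have h : σ g (σ g⁻¹ w) = w := by
    rw [← Module.End.mul_apply, ← map_mul, mul_inv_cancel, map_one, Module.End.one_apply]
  conv_lhs => rw [← h]
  exact e.inner_map_map v (σ g⁻¹ w)

theorem isIntertwiningMap_adjoint (hσ : ∀ g v, ‖σ g v‖ = ‖v‖) (hτ : ∀ g v, ‖τ g v‖ = ‖v‖)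
    {T : U →ₗ[ℂ] W} (hT : σ.IsIntertwiningMap τ T) : τ.IsIntertwiningMap σ T.adjoint := by
  refine ⟨fun g w => ext_inner_left ℂ fun v => ?_⟩
  have h1 := inner_rep_left hτ g⁻¹ (T v) w
  have h2 := inner_rep_left hσ g⁻¹ v (T.adjoint w)
  rw [inv_inv] at h1 h2
  rw [LinearMap.adjoint_inner_right, ← h1, ← h2, LinearMap.adjoint_inner_right, hT.1]

theorem isIntertwiningMap_comp {U' : Type*} [AddCommGroup U'] [Module ℂ U']
    {θ : Representation ℂ G U'} {S : U →ₗ[ℂ] W} {T : U' →ₗ[ℂ] U}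
    (hS : σ.IsIntertwiningMap τ S) (hT : θ.IsIntertwiningMap σ T) :
    θ.IsIntertwiningMap τ (S ∘ₗ T) :=
  ⟨fun g v => by rw [LinearMap.comp_apply, LinearMap.comp_apply, hT.1, hS.1]⟩

theorem isIntertwiningMap_eq_zero_of_apply (hσ : σ.IsIrreducible) {T : U →ₗ[ℂ] W}
    (hT : σ.IsIntertwiningMap τ T) {v : U} (hv : v ≠ 0) (h : T v = 0) : T = 0 := by
  rcases (isIrreducible_iff_forall_submodule.1 hσ).2 (LinearMap.ker T) (fun g w hw => by
    rw [LinearMap.mem_ker] at hw ⊢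
    rw [hT.1, hw, map_zero]) with hb | ht
  · have : v ∈ LinearMap.ker T := h
    rw [hb] at this
    exact absurd this hv
  · exact LinearMap.ker_eq_top.1 ht

theorem exists_eq_smul_of_isIntertwiningMap (hσ : σ.IsIrreducible) {T : U →ₗ[ℂ] U}
    (hT : σ.IsIntertwiningMap σ T) : ∃ c : ℂ, ∀ v, T v = c • v := by
  have := (isIrreducible_iff_forall_submodule.1 hσ).1
  obtain ⟨c, hc⟩ := Module.End.exists_eigenvalue T
  obtain ⟨v, hv⟩ := hc.exists_hasEigenvector
  refine ⟨c, fun w => ?_⟩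
  have h := isIntertwiningMap_eq_zero_of_apply (τ := σ) (T := T - c • LinearMap.id) hσ
    ⟨fun g w => by simp [hT.1]⟩ hv.2 (by simp [hv.apply_eq_smul])
  exact sub_eq_zero.1 (LinearMap.congr_fun h w)

/-- By Schur's lemma a nonzero intertwiner from an irreducible unitary representation is a multiple
of an isometry. -/
theorem exists_adjoint_comp_eq_smul (hσ : σ.IsIrreducible) (hσu : ∀ g v, ‖σ g v‖ = ‖v‖)
    (hτ : ∀ g v, ‖τ g v‖ = ‖v‖) {T : U →ₗ[ℂ] W} (hT : σ.IsIntertwiningMap τ T) (h0 : T ≠ 0) :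
    ∃ c : ℂ, c ≠ 0 ∧ ∀ v, T.adjoint (T v) = c • v := by
  obtain ⟨c, hc⟩ := exists_eq_smul_of_isIntertwiningMap hσ
    (isIntertwiningMap_comp (isIntertwiningMap_adjoint hσu hτ hT) hT)
  refine ⟨c, ?_, hc⟩
  rintro rfl
  apply h0
  ext v
  have h1 : inner ℂ (T v) (T v) = 0 := by
    rw [← LinearMap.adjoint_inner_left]
    have := hc v
    rw [LinearMap.comp_apply] at this
    rw [this, zero_smul, inner_zero_left]
  exact inner_self_eq_zero.1 h1

theorem exists_linearEquiv_of_isIntertwiningMap (hσ : σ.IsIrreducible) (hτ : τ.IsIrreducible)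
    {T : U →ₗ[ℂ] W} (hT : σ.IsIntertwiningMap τ T) (h0 : T ≠ 0) :
    ∃ e : U ≃ₗ[ℂ] W, ∀ g v, e (σ g v) = τ g (e v) := by
  have hinj : Function.Injective T := (injective_iff_map_eq_zero T).2 fun v hv => by
    by_contra h
    exact h0 (isIntertwiningMap_eq_zero_of_apply hσ hT h hv)
  have hsurj : LinearMap.range T = ⊤ := by
    refine ((isIrreducible_iff_forall_submodule.1 hτ).2 (LinearMap.range T) ?_).resolve_left
      fun h => h0 (LinearMap.range_eq_bot.1 h)
    rintro g _ ⟨v, rfl⟩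
    exact ⟨σ g v, hT.1 g v⟩
  exact ⟨LinearEquiv.ofBijective T ⟨hinj, LinearMap.range_eq_top.1 hsurj⟩, hT.1⟩

/-- An invariant subspace that is minimal among the nonzero ones. -/
def IsMinimalInvariant (τ : Representation ℂ G W) (K : Submodule ℂ W) : Prop :=
  Minimal (fun K : Submodule ℂ W => K ≠ ⊥ ∧ ∀ g, ∀ v ∈ K, τ g v ∈ K) K

/-- Splitting off minimal invariant subspaces, the projection on an invariant subspace is a sum of
finitely many projections on minimal ones. -/
theorem exists_starProjection_mem_span (hτ : ∀ g v, ‖τ g v‖ = ‖v‖) (K : Submodule ℂ W)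
    (hK : ∀ g, ∀ v ∈ K, τ g v ∈ K) :
    ∃ s : Set (Submodule ℂ W), s.Finite ∧ (∀ L ∈ s, IsMinimalInvariant τ L) ∧
      K.starProjection ∈ Submodule.span ℂ ((fun L : Submodule ℂ W => L.starProjection) '' s) := by
  induction K using WellFoundedLT.induction with
  | ind K ih =>
  by_cases hbot : K = ⊥
  · subst hbot
    exact ⟨∅, Set.finite_empty, by simp, by simp [Submodule.starProjection_bot]⟩
  obtain ⟨L, ⟨hLK, hL0, hL⟩, hmin⟩ := exists_minimal_of_wellFoundedLT
    (fun L : Submodule ℂ W => L ≤ K ∧ L ≠ ⊥ ∧ ∀ g, ∀ v ∈ L, τ g v ∈ L) ⟨K, le_rfl, hbot, hK⟩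
  have hLmin : IsMinimalInvariant τ L :=
    ⟨⟨hL0, hL⟩, fun N hN hNL => hmin ⟨hNL.trans hLK, hN⟩ hNL⟩
  have hlt : K ⊓ Lᗮ < K := by
    refine lt_of_le_of_ne inf_le_left fun h => hL0 ?_
    have h1 : L ≤ Lᗮ := hLK.trans (inf_eq_left.1 h)
    rw [← Submodule.inf_orthogonal_eq_bot L]
    exact (inf_eq_left.2 h1).symm
  obtain ⟨s, hs, hsmin, hmem⟩ := ih _ hlt (fun g v hv => ⟨hK g v hv.1, by
    intro w hw
    rw [← inner_conj_symm, inner_rep_left hτ, inner_conj_symm]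
    exact hv.2 _ (hL _ _ hw)⟩)
  refine ⟨insert L s, hs.insert L, ?_, ?_⟩
  · rintro N (rfl | hN)
    exacts [hLmin, hsmin N hN]
  · have hsum : K.starProjection = L.starProjection + (K ⊓ Lᗮ).starProjection := by
      ext v
      refine Submodule.eq_starProjection_of_mem_of_inner_eq_zero (K := K) ?_ fun w hw => ?_
      · exact add_mem (hLK (Submodule.starProjection_apply_mem _ _))
          (Submodule.starProjection_apply_mem (K ⊓ Lᗮ) _).1
      · -- split `w` along `L`
        have hw1 : L.starProjection w ∈ L := Submodule.starProjection_apply_mem _ _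
        have hw2 : w - L.starProjection w ∈ Lᗮ := Submodule.sub_starProjection_mem_orthogonal _
        have hw3 : w - L.starProjection w ∈ K ⊓ Lᗮ := ⟨sub_mem hw (hLK hw1), hw2⟩
        have e1 := Submodule.starProjection_inner_eq_zero v _ hw1
        have e2 := Submodule.starProjection_inner_eq_zero v _ hw3
        have e3 : inner ℂ (L.starProjection v) (w - L.starProjection w) = 0 :=
          hw2 _ (Submodule.starProjection_apply_mem _ _)
        have e4 : inner ℂ ((K ⊓ Lᗮ).starProjection v) (L.starProjection w) = 0 := by
          rw [← inner_conj_symm, (Submodule.starProjection_apply_mem (K ⊓ Lᗮ) v).2 _ hw1, map_zero]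
        have hws : w = L.starProjection w + (w - L.starProjection w) := by abel
        rw [hws, inner_add_right, add_apply]
        simp only [inner_sub_left, inner_add_left] at e1 e2 ⊢
        linear_combination e1 + e2 - e3 - e4
    rw [hsum]
    refine add_mem (Submodule.subset_span ⟨L, Set.mem_insert _ _, rfl⟩) ?_
    exact Submodule.span_mono (Set.image_mono (Set.subset_insert _ _)) hmem

/-- A minimal invariant subspace carries an irreducible representation. -/
theorem IsMinimalInvariant.exists_irrep [TopologicalSpace G] (hτ : ∀ g v, ‖τ g v‖ = ‖v‖)
    (hcont : ∀ v, Continuous fun g => τ g v) {K : Submodule ℂ W} (hK : IsMinimalInvariant τ K) :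
    ∃ (ρ : Irrep G) (T : EuclideanSpace ℂ (Fin ρ.dim) →ₗ[ℂ] W), ρ.rep.IsIntertwiningMap τ T ∧
      T ≠ 0 ∧ (T ∘ₗ T.adjoint).toContinuousLinearMap = K.starProjection := by
  obtain ⟨⟨hK0, hinv⟩, hmin⟩ := hK
  let e : EuclideanSpace ℂ (Fin (Module.finrank ℂ K)) ≃ₗᵢ[ℂ] K :=
    (stdOrthonormalBasis ℂ K).repr.symm
  let T : EuclideanSpace ℂ (Fin (Module.finrank ℂ K)) →ₗᵢ[ℂ] W :=
    K.subtypeₗᵢ.comp e.toLinearIsometry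
  have hTK : ∀ v, T v ∈ K := fun v => (e v).2
  have hTsurj : ∀ w ∈ K, ∃ v, T v = w := fun w hw => ⟨e.symm ⟨w, hw⟩, by simp [T]⟩
  have hTT : ∀ v, T.toLinearMap.adjoint (T v) = v := fun v => ext_inner_left ℂ fun w => by
    rw [LinearMap.adjoint_inner_right]
    exact T.inner_map_map w v
  have hproj : ∀ w, T (T.toLinearMap.adjoint w) = K.starProjection w := by
    intro w
    refine (Submodule.eq_starProjection_of_mem_of_inner_eq_zero (hTK _) fun u hu => ?_).symm
    obtain ⟨u, rfl⟩ := hTsurj u hu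
    have h1 := LinearMap.adjoint_inner_left T.toLinearMap u w
    rw [inner_sub_left, T.inner_map_map]
    exact sub_eq_zero.2 h1.symm
  have hTT' : ∀ w ∈ K, T (T.toLinearMap.adjoint w) = w := fun w hw => by
    rw [hproj, Submodule.starProjection_eq_self_iff.2 hw]
  let σ : Representation ℂ G (EuclideanSpace ℂ (Fin (Module.finrank ℂ K))) :=
    { toFun := fun g => T.toLinearMap.adjoint ∘ₗ τ g ∘ₗ T.toLinearMap
      map_one' := by
        ext1 v
        simp [hTT]
      map_mul' := fun g h => by
        ext1 v
        have h1 := hTT' _ (hinv h _ (hTK v))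
        change T.toLinearMap.adjoint (τ (g * h) (T v)) =
          T.toLinearMap.adjoint (τ g (T (T.toLinearMap.adjoint (τ h (T v)))))
        rw [h1, map_mul, Module.End.mul_apply] }
  have hT : ∀ g v, T (σ g v) = τ g (T v) := fun g v => hTT' _ (hinv g _ (hTK v))
  have hσirr : σ.IsIrreducible := by
    rw [isIrreducible_iff_forall_submodule]
    constructor
    · obtain ⟨w, hw, hw0⟩ := Submodule.exists_mem_ne_zero_of_ne_bot hK0
      obtain ⟨v, rfl⟩ := hTsurj w hw
      exact ⟨v, 0, fun h => hw0 (by rw [h, map_zero])⟩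
    · intro L hL
      by_cases hb : L = ⊥
      · exact Or.inl hb
      right
      have hmap : L.map T.toLinearMap ≠ ⊥ := fun h =>
        hb (Submodule.map_injective_of_injective T.injective (h.trans (Submodule.map_bot _).symm))
      have h1 := hmin (y := L.map T.toLinearMap) ⟨hmap, by
        rintro g _ ⟨v, hv, rfl⟩
        exact ⟨σ g v, hL g v hv, hT g v⟩⟩ (by
          rintro _ ⟨v, -, rfl⟩
          exact hTK v)
      rw [eq_top_iff]
      intro v _
      obtain ⟨u, hu, huv⟩ := h1 (hTK v)
      rwa [← T.injective huv]
  refine ⟨⟨_, σ, fun g v => ?_, fun v => ?_, hσirr⟩, T.toLinearMap, ⟨hT⟩, ?_, ?_⟩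
  · rw [← T.norm_map, hT, hτ, T.norm_map]
  · exact T.toLinearMap.adjoint.continuous_of_finiteDimensional.comp (hcont (T v))
  · intro h
    obtain ⟨w, hw, hw0⟩ := Submodule.exists_mem_ne_zero_of_ne_bot hK0
    obtain ⟨v, rfl⟩ := hTsurj w hw
    exact hw0 (LinearMap.congr_fun h v)
  · ext w
    exact hproj w

/-- A unitary representation is a finite sum of irreducible ones; the decomposition is expressed by
the projections `T T*` given by intertwiners `T` from irreducible representations. -/
theorem exists_irreps_one_mem_span [TopologicalSpace G] (hτ : ∀ g v, ‖τ g v‖ = ‖v‖)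
    (hcont : ∀ v, Continuous fun g => τ g v) :
    ∃ s : Set ((ρ : Irrep G) × (EuclideanSpace ℂ (Fin ρ.dim) →ₗ[ℂ] W)), s.Finite ∧
      (∀ p ∈ s, p.1.rep.IsIntertwiningMap τ p.2 ∧ p.2 ≠ 0) ∧
      (1 : W →L[ℂ] W) ∈ Submodule.span ℂ
        ((fun p => (p.2 ∘ₗ p.2.adjoint).toContinuousLinearMap) '' s) := by
  obtain ⟨s, hs, hmin, hmem⟩ := exists_starProjection_mem_span hτ ⊤ fun g v _ => trivial
  have h : ∀ K : s, ∃ p : (ρ : Irrep G) × (EuclideanSpace ℂ (Fin ρ.dim) →ₗ[ℂ] W),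
      (p.1.rep.IsIntertwiningMap τ p.2 ∧ p.2 ≠ 0) ∧
      (p.2 ∘ₗ p.2.adjoint).toContinuousLinearMap = K.1.starProjection := fun K => by
    obtain ⟨ρ, T, h1, h2, h3⟩ := (hmin K.1 K.2).exists_irrep hτ hcont
    exact ⟨⟨ρ, T⟩, ⟨h1, h2⟩, h3⟩
  choose p hp hp' using h
  have := hs.to_subtype
  refine ⟨Set.range p, Set.finite_range p, ?_, ?_⟩
  · rintro _ ⟨K, rfl⟩
    exact hp K
  · rw [Submodule.starProjection_top] at hmem
    refine Submodule.span_mono ?_ hmem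
    rintro _ ⟨K, hK, rfl⟩
    exact ⟨p ⟨K, hK⟩, ⟨_, rfl⟩, hp' ⟨K, hK⟩⟩

end Unitary

/-! ### Irreducible representations of the commutant of a unitary representation -/

section CommutantReps

open Representation

/-- The restriction of a `*`-representation to an invariant subspace. -/
def restrictRep {A : Type*} [NonUnitalRing A] [StarRing A] [Module ℂ A]
    {H : Type*} [NormedAddCommGroup H] [InnerProductSpace ℂ H] [CompleteSpace H]
    (r : A →⋆ₙₐ[ℂ] (H →L[ℂ] H)) (K : Submodule ℂ H) [CompleteSpace K]
    (hK : ∀ a, ∀ v ∈ K, r a v ∈ K) : A →⋆ₙₐ[ℂ] (K →L[ℂ] K) where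
  toFun a := ((r a).comp K.subtypeL).codRestrict K fun v => hK a v v.2
  map_smul' c a := by
    ext v
    change r (c • a) v = c • r a v
    rw [map_smul, smul_apply]
  map_zero' := by
    ext v
    change r 0 v = 0
    rw [map_zero, zero_apply]
  map_add' a b := by
    ext v
    change r (a + b) v = r a v + r b v
    rw [map_add, add_apply]
  map_mul' a b := by
    ext v
    change r (a * b) v = r a (r b v)
    rw [map_mul, mul_apply_eq_comp]
  map_star' a := by
    rw [ContinuousLinearMap.star_eq_adjoint, ContinuousLinearMap.eq_adjoint_iff]
    intro v w
    change inner ℂ (r (star a) v) (w : H) = inner ℂ (v : H) (r a w)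
    rw [map_star, ContinuousLinearMap.star_eq_adjoint, ContinuousLinearMap.adjoint_inner_left]

/-- The kernel of an irreducible representation is a prime ideal. -/
theorem IsIrreducibleRep.eq_zero_or_eq_zero_of_forall {A : Type*} [NonUnitalRing A] [StarRing A]
    [Module ℂ A] {H : Type*} [NormedAddCommGroup H] [InnerProductSpace ℂ H] [CompleteSpace H]
    {r : A →⋆ₙₐ[ℂ] (H →L[ℂ] H)} (hr : IsIrreducibleRep r) {a b : A}
    (h : ∀ g, r (a * g * b) = 0) : r a = 0 ∨ r b = 0 := by
  let K : Submodule ℂ H := ⨅ g : A, LinearMap.ker ((r (a * g) : H →L[ℂ] H) : H →ₗ[ℂ] H)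
  have hK : IsClosed (K : Set H) := by
    simp only [K, Submodule.coe_iInf]
    exact isClosed_iInter fun g => ContinuousLinearMap.isClosed_ker (r (a * g))
  have memK : ∀ v, v ∈ K ↔ ∀ g, r (a * g) v = 0 := by
    intro v
    simp [K]
  have hinv : ∀ c, ∀ v ∈ K, r c v ∈ K := by
    intro c v hv
    rw [memK] at hv ⊢
    intro g
    have := hv (g * c)
    rwa [← mul_assoc, map_mul] at this
  rcases hr.eq_bot_or_eq_top K hK hinv with hbot | htop
  · right
    ext v
    have hv : r b v ∈ K := (memK _).2 fun g => by
      have := h g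
      rw [map_mul] at this
      exact congrArg (fun T : H →L[ℂ] H => T v) this
    rw [hbot] at hv
    exact hv
  · left
    have hz : r a * star (r a) = 0 := by
      ext v
      have : v ∈ K := by
        rw [htop]
        trivial
      rw [memK] at this
      rw [← map_star, ← map_mul]
      exact this (star a)
    exact (CStarRing.mul_star_self_eq_zero_iff _).1 hz

variable {G : Type*} [Group G] [TopologicalSpace G]
  {W : Type*} [NormedAddCommGroup W] [InnerProductSpace ℂ W] [FiniteDimensional ℂ W]
  [CompleteSpace W] {τ : Representation ℂ G W}

/-- The intertwiners from `ρ` to `τ` are killed by the operator `S`, that is, `S` vanishes on the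
`ρ`-isotypical component of `τ`. -/
def KillsIntertwiners (τ : Representation ℂ G W) (ρ : Irrep G) (S : W →L[ℂ] W) : Prop :=
  ∀ T : EuclideanSpace ℂ (Fin ρ.dim) →ₗ[ℂ] W, ρ.rep.IsIntertwiningMap τ T → ∀ v, S (T v) = 0

theorem Irrep.exists_ne_zero (ρ : Irrep G) : ∃ v : EuclideanSpace ℂ (Fin ρ.dim), v ≠ 0 := by
  have := (isIrreducible_iff_forall_submodule.1 ρ.irreducible).1
  exact exists_ne 0

variable {A : Type u} [NonUnitalRing A] [StarRing A] [Module ℂ A]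
  {ev : A →⋆ₙₐ[ℂ] (W →L[ℂ] W)}

theorem exists_comp_adjoint_lift (hτ : ∀ g v, ‖τ g v‖ = ‖v‖)
    (hev' : ∀ T : W →ₗ[ℂ] W, τ.IsIntertwiningMap τ T → ∃ a, ∀ w, ev a w = T w)
    (ρ : Irrep G) {S T : EuclideanSpace ℂ (Fin ρ.dim) →ₗ[ℂ] W}
    (hS : ρ.rep.IsIntertwiningMap τ S) (hT : ρ.rep.IsIntertwiningMap τ T) :
    ∃ a, ∀ w, ev a w = S (T.adjoint w) :=
  hev' _ (isIntertwiningMap_comp hS (isIntertwiningMap_adjoint ρ.norm_rep hτ hT))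

/-- Let the image of `A` be the commutant of `τ`. An irreducible representation `ρ` that occurs in
`τ` gives an irreducible representation of `A` on `Hom(ρ, τ)`, which is embedded in the space of
`τ` by evaluation at a nonzero vector. -/
theorem exists_isPrimitiveIdeal_of_irrep (hτ : ∀ g v, ‖τ g v‖ = ‖v‖)
    (hev : ∀ a, τ.IsIntertwiningMap τ (ev a : W →ₗ[ℂ] W))
    (hev' : ∀ T : W →ₗ[ℂ] W, τ.IsIntertwiningMap τ T → ∃ a, ∀ w, ev a w = T w)
    {ρ : Irrep G} {T₀ : EuclideanSpace ℂ (Fin ρ.dim) →ₗ[ℂ] W}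
    (hT₀ : ρ.rep.IsIntertwiningMap τ T₀) (h0 : T₀ ≠ 0) :
    ∃ P : TwoSidedIdeal A, IsPrimitiveIdeal P ∧ ∀ a, a ∈ P ↔ KillsIntertwiners τ ρ (ev a) := by
  obtain ⟨v₀, hv₀⟩ := ρ.exists_ne_zero
  let K : Submodule ℂ W :=
    { carrier := {w | ∃ T : EuclideanSpace ℂ (Fin ρ.dim) →ₗ[ℂ] W,
        ρ.rep.IsIntertwiningMap τ T ∧ T v₀ = w}
      zero_mem' := ⟨0, ⟨fun g v => by simp⟩, rfl⟩
      add_mem' := by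
        rintro _ _ ⟨S, hS, rfl⟩ ⟨T, hT, rfl⟩
        exact ⟨S + T, ⟨fun g v => by simp [hS.1, hT.1]⟩, rfl⟩
      smul_mem' := by
        rintro c _ ⟨S, hS, rfl⟩
        exact ⟨c • S, ⟨fun g v => by simp [hS.1]⟩, rfl⟩ }
  have hKinv : ∀ a, ∀ w ∈ K, ev a w ∈ K := by
    rintro a _ ⟨T, hT, rfl⟩
    exact ⟨_, isIntertwiningMap_comp (hev a) hT, rfl⟩
  let r := restrictRep ev K hKinv
  have hr : ∀ a (w : K), (r a w : W) = ev a w := fun _ _ => rfl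
  refine ⟨TwoSidedIdeal.ker r, IsIrreducibleRep.isPrimitiveIdeal_ker ⟨?_, ?_⟩, fun a => ?_⟩
  · obtain ⟨a, ha⟩ := exists_comp_adjoint_lift hτ hev' ρ hT₀ hT₀
    obtain ⟨c, hc, hcT⟩ := exists_adjoint_comp_eq_smul ρ.irreducible ρ.norm_rep hτ hT₀ h0
    refine ⟨a, fun h => h0 (isIntertwiningMap_eq_zero_of_apply ρ.irreducible hT₀ hv₀ ?_)⟩
    have h1 := hr a ⟨T₀ v₀, T₀, hT₀, rfl⟩
    rw [h, ha, hcT, map_smul] at h1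
    exact (smul_eq_zero.1 h1.symm).resolve_left hc
  · intro L _ hL
    by_cases hb : L = ⊥
    · exact Or.inl hb
    right
    obtain ⟨⟨_, T, hT, rfl⟩, hTL, hne⟩ := Submodule.exists_mem_ne_zero_of_ne_bot hb
    have hT0 : T ≠ 0 := by
      rintro rfl
      exact hne rfl
    obtain ⟨c, hc, hcT⟩ := exists_adjoint_comp_eq_smul ρ.irreducible ρ.norm_rep hτ hT hT0
    rw [eq_top_iff]
    rintro ⟨_, S, hS, rfl⟩ -
    obtain ⟨a, ha⟩ := exists_comp_adjoint_lift hτ hev' ρ hS hT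
    have h1 := L.smul_mem c⁻¹ (hL a _ hTL)
    convert h1 using 1
    apply Subtype.ext
    change S v₀ = c⁻¹ • ev a (T v₀)
    rw [ha, hcT, map_smul, inv_smul_smul₀ hc]
  · rw [TwoSidedIdeal.mem_ker]
    constructor
    · intro h T hT
      have h1 := hr a ⟨T v₀, T, hT, rfl⟩
      rw [h] at h1
      exact fun v => LinearMap.congr_fun (isIntertwiningMap_eq_zero_of_apply ρ.irreducible
        (isIntertwiningMap_comp (hev a) hT) hv₀ h1.symm) v
    · intro h
      ext ⟨_, T, hT, rfl⟩
      exact h T hT v₀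

/-- Irreducible representations occurring in `τ` are separated by the commutant. -/
theorem exists_linearEquiv_of_killsIntertwiners (hτ : ∀ g v, ‖τ g v‖ = ‖v‖)
    (hev' : ∀ T : W →ₗ[ℂ] W, τ.IsIntertwiningMap τ T → ∃ a, ∀ w, ev a w = T w)
    {ρ σ : Irrep G} {S : EuclideanSpace ℂ (Fin σ.dim) →ₗ[ℂ] W}
    (hS : σ.rep.IsIntertwiningMap τ S) (h0 : S ≠ 0)
    (h : ∀ a, KillsIntertwiners τ ρ (ev a) → KillsIntertwiners τ σ (ev a)) :
    ∃ e : EuclideanSpace ℂ (Fin ρ.dim) ≃ₗ[ℂ] EuclideanSpace ℂ (Fin σ.dim),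
      ∀ g v, e (ρ.rep g v) = σ.rep g (e v) := by
  by_contra hne
  have hST : ∀ T : EuclideanSpace ℂ (Fin ρ.dim) →ₗ[ℂ] W, ρ.rep.IsIntertwiningMap τ T →
      ∀ v, S.adjoint (T v) = 0 := by
    intro T hT v
    by_contra hv
    refine hne (exists_linearEquiv_of_isIntertwiningMap ρ.irreducible σ.irreducible
      (isIntertwiningMap_comp (isIntertwiningMap_adjoint σ.norm_rep hτ hS) hT) ?_)
    exact fun h => hv (LinearMap.congr_fun h v)
  obtain ⟨a, ha⟩ := exists_comp_adjoint_lift hτ hev' σ hS hS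
  obtain ⟨c, hc, hcS⟩ := exists_adjoint_comp_eq_smul σ.irreducible σ.norm_rep hτ hS h0
  have h1 := h a (fun T hT v => by rw [ha, hST T hT, map_zero]) S hS
  apply h0
  ext v
  have h2 := h1 v
  rw [ha, hcS, map_smul] at h2
  rw [(smul_eq_zero.1 h2).resolve_left hc, LinearMap.zero_apply]

/-- An irreducible representation of `A` that factors through the commutant of `τ` comes from one of
the irreducible summands of `τ`. -/
theorem IsIrreducibleRep.exists_irrep (hτ : ∀ g v, ‖τ g v‖ = ‖v‖)
    (hev : ∀ a, τ.IsIntertwiningMap τ (ev a : W →ₗ[ℂ] W))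
    (hev' : ∀ T : W →ₗ[ℂ] W, τ.IsIntertwiningMap τ T → ∃ a, ∀ w, ev a w = T w)
    {s : Set ((ρ : Irrep G) × (EuclideanSpace ℂ (Fin ρ.dim) →ₗ[ℂ] W))}
    (hs : ∀ p ∈ s, p.1.rep.IsIntertwiningMap τ p.2 ∧ p.2 ≠ 0)
    (hs' : (1 : W →L[ℂ] W) ∈ Submodule.span ℂ
      ((fun p => (p.2 ∘ₗ p.2.adjoint).toContinuousLinearMap) '' s))
    {H : Type*} [NormedAddCommGroup H] [InnerProductSpace ℂ H] [CompleteSpace H]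
    {r : A →⋆ₙₐ[ℂ] (H →L[ℂ] H)} (hr : IsIrreducibleRep r) (hrev : ∀ a, ev a = 0 → r a = 0) :
    ∃ p ∈ s, ∀ a, r a = 0 ↔ KillsIntertwiners τ p.1 (ev a) := by
  have hrev' : ∀ {a b}, ev a = ev b → r a = r b := by
    intro a b h
    have h1 : ev (a - b) = 0 := (map_sub ev a b).trans (sub_eq_zero.2 h)
    exact sub_eq_zero.1 ((map_sub r a b).symm.trans (hrev _ h1))
  -- the lifts of the projections on the summands have sum `1` modulo the kernel of `r`
  obtain ⟨p, hp, b, hb, hrb⟩ : ∃ p ∈ s, ∃ b, (∀ w, ev b w = p.2 (p.2.adjoint w)) ∧ r b ≠ 0 := by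
    by_contra! hcon
    have h1 : ∀ x ∈ Submodule.span ℂ ((fun p => (p.2 ∘ₗ p.2.adjoint).toContinuousLinearMap) '' s),
        ∃ b, ev b = x ∧ r b = 0 := by
      intro x hx
      induction hx using Submodule.span_induction with
      | mem x hx =>
        obtain ⟨p, hp, rfl⟩ := hx
        obtain ⟨b, hb⟩ := exists_comp_adjoint_lift hτ hev' p.1 (hs p hp).1 (hs p hp).1
        exact ⟨b, ContinuousLinearMap.ext hb, hcon p hp b hb⟩
      | zero => exact ⟨0, map_zero ev, map_zero r⟩
      | add x y _ _ hx hy =>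
        obtain ⟨a, ha, ha'⟩ := hx
        obtain ⟨b, hb, hb'⟩ := hy
        exact ⟨a + b, by rw [map_add, ha, hb], by rw [map_add, ha', hb', add_zero]⟩
      | smul c x _ hx =>
        obtain ⟨a, ha, ha'⟩ := hx
        exact ⟨c • a, by rw [map_smul, ha], by rw [map_smul, ha', smul_zero]⟩
    obtain ⟨b, hb, hb'⟩ := h1 1 hs'
    obtain ⟨a, ha⟩ := hr.ne_zero
    apply ha
    rw [hrev' (b := a * b) (by rw [map_mul, hb, mul_one]), map_mul, hb', mul_zero]
  obtain ⟨hT, hT0⟩ := hs p hp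
  -- if `Q = ev a ∘ S ≠ 0`, then `x = a g` with `ev g = S T*` satisfies `ev (x* x) = c T T*`
  refine ⟨p, hp, fun a => ⟨fun ha S hS v => ?_, fun ha => ?_⟩⟩
  · by_contra hv
    let Q : EuclideanSpace ℂ (Fin p.1.dim) →ₗ[ℂ] W := (ev a : W →ₗ[ℂ] W) ∘ₗ S
    have hQ : p.1.rep.IsIntertwiningMap τ Q := isIntertwiningMap_comp (hev a) hS
    obtain ⟨c, hc, hcQ⟩ := exists_adjoint_comp_eq_smul p.1.irreducible p.1.norm_rep hτ hQ
      fun h => hv (LinearMap.congr_fun h v)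
    obtain ⟨g, hg⟩ := exists_comp_adjoint_lift hτ hev' p.1 hS hT
    have hag : ∀ w, ev (a * g) w = Q (p.2.adjoint w) := fun w => by
      rw [map_mul, mul_apply_eq_comp, hg]
      rfl
    have h1 : ev (star (a * g) * (a * g)) = ev (c • b) := by
      refine ContinuousLinearMap.ext fun w => ext_inner_left ℂ fun u => ?_
      rw [map_mul, map_star, mul_apply_eq_comp, ContinuousLinearMap.star_eq_adjoint,
        ContinuousLinearMap.adjoint_inner_right, hag, hag, map_smul, smul_apply, hb,
        ← LinearMap.adjoint_inner_right, hcQ, ← map_smul, LinearMap.adjoint_inner_left,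
        map_smul, map_smul]
    have h2 := hrev' h1
    rw [map_mul, map_mul, ha, zero_mul, mul_zero, map_smul] at h2
    exact hrb ((smul_eq_zero.1 h2.symm).resolve_left hc)
  · refine (hr.eq_zero_or_eq_zero_of_forall (b := b) fun g => hrev _ ?_).resolve_right hrb
    ext w
    rw [map_mul, map_mul, mul_apply_eq_comp, mul_apply_eq_comp, hb]
    exact ha _ (isIntertwiningMap_comp (hev g) hT) _

end CommutantReps

/-! ### Intertwiners into the fibres -/

section FiberIntertwiners

variable {V : Type*} [NormedAddCommGroup V] [NormedSpace ℝ V]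
  {M : Type*} [TopologicalSpace M] [ChartedSpace V M]
  [RiemannianBundle (fun x : M => TangentSpace 𝓘(ℝ, V) x)]
  {F : Type*} {E : M → Type*} [∀ x, NormedAddCommGroup (E x)] [∀ x, InnerProductSpace ℂ (E x)]
  {Γ : Type*} [Group Γ] [TopologicalSpace Γ] [MulAction Γ M] [IsIsometricAction V M Γ]
  {𝓔 : EquivariantStructure Γ F E}

theorem isIntertwiner_iff {ξ : Cosphere V M} {ρ : Irrep (MulAction.stabilizer Γ ξ)}
    {T : EuclideanSpace ℂ (Fin ρ.dim) →ₗ[ℂ] E ξ.base} :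
    IsIntertwiner 𝓔 ξ ρ T ↔ ρ.rep.IsIntertwiningMap (fiberRep 𝓔 ξ) T := by
  rw [Representation.isIntertwiningMap_iff]
  refine forall₂_congr fun g v => ?_
  have h := mk_fiberRep (𝓔 := 𝓔) ξ g (T v)
  constructor
  · intro h'
    exact (eq_of_heq (TotalSpace.mk.inj (h.trans h')).2).symm
  · intro h'
    rw [h']
    exact h.symm

theorem forall_mem_isotypic_iff {ξ : Cosphere V M} {ρ : Irrep (MulAction.stabilizer Γ ξ)}
    {S : E ξ.base →L[ℂ] E ξ.base} :
    (∀ v ∈ isotypic 𝓔 ξ ρ, S v = 0) ↔ KillsIntertwiners (fiberRep 𝓔 ξ) ρ S := by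
  have h : (∀ v ∈ isotypic 𝓔 ξ ρ, S v = 0) ↔
      isotypic 𝓔 ξ ρ ≤ LinearMap.ker (S : E ξ.base →ₗ[ℂ] E ξ.base) := Iff.rfl
  rw [h, isotypic]
  simp only [iSup_le_iff, isIntertwiner_iff]
  refine forall₂_congr fun T _ => ?_
  rw [LinearMap.range_le_iff_comap, Submodule.eq_top_iff']
  rfl

/-- The action of `γ` intertwines the fibre representations at `ξ` and at `γ ξ`. -/
theorem fiberRep_smul (γ : Γ) (ξ : Cosphere V M) (g : MulAction.stabilizer Γ ξ)
    (h : MulAction.stabilizer Γ (γ • ξ)) (hgh : (h : Γ) = γ * g * γ⁻¹) (u : E ξ.base) :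
    fiberRep 𝓔 (γ • ξ) h (𝓔.actAt γ ξ u) = 𝓔.actAt γ ξ (fiberRep 𝓔 ξ g u) := by
  have h1 := mk_fiberRep (𝓔 := 𝓔) (γ • ξ) h (𝓔.actAt γ ξ u)
  have h2 := 𝓔.mul_act h γ ξ.base u
  have h3 := 𝓔.mul_act γ g ξ.base u
  have h4 := congrArg (fun p : TotalSpace F E =>
    (⟨γ • p.1, 𝓔.act γ p.1 p.2⟩ : TotalSpace F E)) (mk_fiberRep (𝓔 := 𝓔) ξ g u)
  have h5 : (h : Γ) * γ = γ * g := by rw [hgh]; group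
  rw [h5] at h2
  exact eq_of_heq (TotalSpace.mk.inj (h1.trans (h2.symm.trans (h3.trans h4.symm)))).2

/-- An irreducible representation transported along an isomorphism of groups. -/
def Irrep.comap {G G' : Type*} [Group G] [TopologicalSpace G] [Group G'] [TopologicalSpace G']
    (ρ : Irrep G) (φ : G' ≃* G) (hφ : Continuous φ) : Irrep G' where
  dim := ρ.dim
  rep := ρ.rep.comp φ.toMonoidHom
  norm_rep g v := ρ.norm_rep _ v
  continuous_rep v := (ρ.continuous_rep v).comp hφ
  irreducible := by
    have h := isIrreducible_iff_forall_submodule.1 ρ.irreducible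
    refine isIrreducible_iff_forall_submodule.2 ⟨h.1, fun K hK => h.2 K fun g v hv => ?_⟩
    have := hK (φ.symm g) v hv
    change ρ.rep (φ (φ.symm g)) v ∈ K at this
    rwa [φ.apply_symm_apply] at this

theorem coe_stabilizerEquivStabilizer_symm (γ : Γ) (ξ : Cosphere V M)
    (h : MulAction.stabilizer Γ (γ • ξ)) :
    (((MulAction.stabilizerEquivStabilizer (rfl : γ • ξ = γ • ξ)).symm h :
      MulAction.stabilizer Γ ξ) : Γ) = γ⁻¹ * h * γ := by
  rw [MulAction.stabilizerEquivStabilizer_symm_apply]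
  simp

/-- The pair `γ (ξ, ρ) = (γ ξ, ρ (γ⁻¹ · γ))`. -/
def SymbolPair.smul [IsTopologicalGroup Γ] (γ : Γ) (p : SymbolPair V 𝓔) : SymbolPair V 𝓔 where
  pt := γ • p.pt
  rho := p.rho.comap (MulAction.stabilizerEquivStabilizer (rfl : γ • p.pt = γ • p.pt)).symm (by
    refine Continuous.subtype_mk (f := fun g : MulAction.stabilizer Γ (γ • p.pt) =>
      γ⁻¹ * g * γ) ?_ ?_ |>.congr ?_
    · fun_prop
    · intro g
      have h : (g : Γ) • γ • p.pt = γ • p.pt := g.2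
      rw [MulAction.mem_stabilizer_iff, mul_smul, mul_smul, h, inv_smul_smul]
    · intro g
      exact Subtype.ext (coe_stabilizerEquivStabilizer_symm γ p.pt g).symm)
  occurs := by
    obtain ⟨T, hT, h0⟩ := p.occurs
    rw [isIntertwiner_iff] at hT
    refine ⟨(𝓔.actAt γ p.pt).toLinearMap ∘ₗ T, isIntertwiner_iff.2 ⟨fun h v => ?_⟩, fun h => h0 ?_⟩
    · let g := (MulAction.stabilizerEquivStabilizer (rfl : γ • p.pt = γ • p.pt)).symm h
      refine (congrArg (𝓔.actAt γ p.pt) (hT.1 g v)).trans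
        (fiberRep_smul γ p.pt g h ?_ (T v)).symm
      rw [coe_stabilizerEquivStabilizer_symm]
      group
    · ext v
      exact (𝓔.actAt γ p.pt).injective
        ((LinearMap.congr_fun h v).trans (map_zero (𝓔.actAt γ p.pt)).symm)

theorem SymbolPair.sameOrbit_smul [IsTopologicalGroup Γ] (γ : Γ) (p : SymbolPair V 𝓔) :
    p.SameOrbit (p.smul γ) := by
  refine ⟨γ, rfl, LinearEquiv.refl ℂ _, fun g h hgh v => ?_⟩
  have : g = (MulAction.stabilizerEquivStabilizer (rfl : γ • p.pt = γ • p.pt)).symm h :=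
    Subtype.ext ((by rw [hgh]; group : (g : Γ) = γ⁻¹ * h * γ).trans
      (coe_stabilizerEquivStabilizer_symm γ p.pt h).symm)
  rw [this]
  rfl

end FiberIntertwiners

/-! ### Evaluation of invariant symbols at a point -/

section Evaluation

variable {V : Type*} [NormedAddCommGroup V] [NormedSpace ℝ V]
  {M : Type*} [TopologicalSpace M] [ChartedSpace V M] [IsManifold 𝓘(ℝ, V) ∞ M]
  [RiemannianBundle (fun x : M => TangentSpace 𝓘(ℝ, V) x)]
  {F : Type*} [NormedAddCommGroup F] [InnerProductSpace ℂ F] [FiniteDimensional ℂ F]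
  {E : M → Type*} [TopologicalSpace (TotalSpace F E)] [∀ x, NormedAddCommGroup (E x)]
  [∀ x, InnerProductSpace ℂ (E x)] [∀ x, CompleteSpace (E x)] [FiberBundle F E]
  [VectorBundle ℂ F E] [IsSmoothHermitian V F E]
  {Γ : Type*} [Group Γ] [TopologicalSpace Γ]
  [MulAction Γ M] [IsIsometricAction V M Γ]
  {𝓔 : EquivariantStructure Γ F E}

variable (𝓔) in
/-- Evaluation of invariant symbols at a point of the cosphere bundle. -/
def evalAt (ξ : Cosphere V M) : invariantSymbols V 𝓔 →⋆ₙₐ[ℂ] (E ξ.base →L[ℂ] E ξ.base) where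
  toFun f := f.1 ξ
  map_smul' _ _ := rfl
  map_zero' := rfl
  map_add' _ _ := rfl
  map_mul' _ _ := rfl
  map_star' _ := rfl

theorem isIntertwiningMap_evalAt (ξ : Cosphere V M) (f : invariantSymbols V 𝓔) :
    (fiberRep 𝓔 ξ).IsIntertwiningMap (fiberRep 𝓔 ξ)
      (evalAt 𝓔 ξ f : E ξ.base →ₗ[ℂ] E ξ.base) := by
  refine ⟨fun g v => ?_⟩
  have h1 := mk_apply_actAt (𝓔 := 𝓔) f.1 ξ g v
  rw [f.2.2 g ξ v, ← mk_fiberRep] at h1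
  exact (eq_of_heq (TotalSpace.mk.inj h1).2).symm

theorem exists_evalAt_eq [IsTopologicalGroup Γ] [CompactSpace Γ] [ContinuousSMul Γ (Cosphere V M)]
    [LocallyCompactSpace (Cosphere V M)] [T2Space (Cosphere V M)] (h𝓔 : 𝓔.ContinuousAct)
    {ξ : Cosphere V M} [FiniteDimensional ℂ (E ξ.base)] (T : E ξ.base →ₗ[ℂ] E ξ.base)
    (hT : (fiberRep 𝓔 ξ).IsIntertwiningMap (fiberRep 𝓔 ξ) T) :
    ∃ f, ∀ v, evalAt 𝓔 ξ f v = T v := by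
  obtain ⟨f, hf⟩ := exists_invariantSymbols_eq h𝓔 (T := T.toContinuousLinearMap) hT.1
  exact ⟨f, fun v => by
    change f.1 ξ v = T v
    rw [hf]
    rfl⟩

theorem continuous_fiberRep (h𝓔 : 𝓔.ContinuousAct) (ξ : Cosphere V M) (v : E ξ.base) :
    Continuous fun g => fiberRep 𝓔 ξ g v := by
  rw [(FiberBundle.totalSpaceMk_isInducing F E ξ.base).continuous_iff]
  have h : Continuous fun g : MulAction.stabilizer Γ ξ =>
      ((g : Γ), (⟨ξ.base, v⟩ : TotalSpace F E)) := by fun_prop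
  exact (Continuous.comp h𝓔 h).congr fun g => (mk_fiberRep ξ g v).symm

/-- The ideal of `(ξ, ρ)` depends only on the orbit, because invariant symbols are determined on an
orbit of points by their value at one of them. -/
theorem SymbolPair.SameOrbit.killsIntertwiners {p q : SymbolPair V 𝓔} (h : p.SameOrbit q)
    (f : invariantSymbols V 𝓔) (hf : KillsIntertwiners (fiberRep 𝓔 p.pt) p.rho (f.1 p.pt)) :
    KillsIntertwiners (fiberRep 𝓔 q.pt) q.rho (f.1 q.pt) := by
  obtain ⟨ξ, ρ, _⟩ := p
  obtain ⟨_, σ, _⟩ := q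
  obtain ⟨γ, rfl, e, he⟩ := h
  intro S hS w
  obtain ⟨v, rfl⟩ := e.surjective w
  -- the intertwiner `S` transported to the fibre at `ξ`
  let T : EuclideanSpace ℂ (Fin ρ.dim) →ₗ[ℂ] E ξ.base :=
    (𝓔.actEquiv γ ξ).symm.toLinearEquiv.toLinearMap ∘ₗ S ∘ₗ e.toLinearMap
  have hT : ∀ v, 𝓔.actAt γ ξ (T v) = S (e v) := fun v =>
    (𝓔.actEquiv γ ξ).apply_symm_apply _
  have hTi : ρ.rep.IsIntertwiningMap (fiberRep 𝓔 ξ) T := by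
    refine ⟨fun g v => (𝓔.actAt γ ξ).injective ?_⟩
    have hmem : γ * g * γ⁻¹ ∈ MulAction.stabilizer Γ (γ • ξ) := by
      rw [MulAction.mem_stabilizer_iff, mul_smul, inv_smul_smul, mul_smul, g.2]
    rw [hT, he g ⟨_, hmem⟩ rfl, ← fiberRep_smul γ ξ g ⟨_, hmem⟩ rfl, hT, hS.1]
  change f.1 (γ • ξ) (S (e v)) = 0
  rw [← hT, f.2.2 γ ξ, hf T hTi, map_zero]

theorem killsIntertwiners_centralInclusion_iff (p : SymbolPair V 𝓔)
    (z : invariantFunctions V M Γ) :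
    KillsIntertwiners (fiberRep 𝓔 p.pt) p.rho ((centralInclusion V 𝓔 z).1 p.pt) ↔
      z.1 p.pt = 0 := by
  constructor
  · intro h
    obtain ⟨T, hT, h0⟩ := p.occurs
    by_contra hz
    apply h0
    ext v
    have h1 : z.1 p.pt • T v = 0 := h T (isIntertwiner_iff.1 hT) v
    exact (smul_eq_zero.1 h1).resolve_left hz
  · intro hz T _ v
    change z.1 p.pt • T v = 0
    rw [hz, zero_smul]

variable [IsTopologicalGroup Γ] [CompactSpace Γ] [ContinuousSMul Γ (Cosphere V M)]
  [LocallyCompactSpace (Cosphere V M)] [T2Space (Cosphere V M)]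

/-- Pairs are separated, up to the action of `Γ`, by the invariant symbols: invariant functions
separate the orbits of points, and over one point Schur's lemma applies. -/
theorem SymbolPair.sameOrbit_of_killsIntertwiners (h𝓔 : 𝓔.ContinuousAct) {p q : SymbolPair V 𝓔}
    (h : ∀ f : invariantSymbols V 𝓔, KillsIntertwiners (fiberRep 𝓔 p.pt) p.rho (f.1 p.pt) ↔
      KillsIntertwiners (fiberRep 𝓔 q.pt) q.rho (f.1 q.pt)) : p.SameOrbit q := by
  obtain ⟨γ, hγ⟩ : p.pt ∈ MulAction.orbit Γ q.pt :=
    mem_orbit_of_invariantFunctions fun z hz => by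
      rw [← killsIntertwiners_centralInclusion_iff (𝓔 := 𝓔)] at hz ⊢
      exact (h _).2 hz
  have hq := q.sameOrbit_smul γ
  have hq' := (SymbolPair.orbitSetoid V 𝓔).symm hq
  refine (SymbolPair.orbitSetoid V 𝓔).trans ?_ hq'
  have h' : ∀ f : invariantSymbols V 𝓔, KillsIntertwiners (fiberRep 𝓔 p.pt) p.rho (f.1 p.pt) →
      KillsIntertwiners (fiberRep 𝓔 (q.smul γ).pt) (q.smul γ).rho (f.1 (q.smul γ).pt) :=
    fun f hf => hq.killsIntertwiners f ((h f).1 hf)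
  have hpt : p.pt = (q.smul γ).pt := hγ.symm
  generalize q.smul γ = q' at h' hpt
  obtain ⟨ξ, ρ, _⟩ := p
  obtain ⟨_, σ, S, hS, h0⟩ := q'
  obtain rfl : ξ = _ := hpt
  have := finiteDimensional_fiber F (E := E) ξ.base
  obtain ⟨e, he⟩ := exists_linearEquiv_of_killsIntertwiners (ev := evalAt 𝓔 ξ) (ρ := ρ) (σ := σ)
    (norm_fiberRep ξ) (exists_evalAt_eq h𝓔) (isIntertwiner_iff.1 hS) h0 h'
  refine ⟨1, one_smul _ _, e, fun g k hgk v => ?_⟩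
  have : k = g := Subtype.ext (by simpa using hgk)
  rw [this]
  exact he g v

/-- Every pair `(ξ, ρ)` defines a primitive ideal. -/
theorem SymbolPair.exists_prim (h𝓔 : 𝓔.ContinuousAct) (p : SymbolPair V 𝓔) :
    ∃ P : Prim (invariantSymbols V 𝓔),
      ∀ f, f ∈ P.1 ↔ KillsIntertwiners (fiberRep 𝓔 p.pt) p.rho (f.1 p.pt) := by
  have := finiteDimensional_fiber F (E := E) p.pt.base
  obtain ⟨T, hT, h0⟩ := p.occurs
  obtain ⟨P, hP, hP'⟩ := exists_isPrimitiveIdeal_of_irrep (ev := evalAt 𝓔 p.pt) (norm_fiberRep p.pt)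
    (isIntertwiningMap_evalAt p.pt) (exists_evalAt_eq h𝓔) (isIntertwiner_iff.1 hT) h0
  exact ⟨⟨P, hP⟩, hP'⟩

/-- Over a point `ξ` there are finitely many irreducible summands of the fibre of `E`, which account
for all the primitive ideals that contain the symbols vanishing at `ξ`. -/
theorem exists_finite_forall_prim (h𝓔 : 𝓔.ContinuousAct) (ξ : Cosphere V M) :
    ∃ s : Set (SymbolPair V 𝓔), s.Finite ∧ (∀ p ∈ s, p.pt = ξ) ∧
      ∀ P : Prim (invariantSymbols V 𝓔), (∀ f : invariantSymbols V 𝓔, f.1 ξ = 0 → f ∈ P.1) →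
        ∃ p ∈ s, ∀ f, f ∈ P.1 ↔ KillsIntertwiners (fiberRep 𝓔 p.pt) p.rho (f.1 p.pt) := by
  have := finiteDimensional_fiber F (E := E) ξ.base
  obtain ⟨s, hs, hs', hspan⟩ := exists_irreps_one_mem_span (norm_fiberRep (𝓔 := 𝓔) ξ)
    (continuous_fiberRep h𝓔 ξ)
  have := hs.to_subtype
  let pair : s → SymbolPair V 𝓔 := fun p =>
    ⟨ξ, p.1.1, p.1.2, isIntertwiner_iff.2 (hs' p.1 p.2).1, (hs' p.1 p.2).2⟩
  refine ⟨Set.range pair, Set.finite_range pair, ?_, ?_⟩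
  · rintro _ ⟨p, rfl⟩
    rfl
  · rintro ⟨P, H, _, _, _, r, hr, rfl⟩ hP
    obtain ⟨p, hp, h⟩ := hr.exists_irrep (ev := evalAt 𝓔 ξ) (norm_fiberRep ξ)
      (isIntertwiningMap_evalAt ξ) (exists_evalAt_eq h𝓔) hs' hspan
      fun f hf => (TwoSidedIdeal.mem_ker r).1 (hP f hf)
    exact ⟨pair ⟨p, hp⟩, ⟨_, rfl⟩, fun f => (TwoSidedIdeal.mem_ker r).trans (h f)⟩

end Evaluation

/-! ### The primitive ideal space of the invariant functions -/

section CharacterIdeals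

/-- The kernel of a nonzero character is a primitive ideal. -/
theorem isPrimitiveIdeal_ker_character {Z : Type u} [NonUnitalRing Z] [StarRing Z] [Module ℂ Z]
    (c : Z →⋆ₙₐ[ℂ] ℂ) (hc : ∃ z, c z ≠ 0) : IsPrimitiveIdeal (TwoSidedIdeal.ker c) := by
  let r : Z →⋆ₙₐ[ℂ] (ℂ →L[ℂ] ℂ) :=
    ((StarAlgHom.ofId ℂ (ℂ →L[ℂ] ℂ) : ℂ →⋆ₐ[ℂ] (ℂ →L[ℂ] ℂ)) : ℂ →⋆ₙₐ[ℂ] (ℂ →L[ℂ] ℂ)).comp c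
  have hr : ∀ z, r z = 0 ↔ c z = 0 := fun z =>
    map_eq_zero_iff (StarAlgHom.ofId ℂ (ℂ →L[ℂ] ℂ)) (algebraMap ℂ (ℂ →L[ℂ] ℂ)).injective
  have hker : TwoSidedIdeal.ker c = TwoSidedIdeal.ker r := by
    ext z
    rw [TwoSidedIdeal.mem_ker, TwoSidedIdeal.mem_ker, hr]
  rw [hker]
  refine IsIrreducibleRep.isPrimitiveIdeal_ker ⟨?_, fun K _ _ => eq_bot_or_eq_top K⟩
  obtain ⟨z, hz⟩ := hc
  exact ⟨z, fun h => hz ((hr z).1 h)⟩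

theorem isOpen_setOf_notMem_prim {A : Type u} [NonUnitalRing A] [StarRing A] [Module ℂ A] (a : A) :
    IsOpen {P : Prim A | a ∉ P.1} := by
  refine ⟨TwoSidedIdeal.span {a}, ?_⟩
  ext P
  rw [Set.mem_ofPred_eq, Set.mem_ofPred_eq, TwoSidedIdeal.span_le, Set.singleton_subset_iff]
  rfl

variable {V : Type*} [NormedAddCommGroup V] [NormedSpace ℝ V]
  {M : Type*} [TopologicalSpace M] [ChartedSpace V M] [IsManifold 𝓘(ℝ, V) ∞ M]
  [RiemannianBundle (fun x : M => TangentSpace 𝓘(ℝ, V) x)]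
  {Γ : Type*} [Group Γ] [TopologicalSpace Γ] [IsTopologicalGroup Γ] [CompactSpace Γ]
  [MulAction Γ M] [IsIsometricAction V M Γ] [ContinuousSMul Γ (Cosphere V M)]
  [LocallyCompactSpace (Cosphere V M)] [T2Space (Cosphere V M)]

variable (Γ) in
/-- Evaluation of invariant functions at a point of the cosphere bundle. -/
def evalCharacter (ξ : Cosphere V M) : invariantFunctions V M Γ →⋆ₙₐ[ℂ] ℂ where
  toFun z := z.1 ξ
  map_smul' _ _ := rfl
  map_zero' := rfl
  map_add' _ _ := rfl
  map_mul' _ _ := rfl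
  map_star' _ := rfl

theorem exists_invariantFunctions_apply_ne_zero (ξ : Cosphere V M) :
    ∃ z : invariantFunctions V M Γ, z.1 ξ ≠ 0 := by
  obtain ⟨z, hz, -⟩ := exists_invariantFunctions_ne_zero (Γ := Γ) isOpen_univ
    (fun _ _ _ => trivial) (Set.mem_univ ξ)
  exact ⟨z, hz⟩

variable (Γ) in
/-- The primitive ideal of invariant functions vanishing at a point. -/
def pointPrim (ξ : Cosphere V M) : Prim (invariantFunctions V M Γ) :=
  ⟨TwoSidedIdeal.ker (evalCharacter Γ ξ),
    isPrimitiveIdeal_ker_character _ (exists_invariantFunctions_apply_ne_zero ξ)⟩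

theorem mem_pointPrim {ξ : Cosphere V M} {z : invariantFunctions V M Γ} :
    z ∈ (pointPrim Γ ξ).1 ↔ z.1 ξ = 0 :=
  TwoSidedIdeal.mem_ker _

theorem pointPrim_smul (γ : Γ) (ξ : Cosphere V M) : pointPrim Γ (γ • ξ) = pointPrim Γ ξ := by
  apply Subtype.ext
  ext z
  rw [mem_pointPrim, mem_pointPrim, z.2 γ ξ]

variable (V M Γ) in
/-- The map `S*M / Γ → Prim (Z_M)`. -/
def orbitPrim : MulAction.orbitRel.Quotient Γ (Cosphere V M) → Prim (invariantFunctions V M Γ) :=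
  Quotient.lift (pointPrim Γ) (by
    rintro _ ξ ⟨γ, rfl⟩
    exact pointPrim_smul γ ξ)

theorem bijective_orbitPrim : Function.Bijective (orbitPrim V M Γ) := by
  constructor
  · rintro ⟨ξ⟩ ⟨η⟩ (h : pointPrim Γ ξ = pointPrim Γ η)
    exact Quotient.sound (mem_orbit_of_invariantFunctions fun z hz => by
      rwa [← mem_pointPrim, h, mem_pointPrim])
  · rintro ⟨P, H, _, _, _, r, hr, rfl⟩
    have := hr.nontrivial
    obtain ⟨c, hc⟩ := hr.exists_character (NonUnitalStarAlgHom.id ℂ _)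
      fun z w => Commute.all z w
    have hc' : ∀ z, r z = 0 ↔ c z = 0 := by
      intro z
      rw [show r z = _ from hc z, ← zero_smul ℂ (ContinuousLinearMap.id ℂ H)]
      exact smul_id_injective.eq_iff
    obtain ⟨z, hz⟩ := hr.ne_zero
    obtain ⟨ξ, hξ⟩ := character_eq_eval ⟨z, fun h => hz ((hc' z).2 h)⟩
      exists_invariantFunctions_apply_ne_zero
    refine ⟨Quotient.mk _ ξ, Subtype.ext ?_⟩
    ext w
    change w ∈ (pointPrim Γ ξ).1 ↔ _
    rw [mem_pointPrim, TwoSidedIdeal.mem_ker, hc', hξ]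

theorem continuous_orbitPrim : Continuous (orbitPrim V M Γ) := by
  refine continuous_quot_lift _ ⟨?_⟩
  rintro _ ⟨J, rfl⟩
  have h : pointPrim Γ ⁻¹' {P | ¬ J ≤ P.1} = ⋃ z ∈ J, {ξ : Cosphere V M | z.1 ξ ≠ 0} := by
    ext ξ
    simp only [Set.mem_preimage, Set.mem_ofPred_eq, Set.mem_iUnion, SetLike.not_le_iff_exists,
      mem_pointPrim, exists_prop]
  rw [h]
  exact isOpen_biUnion fun z _ => isOpen_ne_fun z.1.continuous continuous_const

theorem isOpenMap_orbitPrim : IsOpenMap (orbitPrim V M Γ) := by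
  intro U hU
  let p : Cosphere V M → MulAction.orbitRel.Quotient Γ (Cosphere V M) := Quotient.mk _
  have hp : IsOpen (p ⁻¹' U) := hU.preimage continuous_quot_mk
  have hpinv : ∀ (γ : Γ) ξ, γ • ξ ∈ p ⁻¹' U → ξ ∈ p ⁻¹' U := by
    intro γ ξ h
    have : p (γ • ξ) = p ξ := Quotient.sound ⟨γ, rfl⟩
    rwa [Set.mem_preimage, this] at h
  -- the ideal of functions that vanish outside `U`
  let J : TwoSidedIdeal (invariantFunctions V M Γ) := ⨅ ξ : {ξ // p ξ ∉ U}, (pointPrim Γ ξ.1).1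
  refine ⟨J, ?_⟩
  ext P
  obtain ⟨⟨ξ⟩, rfl⟩ := bijective_orbitPrim.2 P
  change orbitPrim V M Γ (p ξ) ∈ _ ↔ ¬ J ≤ (pointPrim Γ ξ).1
  rw [bijective_orbitPrim.1.mem_set_image]
  constructor
  · intro h hJ
    obtain ⟨z, hz, hz'⟩ := exists_invariantFunctions_ne_zero hp hpinv h
    refine hz (mem_pointPrim.1 (hJ ((TwoSidedIdeal.mem_iInf _).2 fun η => ?_)))
    exact mem_pointPrim.2 (hz' η.1 η.2)
  · intro h
    by_contra hξ
    exact h (iInf_le (fun ξ : {ξ // p ξ ∉ U} => (pointPrim Γ ξ.1).1) ⟨ξ, hξ⟩)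

variable (V M Γ) in
/-- The homeomorphism `S*M / Γ ≃ Prim (Z_M)`. -/
def orbitPrimHomeomorph :
    MulAction.orbitRel.Quotient Γ (Cosphere V M) ≃ₜ Prim (invariantFunctions V M Γ) :=
  (Equiv.ofBijective _ bijective_orbitPrim).toHomeomorphOfContinuousOpen continuous_orbitPrim
    isOpenMap_orbitPrim

end CharacterIdeals

/-! ### The primitive ideals of the invariant symbols and the central character -/

section SymbolIdeals

variable {V : Type*} [NormedAddCommGroup V] [NormedSpace ℝ V]
  {M : Type*} [TopologicalSpace M] [ChartedSpace V M] [IsManifold 𝓘(ℝ, V) ∞ M]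
  [RiemannianBundle (fun x : M => TangentSpace 𝓘(ℝ, V) x)]
  {F : Type*} [NormedAddCommGroup F] [InnerProductSpace ℂ F] [FiniteDimensional ℂ F]
  {E : M → Type*} [TopologicalSpace (TotalSpace F E)] [∀ x, NormedAddCommGroup (E x)]
  [∀ x, InnerProductSpace ℂ (E x)] [∀ x, CompleteSpace (E x)] [FiberBundle F E]
  [VectorBundle ℂ F E] [IsSmoothHermitian V F E]
  {Γ : Type*} [Group Γ] [TopologicalSpace Γ] [IsTopologicalGroup Γ] [CompactSpace Γ]
  [MulAction Γ M] [IsIsometricAction V M Γ] [ContinuousSMul Γ (Cosphere V M)]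
  [LocallyCompactSpace (Cosphere V M)] [T2Space (Cosphere V M)]
  {𝓔 : EquivariantStructure Γ F E}

/-- The primitive ideal of invariant symbols `f` such that `f ξ` vanishes on the `ρ`-isotypical
component. -/
def SymbolPair.prim (h𝓔 : 𝓔.ContinuousAct) (p : SymbolPair V 𝓔) : Prim (invariantSymbols V 𝓔) :=
  (p.exists_prim h𝓔).choose

theorem SymbolPair.mem_prim (h𝓔 : 𝓔.ContinuousAct) {p : SymbolPair V 𝓔}
    {f : invariantSymbols V 𝓔} :
    f ∈ (p.prim h𝓔).1 ↔ KillsIntertwiners (fiberRep 𝓔 p.pt) p.rho (f.1 p.pt) :=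
  (p.exists_prim h𝓔).choose_spec f

theorem SymbolPair.prim_eq_iff (h𝓔 : 𝓔.ContinuousAct) {p q : SymbolPair V 𝓔} :
    p.prim h𝓔 = q.prim h𝓔 ↔ p.SameOrbit q := by
  constructor
  · intro h
    exact SymbolPair.sameOrbit_of_killsIntertwiners h𝓔 fun f => by
      rw [← SymbolPair.mem_prim h𝓔, ← SymbolPair.mem_prim h𝓔, h]
  · intro h
    apply Subtype.ext
    ext f
    rw [SymbolPair.mem_prim, SymbolPair.mem_prim]
    exact ⟨h.killsIntertwiners f, ((SymbolPair.orbitSetoid V 𝓔).symm h).killsIntertwiners f⟩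

theorem exists_point_prim (P : Prim (invariantSymbols V 𝓔)) :
    ∃ ξ : Cosphere V M, ∀ f : invariantSymbols V 𝓔, f.1 ξ = 0 → f ∈ P.1 := by
  obtain ⟨P, H, _, _, _, r, hr, rfl⟩ := P
  obtain ⟨-, ξ, -, -, hξ⟩ := hr.exists_point exists_invariantFunctions_apply_ne_zero
  exact ⟨ξ, fun f hf => (TwoSidedIdeal.mem_ker r).2 (hξ f hf)⟩

theorem exists_symbolPair_prim_eq (h𝓔 : 𝓔.ContinuousAct) (P : Prim (invariantSymbols V 𝓔)) :
    ∃ p : SymbolPair V 𝓔, p.prim h𝓔 = P := by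
  obtain ⟨ξ, hξ⟩ := exists_point_prim P
  obtain ⟨s, -, -, h⟩ := exists_finite_forall_prim h𝓔 ξ
  obtain ⟨p, -, hp⟩ := h P hξ
  refine ⟨p, Subtype.ext ?_⟩
  ext f
  rw [SymbolPair.mem_prim, hp]

/-- The bijection of `Γ`-orbits of pairs onto primitive ideals. -/
def orbitPairsEquivPrim (h𝓔 : 𝓔.ContinuousAct) : OrbitPairs V 𝓔 ≃ Prim (invariantSymbols V 𝓔) :=
  Equiv.ofBijective (Quotient.lift (SymbolPair.prim h𝓔) fun _ _ h =>
    (SymbolPair.prim_eq_iff h𝓔).2 h) (by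
  constructor
  · rintro ⟨p⟩ ⟨q⟩ h
    exact Quotient.sound ((SymbolPair.prim_eq_iff h𝓔).1 h)
  · intro P
    obtain ⟨p, hp⟩ := exists_symbolPair_prim_eq h𝓔 P
    exact ⟨p.orbit, hp⟩)

theorem orbitPairsEquivPrim_orbit (h𝓔 : 𝓔.ContinuousAct) (p : SymbolPair V 𝓔) :
    orbitPairsEquivPrim h𝓔 p.orbit = p.prim h𝓔 := rfl

/-- The central character map, as the projection `Γ(ξ, ρ) ↦ Γξ`. -/
def centralCharacterMap (h𝓔 : 𝓔.ContinuousAct) (P : Prim (invariantSymbols V 𝓔)) :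
    Prim (invariantFunctions V M Γ) :=
  Quotient.lift (s := SymbolPair.orbitSetoid V 𝓔) (fun p => pointPrim Γ p.pt) (by
    rintro p q ⟨γ, hγ, -⟩
    rw [← hγ, pointPrim_smul]) ((orbitPairsEquivPrim (V := V) h𝓔).symm P)

theorem centralCharacterMap_prim (h𝓔 : 𝓔.ContinuousAct) (p : SymbolPair V 𝓔) :
    centralCharacterMap h𝓔 (p.prim h𝓔) = pointPrim Γ p.pt := by
  rw [← orbitPairsEquivPrim_orbit, centralCharacterMap, Equiv.symm_apply_apply]
  rfl

/-- The central character map is the intersection of ideals with the central subalgebra. -/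
theorem mem_centralCharacterMap (h𝓔 : 𝓔.ContinuousAct) {P : Prim (invariantSymbols V 𝓔)}
    {z : invariantFunctions V M Γ} :
    z ∈ (centralCharacterMap h𝓔 P).1 ↔ centralInclusion V 𝓔 z ∈ P.1 := by
  obtain ⟨p, rfl⟩ := exists_symbolPair_prim_eq h𝓔 P
  rw [centralCharacterMap_prim, mem_pointPrim, SymbolPair.mem_prim,
    killsIntertwiners_centralInclusion_iff]

theorem isCentralCharacterMap_centralCharacterMap (h𝓔 : 𝓔.ContinuousAct) :
    IsCentralCharacterMap (centralInclusion V 𝓔) (centralCharacterMap h𝓔) := by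
  intro H _ _ _ r hr
  have := hr.nontrivial
  obtain ⟨c, hc⟩ := hr.exists_character (centralInclusion V 𝓔)
    fun z f => commute_centralInclusion z f
  refine ⟨c, hc, ?_⟩
  ext z
  refine (mem_centralCharacterMap h𝓔).trans ((TwoSidedIdeal.mem_ker r).trans ?_)
  rw [TwoSidedIdeal.mem_ker, hc, ← zero_smul ℂ (ContinuousLinearMap.id ℂ H)]
  exact smul_id_injective.eq_iff

theorem continuous_centralCharacterMap (h𝓔 : 𝓔.ContinuousAct) :
    Continuous (centralCharacterMap (V := V) h𝓔) := by
  refine ⟨?_⟩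
  rintro _ ⟨J, rfl⟩
  have h : centralCharacterMap h𝓔 ⁻¹' {P | ¬ J ≤ P.1} =
      ⋃ z ∈ J, {P : Prim (invariantSymbols V 𝓔) | centralInclusion V 𝓔 z ∉ P.1} := by
    ext P
    simp only [Set.mem_preimage, Set.mem_ofPred_eq, Set.mem_iUnion, SetLike.not_le_iff_exists,
      mem_centralCharacterMap, exists_prop]
  rw [h]
  exact isOpen_biUnion fun z _ => isOpen_setOf_notMem_prim _

theorem finite_preimage_centralCharacterMap (h𝓔 : 𝓔.ContinuousAct)
    (y : Prim (invariantFunctions V M Γ)) : (centralCharacterMap h𝓔 ⁻¹' {y}).Finite := by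
  obtain ⟨⟨ξ⟩, rfl⟩ := bijective_orbitPrim.2 y
  obtain ⟨s, hs, -, h⟩ := exists_finite_forall_prim h𝓔 ξ
  refine (hs.image (SymbolPair.prim h𝓔)).subset fun P (hP : _ = pointPrim Γ ξ) => ?_
  obtain ⟨p, hp, hpP⟩ := h P fun f hf => by
    obtain ⟨z, g, rfl, hz⟩ := exists_eq_smul f
    refine P.1.mul_mem_right _ _ ((mem_centralCharacterMap h𝓔).1 ?_)
    rw [hP, mem_pointPrim]
    exact hz ξ hf
  refine ⟨p, hp, Subtype.ext ?_⟩
  ext f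
  rw [SymbolPair.mem_prim, hpP]

end SymbolIdeals

end EquivSymbol

end

theorem corollary4p2
    {V W F : Type*}
    [NormedAddCommGroup V] [NormedSpace ℝ V] [FiniteDimensional ℝ V]
    [NormedAddCommGroup W] [NormedSpace ℝ W] [FiniteDimensional ℝ W]
    [NormedAddCommGroup F] [InnerProductSpace ℂ F] [FiniteDimensional ℂ F]
    -- `M` is a Riemannian manifold
    {M : Type*} [TopologicalSpace M] [T2Space M] [ChartedSpace V M] [IsManifold 𝓘(ℝ, V) ∞ M]
    [RiemannianBundle (fun x : M => TangentSpace 𝓘(ℝ, V) x)]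
    [IsContMDiffRiemannianBundle 𝓘(ℝ, V) ∞ V (fun x : M => TangentSpace 𝓘(ℝ, V) x)]
    -- `Γ` is a compact Lie group acting smoothly and isometrically on `M`
    {Γ : Type*} [Group Γ] [TopologicalSpace Γ] [ChartedSpace W Γ] [LieGroup 𝓘(ℝ, W) ∞ Γ]
    [CompactSpace Γ] [MulAction Γ M] [ContMDiffSMul 𝓘(ℝ, W) 𝓘(ℝ, V) ∞ Γ M]
    [IsIsometricAction V M Γ]
    -- `E → M` is a smooth Hermitian vector bundle with fibres isomorphic to `F`
    {E : M → Type*} [TopologicalSpace (TotalSpace F E)] [∀ x, NormedAddCommGroup (E x)]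
    [∀ x, InnerProductSpace ℂ (E x)] [∀ x, CompleteSpace (E x)] [FiberBundle F E]
    [VectorBundle ℂ F E] [VectorBundle ℝ F E] [ContMDiffVectorBundle ∞ F E 𝓘(ℝ, V)]
    [IsSmoothHermitian V F E]
    -- the action of `Γ` on `M` is lifted to a smooth action on `E` by isometries of the fibres
    (𝓔 : EquivariantStructure Γ F E) (h𝓔 : 𝓔.IsSmooth V W) :
    ∃ (Φ : OrbitPairs V 𝓔 ≃ Prim (invariantSymbols V 𝓔))
      (Ψ : MulAction.orbitRel.Quotient Γ (Cosphere V M) ≃ₜ Prim (invariantFunctions V M Γ))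
      (χ : Prim (invariantSymbols V 𝓔) → Prim (invariantFunctions V M Γ)),
      -- `Φ (Γ(ξ, ρ)) = ker π_{ξ,ρ}`, where `π_{ξ,ρ}(f)` is the restriction of `f ξ` to the
      -- `ρ`-isotypical component of `E_x`
      (∀ (p : SymbolPair V 𝓔) (f : invariantSymbols V 𝓔),
        f ∈ (Φ p.orbit).1 ↔ ∀ v ∈ isotypic 𝓔 p.pt p.rho, f.1 p.pt v = 0) ∧
      -- `Ψ (Γ ξ)` is the ideal of functions vanishing at `ξ`
      (∀ (ξ : Cosphere V M) (z : invariantFunctions V M Γ),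
        z ∈ (Ψ (Quotient.mk _ ξ)).1 ↔ z.1 ξ = 0) ∧
      IsCentralCharacterMap (centralInclusion V 𝓔) χ ∧
      Continuous χ ∧
      (∀ y, (χ ⁻¹' {y}).Finite) ∧
      ∀ p : SymbolPair V 𝓔, χ (Φ p.orbit) = Ψ (Quotient.mk _ p.pt) := by
  have : IsTopologicalGroup Γ := topologicalGroup_of_lieGroup 𝓘(ℝ, W) ∞
  have : ContinuousSMul Γ (Cosphere V M) := continuousSMul_cosphere (W := W)
  have h : 𝓔.ContinuousAct := ContMDiff.continuous h𝓔
  refine ⟨orbitPairsEquivPrim h, orbitPrimHomeomorph V M Γ, centralCharacterMap h,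
    fun p f => (SymbolPair.mem_prim h).trans forall_mem_isotypic_iff.symm,
    fun ξ z => mem_pointPrim, isCentralCharacterMap_centralCharacterMap h,
    continuous_centralCharacterMap h, finite_preimage_centralCharacterMap h,
    fun p => centralCharacterMap_prim h p⟩
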